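/- **Setting.** A contact sub-Riemannian $3$-manifold is a connected $3$-manifold $M$ without boundary with an oriented contact plane distribution $\mathcal H$ carrying a Riemannian metric $g_h$. Let $\eta$ be the normalized contact form: $\ker\eta=\mathcal H$ and $d\eta|_{\mathcal H}$ is the area form of the oriented plane $(\mathcal H,g_h)$, with the convention $d\eta(U,V)=\tfrac12\big(U(\eta(V))-V(\eta(U))-\eta([U,V])\big)$. Let $T$ be the Reeb field ($\eta(T)=1$, $d\eta(T,\cdot)=0$), $J$ the positive $90^\circ$ rotation of $(\mathcal H,g_h)$ extended by $J(T)=0$, and $g=\langle\cdot,\cdot\rangle$ the Riemannian metric extending $g_h$ for which $T$ is a unit field orthogonal to $\mathcal H$, with Levi-Civita connection $D$. $M$ is Sasakian if the (local) diffeomorphisms of the one-parameter group of $T$ are isometries, i.e. their differentials restrict to orientation-preserving linear isometries between the planes of $(\mathcal H,g_h)$. In that case the Webster scalar curvature is $K=\tfrac14(K_h+3)$, where $K_h$ is the sectional curvature of $\mathcal H$ in $(M,g)$. Let $\Sigma$ be an oriented $C^2$ surface (without boundary) immersed in a Sasakian sub-Riemannian $3$-manifold $M$, with unit normal $N$ in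 $(M,g)$, and let $\Sigma_0$ be its singular set, i.e. the set of $p\in\Sigma$ with $T_p\Sigma=\mathcal H_p$. Put $N_h=N-\langle N,T\rangle T$ and, on $\Sigma-\Sigma_0$, $$\nu_h=\frac{N_h}{|N_h|},\qquad Z=J(\nu_h),\qquad S=\langle N,T\rangle\,\nu_h-|N_h|\,T .$$ Let $B(U)=-D_UN$ be the shape operator. The mean curvature $H$ is the function on $\Sigma-\Sigma_0$ given by $-2H=\operatorname{div}_\Sigma\nu_h=\langle D_Z\nu_h,Z\rangle+\langle D_S\nu_h,S\rangle$. For $f\in C^2(\Sigma-\Sigma_0)$ define $$\mathcal L(f)=|N_h|^{-1}\Big\{Z(Z(f))+2\,|N_h|^{-1}\langle N,T\rangle\,\langle B(Z),S\rangle\,Z(f)+\big(|B(Z)+S|^2+4(K-1)|N_h|^2\big)f\Big\}.$$ A Jacobi function on $\Sigma$ is a function $f\in C^2(\Sigma-\Sigma_0)$ with $\mathcal L(f)=0$ on $\Sigma-\Sigma_0$. **Statement.** Let $\Sigma$ be an oriented $C^2$ surface immersed in a Sasakian sub-Riemannian $3$-manifold $M$. Suppose that $\Sigma-\Sigma_0$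 is a $C^3$ surface of constant mean curvature $H$. Then the function $\psi=\langle N,T\rangle$ is a Jacobi function on $\Sigma$: $\psi\in C^2(\Sigma-\Sigma_0)$ and $\mathcal L(\psi)=0$ on $\Sigma-\Sigma_0$. -/

import Mathlib

open scoped Manifold ContDiff Topology

/-- The model space of a `3`-manifold. -/
abbrev E3 : Type := EuclideanSpace ℝ (Fin 3)

/-- The model space of a surface. -/
abbrev E2 : Type := EuclideanSpace ℝ (Fin 2)

/- The model spaces are charted on themselves by the identity chart (without this line, instance
search finds a definitionally equal but more complicated term). -/
attribute [local instance 2000] chartedSpaceSelf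

noncomputable section

/-! ### Contact sub-Riemannian `3`-manifolds -/

/-- The exterior derivative of a `1`-form `η`, evaluated on two vector fields `U`, `V`, in the
normalization usual in contact metric geometry,
`dη(U, V) = (1/2) (U(η(V)) - V(η(U)) - η([U, V]))`. -/
def extDerivOneForm {M : Type*} [TopologicalSpace M] [ChartedSpace E3 M]
    (η : ∀ x : M, TangentSpace (𝓡 3) x →L[ℝ] ℝ) (U V : ∀ x : M, TangentSpace (𝓡 3) x) (x : M) :
    ℝ :=
  let dV : ℝ := mfderiv (𝓡 3) 𝓘(ℝ, ℝ) (fun y => η y (V y)) x (U x)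
  let dU : ℝ := mfderiv (𝓡 3) 𝓘(ℝ, ℝ) (fun y => η y (U y)) x (V x)
  (1 / 2 : ℝ) * (dV - dU - η x (VectorField.mlieBracket (𝓡 3) U V x))

/-- A vector field is differentiable at a point. -/
def VFieldDiffAt {M : Type*} [TopologicalSpace M] [ChartedSpace E3 M] [IsManifold (𝓡 3) ∞ M]
    (U : ∀ x : M, TangentSpace (𝓡 3) x) (x : M) : Prop :=
  MDifferentiableAt (𝓡 3) (𝓡 3).tangent (fun y => (⟨y, U y⟩ : TangentBundle (𝓡 3) M)) x

/-- A contact sub-Riemannian structure on a `3`-manifold `M`: an oriented contact plane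
distribution `H = ker η` with a Riemannian metric `gh` on it.

* `eta` is the normalized contact form, `reeb` its Reeb vector field `T`.
* `gh` is the horizontal metric; it is carried by a smooth `2`-tensor on `M`, of which only the
  values on horizontal vectors are ever used.
* `J` is the rotation by 90 degrees in `(H, gh)`, extended by `J T = 0`. It encodes the
  orientation of `H` (the positive bases are those like `(u, J u)`), and
  `(u, v) ↦ gh (J u) v` is the area form of the oriented plane `H`.

The normalization `dη = area form` on `H` contains the contact condition. -/
structure ContactSubRiemannian (M : Type*) [TopologicalSpace M] [ChartedSpace E3 M]
    [IsManifold (𝓡 3) ∞ M] where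
  eta : ∀ x : M, TangentSpace (𝓡 3) x →L[ℝ] ℝ
  reeb : ∀ x : M, TangentSpace (𝓡 3) x
  gh : ∀ x : M, TangentSpace (𝓡 3) x →L[ℝ] TangentSpace (𝓡 3) x →L[ℝ] ℝ
  J : ∀ x : M, TangentSpace (𝓡 3) x →L[ℝ] TangentSpace (𝓡 3) x
  eta_smooth : ContMDiff (𝓡 3) ((𝓡 3).prod 𝓘(ℝ, E3 →L[ℝ] ℝ)) ∞
    (fun x => Bundle.TotalSpace.mk' (E3 →L[ℝ] ℝ)
      (E := fun x : M => TangentSpace (𝓡 3) x →L[ℝ] ℝ) x (eta x))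
  reeb_smooth : ContMDiff (𝓡 3) (𝓡 3).tangent ∞
    (fun x => (⟨x, reeb x⟩ : TangentBundle (𝓡 3) M))
  gh_smooth : ContMDiff (𝓡 3) ((𝓡 3).prod 𝓘(ℝ, E3 →L[ℝ] E3 →L[ℝ] ℝ)) ∞
    (fun x => Bundle.TotalSpace.mk' (E3 →L[ℝ] E3 →L[ℝ] ℝ)
      (E := fun x : M => TangentSpace (𝓡 3) x →L[ℝ] TangentSpace (𝓡 3) x →L[ℝ] ℝ) x (gh x))
  J_smooth : ContMDiff (𝓡 3) ((𝓡 3).prod 𝓘(ℝ, E3 →L[ℝ] E3)) ∞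
    (fun x => Bundle.TotalSpace.mk' (E3 →L[ℝ] E3)
      (E := fun x : M => TangentSpace (𝓡 3) x →L[ℝ] TangentSpace (𝓡 3) x) x (J x))
  /-- `gh` is a Riemannian metric on `H`. -/
  gh_symm : ∀ (x : M) (u v : TangentSpace (𝓡 3) x), eta x u = 0 → eta x v = 0 →
    gh x u v = gh x v u
  gh_pos : ∀ (x : M) (u : TangentSpace (𝓡 3) x), eta x u = 0 → u ≠ 0 → 0 < gh x u u
  /-- `J` is an orthogonal complex structure on `(H, gh)` and kills `T`. -/
  J_reeb : ∀ x : M, J x (reeb x) = 0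
  J_horizontal : ∀ (x : M) (u : TangentSpace (𝓡 3) x), eta x u = 0 → eta x (J x u) = 0
  J_sq : ∀ (x : M) (u : TangentSpace (𝓡 3) x), eta x u = 0 → J x (J x u) = -u
  J_isometry : ∀ (x : M) (u v : TangentSpace (𝓡 3) x), eta x u = 0 → eta x v = 0 →
    gh x (J x u) (J x v) = gh x u v
  /-- `dη` restricted to `H` is the area form of the oriented plane `(H, gh)`. -/
  normalized : ∀ (x : M) (U V : ∀ y : M, TangentSpace (𝓡 3) y),
    VFieldDiffAt U x → VFieldDiffAt V x → eta x (U x) = 0 → eta x (V x) = 0 →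
    extDerivOneForm eta U V x = gh x (J x (U x)) (V x)
  /-- The Reeb vector field: `η(T) = 1` and `dη(T, ·) = 0`. -/
  eta_reeb : ∀ x : M, eta x (reeb x) = 1
  extDeriv_reeb : ∀ (x : M) (U : ∀ y : M, TangentSpace (𝓡 3) y),
    VFieldDiffAt U x → extDerivOneForm eta reeb U x = 0

namespace ContactSubRiemannian

variable {M : Type*} [TopologicalSpace M] [ChartedSpace E3 M] [IsManifold (𝓡 3) ∞ M]

/-- The horizontal projection `u ↦ u_h = u - η(u) T`. -/
def horiz (C : ContactSubRiemannian M) (x : M) (u : TangentSpace (𝓡 3) x) :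
    TangentSpace (𝓡 3) x :=
  u - C.eta x u • C.reeb x

/-- The canonical extension `g` of `gh`: it extends `gh`, and `T` is a unit field orthogonal
to `H`. -/
def g (C : ContactSubRiemannian M) (x : M) (u v : TangentSpace (𝓡 3) x) : ℝ :=
  C.gh x (C.horiz x u) (C.horiz x v) + C.eta x u * C.eta x v

/-- The structure is Sasakian: the (local) one-parameter group of diffeomorphisms generated by
`T` acts by isometries, i.e. the differentials `dΦ_s` map `H` to `H` and restrict to
orientation-preserving linear isometries (isometries that commute with `J`). -/
def IsSasakian (C : ContactSubRiemannian M) : Prop :=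
  ∀ x : M, ∃ (W : Set M) (ε : ℝ) (Φ : ℝ → M → M),
    IsOpen W ∧ x ∈ W ∧ 0 < ε ∧
    ContMDiffOn (𝓘(ℝ, ℝ).prod (𝓡 3)) (𝓡 3) ∞ (fun q : ℝ × M => Φ q.1 q.2)
      (Set.Ioo (-ε) ε ×ˢ W) ∧
    (∀ y ∈ W, Φ 0 y = y) ∧
    (∀ y ∈ W, IsMIntegralCurveOn (I := 𝓡 3) (fun s => Φ s y) C.reeb (Set.Ioo (-ε) ε)) ∧
    ∀ s ∈ Set.Ioo (-ε) ε, ∀ y ∈ W, ∀ u v : TangentSpace (𝓡 3) y,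
      C.eta y u = 0 → C.eta y v = 0 →
        C.eta (Φ s y) (mfderiv (𝓡 3) (𝓡 3) (Φ s) y u) = 0 ∧
        C.gh (Φ s y) (mfderiv (𝓡 3) (𝓡 3) (Φ s) y u) (mfderiv (𝓡 3) (𝓡 3) (Φ s) y v)
          = C.gh y u v ∧
        mfderiv (𝓡 3) (𝓡 3) (Φ s) y (C.J y u)
          = C.J (Φ s y) (mfderiv (𝓡 3) (𝓡 3) (Φ s) y u)

/-! ### The Levi-Civita connection and the curvature of `g` in a chart

`e` is a smooth chart of `M`, with values in `E3`. The geometric objects below that carry `e` as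
an argument are computed in the coordinates given by `e`; as usual their values at a point do not
depend on the chart chosen around that point. -/

/-- The metric `g` in the coordinates of `e`. -/
def gCoord (C : ContactSubRiemannian M) (e : OpenPartialHomeomorph M E3) (y u v : E3) : ℝ :=
  C.g (e.symm y) (mfderiv (𝓡 3) (𝓡 3) e.symm y u) (mfderiv (𝓡 3) (𝓡 3) e.symm y v)

/-- The Christoffel symbols of the first kind, as a trilinear expression:
`g(D_u v, w) = (1/2) (∂_u g(v, w) + ∂_v g(u, w) - ∂_w g(u, v))` for constant `u`, `v`, `w`. -/
def christoffelFirst (C : ContactSubRiemannian M) (e : OpenPartialHomeomorph M E3)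
    (y u v w : E3) : ℝ :=
  (1 / 2 : ℝ) * (fderiv ℝ (fun z => C.gCoord e z v w) y u
    + fderiv ℝ (fun z => C.gCoord e z u w) y v - fderiv ℝ (fun z => C.gCoord e z u v) y w)

/-- The standard coordinate vectors of `E3`. -/
def basisVec (i : Fin 3) : E3 := EuclideanSpace.single i (1 : ℝ)

/-- The Christoffel symbols of the second kind, as a bilinear expression: `Γ(u, v) = D_u v` for
constant vector fields `u`, `v` in the coordinates of `e`. -/
def christoffel (C : ContactSubRiemannian M) (e : OpenPartialHomeomorph M E3) (y u v : E3) : E3 :=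
  ∑ k : Fin 3, (∑ l : Fin 3,
    (Matrix.of fun i j : Fin 3 => C.gCoord e y (basisVec i) (basisVec j))⁻¹ k l
      * C.christoffelFirst e y u v (basisVec l)) • basisVec k

/-- The curvature tensor `R(u, v) w = D_u D_v w - D_v D_u w - D_[u,v] w` in coordinates. -/
def curvature (C : ContactSubRiemannian M) (e : OpenPartialHomeomorph M E3) (y u v w : E3) : E3 :=
  fderiv ℝ (fun z => C.christoffel e z v w) y u - fderiv ℝ (fun z => C.christoffel e z u w) y v
    + C.christoffel e y u (C.christoffel e y v w) - C.christoffel e y v (C.christoffel e y u w)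

/-- The sectional curvature in `(M, g)` of the plane spanned by `u`, `v`, computed in `e`. -/
def sectionalCurvature (C : ContactSubRiemannian M) (e : OpenPartialHomeomorph M E3) (x : M)
    (u v : TangentSpace (𝓡 3) x) : ℝ :=
  let u' : E3 := mfderiv (𝓡 3) (𝓡 3) e x u
  let v' : E3 := mfderiv (𝓡 3) (𝓡 3) e x v
  C.gCoord e (e x) (C.curvature e (e x) u' v' v') u'
    / (C.g x u u * C.g x v v - C.g x u v ^ 2)

/-- The Webster scalar curvature `K = (K_h + 3) / 4`, where `K_h` is the sectional curvature of
the plane `H` in `(M, g)`; the plane is presented by the basis `(u, J u)` for some nonzero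
horizontal `u` (the value does not depend on `u`). -/
def websterCurvature (C : ContactSubRiemannian M) (e : OpenPartialHomeomorph M E3) (x : M) : ℝ :=
  let u : TangentSpace (𝓡 3) x := Classical.epsilon fun u => C.eta x u = 0 ∧ u ≠ 0
  (1 / 4 : ℝ) * (C.sectionalCurvature e x u (C.J x u) + 3)

end ContactSubRiemannian

/-! ### Surfaces -/

/-- An oriented `C²` surface immersed in `M`. As `M` is oriented, the orientation of the surface is
given by a continuous unit normal `N` along the immersion `φ`. -/
structure OrientedSurface {M : Type*} [TopologicalSpace M] [ChartedSpace E3 M]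
    [IsManifold (𝓡 3) ∞ M] (C : ContactSubRiemannian M)
    (Sig : Type*) [TopologicalSpace Sig] [ChartedSpace E2 Sig] where
  φ : Sig → M
  contMDiff : ContMDiff (𝓡 2) (𝓡 3) 2 φ
  immersion : ∀ p : Sig, Function.Injective (mfderiv (𝓡 2) (𝓡 3) φ p)
  N : ∀ p : Sig, TangentSpace (𝓡 3) (φ p)
  N_continuous : Continuous fun p => (⟨φ p, N p⟩ : TangentBundle (𝓡 3) M)
  N_unit : ∀ p : Sig, C.g (φ p) (N p) (N p) = 1
  N_normal : ∀ (p : Sig) (v : TangentSpace (𝓡 2) p),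
    C.g (φ p) (N p) (mfderiv (𝓡 2) (𝓡 3) φ p v) = 0

namespace OrientedSurface

variable {M : Type*} [TopologicalSpace M] [ChartedSpace E3 M] [IsManifold (𝓡 3) ∞ M]
  {C : ContactSubRiemannian M} {Sig : Type*} [TopologicalSpace Sig] [ChartedSpace E2 Sig]

/-- The singular set `Σ₀`: the points where the tangent plane is horizontal. -/
def singularSet (F : OrientedSurface C Sig) : Set Sig :=
  {p | Set.range (mfderiv (𝓡 2) (𝓡 3) F.φ p) = {u | C.eta (F.φ p) u = 0}}

/-- `Σ - Σ₀` is a `C³` surface: around each of its points there is a parametrization, compatible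
with the `C²` structure of `Σ`, for which the immersion is of class `C³`. -/
def IsC3OffSingularSet (F : OrientedSurface C Sig) : Prop :=
  ∀ p ∉ F.singularSet, ∃ c ∈ IsManifold.maximalAtlas (𝓡 2) 2 Sig,
    p ∈ c.source ∧ ContMDiffOn (𝓡 2) (𝓡 3) 3 (F.φ ∘ c.symm) c.target

/-- The function `⟨N, T⟩`. -/
def normalReeb (F : OrientedSurface C Sig) (p : Sig) : ℝ :=
  C.g (F.φ p) (F.N p) (C.reeb (F.φ p))

/-- `N_h = N - ⟨N, T⟩ T`. -/
def Nh (F : OrientedSurface C Sig) (p : Sig) : TangentSpace (𝓡 3) (F.φ p) :=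
  F.N p - F.normalReeb p • C.reeb (F.φ p)

/-- `|N_h|`. -/
def normNh (F : OrientedSurface C Sig) (p : Sig) : ℝ :=
  √(C.g (F.φ p) (F.Nh p) (F.Nh p))

/-- The horizontal Gauss map `ν_h = N_h / |N_h|`. -/
def nu (F : OrientedSurface C Sig) (p : Sig) : TangentSpace (𝓡 3) (F.φ p) :=
  (F.normNh p)⁻¹ • F.Nh p

/-- The characteristic vector field `Z = J(ν_h)`. -/
def Z (F : OrientedSurface C Sig) (p : Sig) : TangentSpace (𝓡 3) (F.φ p) :=
  C.J (F.φ p) (F.nu p)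

/-- `S = ⟨N, T⟩ ν_h - |N_h| T`. -/
def S (F : OrientedSurface C Sig) (p : Sig) : TangentSpace (𝓡 3) (F.φ p) :=
  F.normalReeb p • F.nu p - F.normNh p • C.reeb (F.φ p)

/-- The vector of `T_pΣ` corresponding to a vector of `T_{φ(p)}M` tangent to the surface. -/
def lift (F : OrientedSurface C Sig) (p : Sig) (u : TangentSpace (𝓡 3) (F.φ p)) :
    TangentSpace (𝓡 2) p :=
  Function.invFun (mfderiv (𝓡 2) (𝓡 3) F.φ p) u

/-- `Z(f)`, the derivative of a function on the surface along `Z`. -/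
def derivZ (F : OrientedSurface C Sig) (f : Sig → ℝ) (p : Sig) : ℝ :=
  mfderiv (𝓡 2) 𝓘(ℝ, ℝ) f p (F.lift p (F.Z p))

/-- The covariant derivative `D_v X` of a vector field `X` along the immersion, for the Levi-Civita
connection of `g` and `v` tangent to the surface at `p`, computed in the chart `e`: the coordinate
vector of `D_v X` is `v(X̂) + Γ(v, X̂)`, where `X̂` is the coordinate vector of `X`. -/
def covDeriv (F : OrientedSurface C Sig) (e : OpenPartialHomeomorph M E3)
    (X : ∀ p : Sig, TangentSpace (𝓡 3) (F.φ p)) (p : Sig) (v : TangentSpace (𝓡 3) (F.φ p)) :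
    TangentSpace (𝓡 3) (F.φ p) :=
  let Xc : Sig → E3 := fun q => mfderiv (𝓡 3) (𝓡 3) e (F.φ q) (X q)
  let vc : E3 := mfderiv (𝓡 3) (𝓡 3) e (F.φ p) v
  let vX : E3 := mfderiv (𝓡 2) 𝓘(ℝ, E3) Xc p (F.lift p v)
  mfderiv (𝓡 3) (𝓡 3) e.symm (e (F.φ p)) (vX + C.christoffel e (e (F.φ p)) vc (Xc p))

/-- The shape operator `B(v) = -D_v N`. -/
def shape (F : OrientedSurface C Sig) (e : OpenPartialHomeomorph M E3) (p : Sig)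
    (v : TangentSpace (𝓡 3) (F.φ p)) : TangentSpace (𝓡 3) (F.φ p) :=
  -F.covDeriv e F.N p v

/-- The mean curvature `H`: `-2H = div_Σ ν_h = ⟨D_Z ν_h, Z⟩ + ⟨D_S ν_h, S⟩`. -/
def meanCurvature (F : OrientedSurface C Sig) (e : OpenPartialHomeomorph M E3) (p : Sig) : ℝ :=
  -(1 / 2 : ℝ) * (C.g (F.φ p) (F.covDeriv e F.nu p (F.Z p)) (F.Z p)
    + C.g (F.φ p) (F.covDeriv e F.nu p (F.S p)) (F.S p))

/-- The mean curvature is constant, equal to `H`, on `Σ - Σ₀`. -/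
def HasConstantMeanCurvature (F : OrientedSurface C Sig) (H : ℝ) : Prop :=
  ∀ p ∉ F.singularSet, ∀ e ∈ IsManifold.maximalAtlas (𝓡 3) ∞ M, F.φ p ∈ e.source →
    F.meanCurvature e p = H

/-- The sub-Riemannian Jacobi operator
`𝓛(f) = |N_h|⁻¹ {Z(Z(f)) + 2 |N_h|⁻¹ ⟨N, T⟩ ⟨B(Z), S⟩ Z(f)
  + (|B(Z) + S|² + 4 (K - 1) |N_h|²) f}`. -/
def jacobiOperator (F : OrientedSurface C Sig) (e : OpenPartialHomeomorph M E3) (f : Sig → ℝ)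
    (p : Sig) : ℝ :=
  let BZ := F.shape e p (F.Z p)
  (F.normNh p)⁻¹ *
    (F.derivZ (F.derivZ f) p
      + 2 * (F.normNh p)⁻¹ * F.normalReeb p * C.g (F.φ p) BZ (F.S p) * F.derivZ f p
      + (C.g (F.φ p) (BZ + F.S p) (BZ + F.S p)
          + 4 * (C.websterCurvature e (F.φ p) - 1) * F.normNh p ^ 2) * f p)

/-- A (sub-Riemannian) Jacobi function: `f ∈ C²(Σ - Σ₀)` with `𝓛(f) = 0` on `Σ - Σ₀`. -/
def IsJacobiFunction (F : OrientedSurface C Sig) (f : Sig → ℝ) : Prop :=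
  ContMDiffOn (𝓡 2) 𝓘(ℝ, ℝ) 2 f F.singularSetᶜ ∧
  ∀ p ∉ F.singularSet, ∀ e ∈ IsManifold.maximalAtlas (𝓡 3) ∞ M, F.φ p ∈ e.source →
    F.jacobiOperator e f p = 0

end OrientedSurface

end

/-! The claim is local, so charts replace M by a Sasakian structure on an open subset of ℝ³
(`SasakianChart`) and the regular part of Σ by a parametrized surface with an adapted frame
(`FramedSurface`). The Sasakian condition makes T a Killing field; combined with the formula for dη
this gives D_v T = J v (`cov_T`), the structural identity behind every computation.

Off the singular set put h = |N_h|, ψ = ⟨N, T⟩ and u = ψ / h. The tangent plane is spanned by Z and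
W = T - uν, and S = -hW. The frame ν, Z, T is orthonormal and DT = J, so its derivatives along Σ are
known except for two coefficients. The first, ⟨D_Z Z, ν⟩, is 2H, because ⟨D_S ν, S⟩ = 0
(`meanCurvature_eq`). The second, ⟨D_W Z, ν⟩, is forced to be -1 - Z(u) - 2u² by the tangency of [Z,
W], and then [Z, W] = 2Hu Z - 2u W (`lieBracket_z_w`). Put these into R(Z, W)Z = D_Z D_W Z - D_W D_Z
Z - D_[Z,W] Z and take the ν-component. As H is constant and ⟨R(Z, T)Z, ν⟩ = 0 (a consequence of
`inner_Rm_T`), the result is Z(Z(u)) + 6u Z(u) + 4u³ + 4H²u + (K_h + 3)u = 0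
(`second_order_equation`). From h² + ψ² = 1 follows Z(ψ) = h³ Z(u), and the brace in 𝓛(ψ) turns out
to be h³ times the left side above (`jacobi_equation`).

Regularity is tight: the normal is only assumed continuous, but on a C³ surface it is C²
(`contDiffAt_unit_normal`). Hence ψ, ν and Z are C², which is what the symmetry of second
derivatives in `cov_curvature` requires. The rest is translation: the Killing equation is extracted
from the Reeb flow (`lieDeriv_gChart`), and the coordinate formulas for connection and curvature are
matched with invariant ones (`christoffel_eq`, `websterCurvature_eq`). -/

set_option maxSynthPendingDepth 3
set_option linter.unusedSectionVars false

noncomputable section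

/-! ### Riemannian metrics on open subsets of a vector space -/

/-- A Riemannian metric on an open subset of `V`. -/
structure MetricChart (V : Type*) [NormedAddCommGroup V] [NormedSpace ℝ V] where
  Ω : Set V
  isOpen : IsOpen Ω
  G : V → V →L[ℝ] V →L[ℝ] ℝ
  smooth : ContDiffOn ℝ ∞ G Ω
  symm : ∀ y ∈ Ω, ∀ u v, G y u v = G y v u
  pos : ∀ y ∈ Ω, ∀ u, u ≠ 0 → 0 < G y u u

namespace MetricChart

variable {V : Type*} [NormedAddCommGroup V] [NormedSpace ℝ V] (A : MetricChart V)

/-- The Christoffel symbols of the first kind. -/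
def koszul (y : V) : V →L[ℝ] V →L[ℝ] V →L[ℝ] ℝ :=
  (1 / 2 : ℝ) • (fderiv ℝ A.G y + (fderiv ℝ A.G y).flip
    - ((ContinuousLinearMap.flipₗᵢ ℝ V V ℝ).toContinuousLinearEquiv.toContinuousLinearMap ∘L
      (fderiv ℝ A.G y).flip))

theorem koszul_apply (y u v w : V) :
    A.koszul y u v w = (1 / 2 : ℝ) *
      (fderiv ℝ A.G y u v w + fderiv ℝ A.G y v u w - fderiv ℝ A.G y w u v) := by
  simp [koszul]

/-- The Christoffel symbols of the second kind. -/
def Γ (y : V) : V →L[ℝ] V →L[ℝ] V :=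
  (ContinuousLinearMap.compL ℝ V (V →L[ℝ] ℝ) V (A.G y).inverse) ∘L A.koszul y

variable {A} {y : V}

theorem ext_of_inner (hy : y ∈ A.Ω) {u v : V} (h : ∀ w, A.G y u w = A.G y v w) : u = v := by
  by_contra hne
  have := A.pos y hy (u - v) (sub_ne_zero.2 hne)
  rw [map_sub] at this
  simp [h] at this

theorem isInvertible_G [FiniteDimensional ℝ V] (hy : y ∈ A.Ω) : (A.G y).IsInvertible := by
  have hinj : Function.Injective (A.G y : V →ₗ[ℝ] (V →L[ℝ] ℝ)) := fun u v h =>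
    ext_of_inner hy fun w => DFunLike.congr_fun h w
  have hdim : Module.finrank ℝ V = Module.finrank ℝ (V →L[ℝ] ℝ) := by
    rw [(LinearMap.toContinuousLinearMap : (V →ₗ[ℝ] ℝ) ≃ₗ[ℝ] _).symm.finrank_eq]
    exact (Subspace.dual_finrank_eq).symm
  refine ⟨(LinearEquiv.ofInjectiveOfFinrankEq (A.G y : V →ₗ[ℝ] _) hinj hdim).toContinuousLinearEquiv, ?_⟩
  ext u v
  rfl

variable [FiniteDimensional ℝ V]

theorem G_Γ (hy : y ∈ A.Ω) (u v w : V) : A.G y (A.Γ y u v) w = A.koszul y u v w := by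
  obtain ⟨e, he⟩ := isInvertible_G hy
  have : A.G y (A.Γ y u v) = A.koszul y u v := by
    simp [Γ, ← he]
  rw [this]

theorem differentiableAt_G (hy : y ∈ A.Ω) : DifferentiableAt ℝ A.G y :=
  (A.smooth.contDiffAt (A.isOpen.mem_nhds hy)).differentiableAt (by simp)

theorem fderiv_G_apply (hy : y ∈ A.Ω) (u v w : V) :
    fderiv ℝ (fun z => A.G z v w) y u = fderiv ℝ A.G y u v w := by
  have h := (((differentiableAt_G hy).hasFDerivAt.clm_apply (hasFDerivAt_const v y)).clm_apply
    (hasFDerivAt_const w y)).fderiv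
  rw [h]; simp

theorem fderiv_G_symm (hy : y ∈ A.Ω) (u v w : V) :
    fderiv ℝ A.G y u v w = fderiv ℝ A.G y u w v := by
  rw [← fderiv_G_apply hy, ← fderiv_G_apply hy]
  have : (fun z => A.G z v w) =ᶠ[𝓝 y] (fun z => A.G z w v) := by
    filter_upwards [A.isOpen.mem_nhds hy] with z hz using A.symm z hz v w
  rw [this.fderiv_eq]

theorem Γ_symm (hy : y ∈ A.Ω) (u v : V) : A.Γ y u v = A.Γ y v u := by
  refine ext_of_inner hy fun w => ?_
  rw [G_Γ hy, G_Γ hy, koszul_apply, koszul_apply, fderiv_G_symm hy w u v]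
  ring

theorem metric_compat (hy : y ∈ A.Ω) (u v w : V) :
    fderiv ℝ A.G y u v w = A.G y (A.Γ y u v) w + A.G y v (A.Γ y u w) := by
  rw [A.symm y hy v, G_Γ hy, G_Γ hy, koszul_apply, koszul_apply, fderiv_G_symm hy u w v,
    fderiv_G_symm hy v u w, fderiv_G_symm hy w u v]
  ring

theorem contDiffOn_koszul : ContDiffOn ℝ ∞ A.koszul A.Ω := by
  have h : ContDiffOn ℝ ∞ (fderiv ℝ A.G) A.Ω :=
    A.smooth.fderiv_of_isOpen A.isOpen (by simp)
  refine contDiffOn_clm_apply.2 fun u => contDiffOn_clm_apply.2 fun v =>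
    contDiffOn_clm_apply.2 fun w => ?_
  simp only [koszul_apply]
  have h' : ∀ a b c : V, ContDiffOn ℝ ∞ (fun z => fderiv ℝ A.G z a b c) A.Ω := fun a b c =>
    ((h.clm_apply contDiffOn_const).clm_apply contDiffOn_const).clm_apply contDiffOn_const
  exact contDiffOn_const.mul (((h' _ _ _).add (h' _ _ _)).sub (h' _ _ _))

theorem contDiffOn_Γ : ContDiffOn ℝ ∞ A.Γ A.Ω := by
  have : CompleteSpace V := FiniteDimensional.complete ℝ V
  -- Inversion of continuous linear maps is smooth at invertible ones, and `G` is invertible on Ω by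
  -- positivity.
  have hinv : ContDiffOn ℝ ∞ (fun y => (A.G y).inverse) A.Ω := by
    intro y hy
    obtain ⟨e, he⟩ := isInvertible_G hy
    have h1 := contDiffAt_map_inverse (𝕜 := ℝ) (n := ∞) e
    rw [he] at h1
    exact h1.comp_contDiffWithinAt y (A.smooth y hy)
  exact ((ContinuousLinearMap.contDiff _).comp_contDiffOn hinv).clm_comp contDiffOn_koszul

theorem contDiffAt_Γ (hy : y ∈ A.Ω) : ContDiffAt ℝ ∞ A.Γ y :=
  contDiffOn_Γ.contDiffAt (A.isOpen.mem_nhds hy)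

theorem differentiableAt_Γ (hy : y ∈ A.Ω) : DifferentiableAt ℝ A.Γ y :=
  (contDiffAt_Γ hy).differentiableAt (by simp)

/-! ### Curvature and covariant differentiation along maps -/

variable (A) in
/-- The curvature tensor. -/
def Rm (y u v w : V) : V :=
  fderiv ℝ A.Γ y u v w - fderiv ℝ A.Γ y v u w + A.Γ y u (A.Γ y v w) - A.Γ y v (A.Γ y u w)

variable {E : Type*} [NormedAddCommGroup E] [NormedSpace ℝ E]

variable (A) in
/-- The covariant derivative along `x` of a vector field `X` along `x`. -/
def cov (x X : E → V) (q : E) : E →L[ℝ] V :=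
  fderiv ℝ X q + ((A.Γ (x q)).flip (X q)) ∘L fderiv ℝ x q

theorem cov_apply (x X : E → V) (q v : E) :
    A.cov x X q v = fderiv ℝ X q v + A.Γ (x q) (fderiv ℝ x q v) (X q) := by
  simp [cov]

variable {x X Y : E → V} {q : E}

theorem cov_congr (h : X =ᶠ[𝓝 q] Y) : A.cov x X q = A.cov x Y q := by
  simp only [cov, h.fderiv_eq, h.eq_of_nhds]

theorem cov_add (hX : DifferentiableAt ℝ X q) (hY : DifferentiableAt ℝ Y q) (v : E) :
    A.cov x (fun p => X p + Y p) q v = A.cov x X q v + A.cov x Y q v := by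
  simp only [cov_apply, fderiv_fun_add hX hY, map_add, add_apply]
  abel

theorem cov_sub (hX : DifferentiableAt ℝ X q) (hY : DifferentiableAt ℝ Y q) (v : E) :
    A.cov x (fun p => X p - Y p) q v = A.cov x X q v - A.cov x Y q v := by
  simp only [cov_apply, fderiv_fun_sub hX hY, map_sub, sub_apply]
  abel

theorem cov_smul {f : E → ℝ} (hf : DifferentiableAt ℝ f q) (hX : DifferentiableAt ℝ X q) (v : E) :
    A.cov x (fun p => f p • X p) q v = fderiv ℝ f q v • X q + f q • A.cov x X q v := by
  simp only [cov_apply, fderiv_fun_smul hf hX, map_smul, smul_add, add_apply, smul_apply,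
    ContinuousLinearMap.smulRight_apply]
  abel

theorem hasFDerivAt_inner (hy : x q ∈ A.Ω) (hx : DifferentiableAt ℝ x q)
    (hX : DifferentiableAt ℝ X q) (hY : DifferentiableAt ℝ Y q) (v : E) :
    fderiv ℝ (fun p => A.G (x p) (X p) (Y p)) q v
      = A.G (x q) (A.cov x X q v) (Y q) + A.G (x q) (X q) (A.cov x Y q v) := by
  have h1 : HasFDerivAt (fun p => A.G (x p)) ((fderiv ℝ A.G (x q)) ∘L fderiv ℝ x q) q :=
    HasFDerivAt.comp (F := V) (G := V →L[ℝ] V →L[ℝ] ℝ) q (differentiableAt_G hy).hasFDerivAt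
      hx.hasFDerivAt
  rw [((h1.clm_apply hX.hasFDerivAt).clm_apply hY.hasFDerivAt).fderiv]
  simp only [add_apply, ContinuousLinearMap.comp_apply, ContinuousLinearMap.flip_apply, cov_apply,
    map_add, metric_compat hy]
  ring

theorem differentiableAt_cov (hy : x q ∈ A.Ω) (hx : ContDiffAt ℝ 2 x q)
    (hX : ContDiffAt ℝ 2 X q) : DifferentiableAt ℝ (A.cov x X) q := by
  have h1 : DifferentiableAt ℝ (fderiv ℝ X) q :=
    (hX.fderiv_right (m := 1) (by norm_num)).differentiableAt (by norm_num)
  have h2 : DifferentiableAt ℝ (fderiv ℝ x) q :=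
    (hx.fderiv_right (m := 1) (by norm_num)).differentiableAt (by norm_num)
  have h3 : DifferentiableAt ℝ (fun p => A.Γ (x p)) q :=
    DifferentiableAt.comp (F := V) (G := V →L[ℝ] V →L[ℝ] V) q (differentiableAt_Γ hy)
      (hx.differentiableAt (by norm_num))
  have h4 : DifferentiableAt ℝ (fun p => (A.Γ (x p)).flip) q :=
    DifferentiableAt.comp (g := ContinuousLinearMap.flipₗᵢ ℝ V V V) q
      (ContinuousLinearMap.flipₗᵢ ℝ V V V).toContinuousLinearEquiv.differentiableAt h3
  exact h1.add ((h4.clm_apply (hX.differentiableAt (by norm_num))).clm_comp h2)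

/-- The second derivatives of `x` cancel by symmetry and the Christoffel terms by `Γ_symm`; only the
derivatives of the coefficients `a`, `b` survive, and they form the bracket. -/
theorem cov_torsion {a b : E → E} (hy : x q ∈ A.Ω) (hx : ContDiffAt ℝ 2 x q)
    (ha : DifferentiableAt ℝ a q) (hb : DifferentiableAt ℝ b q) :
    A.cov x (fun p => fderiv ℝ x p (b p)) q (a q) - A.cov x (fun p => fderiv ℝ x p (a p)) q (b q)
      = fderiv ℝ x q (VectorField.lieBracket ℝ a b q) := by
  have h2 : HasFDerivAt (fderiv ℝ x) (fderiv ℝ (fderiv ℝ x) q) q :=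
    ((hx.fderiv_right (m := 1) (by norm_num)).differentiableAt (by norm_num)).hasFDerivAt
  have hs : IsSymmSndFDerivAt ℝ x q := hx.isSymmSndFDerivAt (by simp)
  simp only [cov_apply, (h2.clm_apply ha.hasFDerivAt).fderiv, (h2.clm_apply hb.hasFDerivAt).fderiv,
    VectorField.lieBracket, map_sub, add_apply, ContinuousLinearMap.comp_apply,
    ContinuousLinearMap.flip_apply, hs.eq (a q) (b q), Γ_symm hy (fderiv ℝ x q (a q))]
  abel

/-- Symmetry of the second derivatives of both `x` and `X` removes all second-order terms, and the
derivatives of `a`, `b` are absorbed by the bracket. What is left is tensorial. The field `X` has to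
be given only along `x`. -/
theorem cov_curvature {a b : E → E} (hy : x q ∈ A.Ω) (hx : ContDiffAt ℝ 2 x q)
    (hX : ContDiffAt ℝ 2 X q) (ha : DifferentiableAt ℝ a q) (hb : DifferentiableAt ℝ b q) :
    A.cov x (fun p => A.cov x X p (b p)) q (a q) - A.cov x (fun p => A.cov x X p (a p)) q (b q)
        - A.cov x X q (VectorField.lieBracket ℝ a b q)
      = A.Rm (x q) (fderiv ℝ x q (a q)) (fderiv ℝ x q (b q)) (X q) := by
  have h1 : HasFDerivAt (fderiv ℝ X) (fderiv ℝ (fderiv ℝ X) q) q :=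
    ((hX.fderiv_right (m := 1) (by norm_num)).differentiableAt (by norm_num)).hasFDerivAt
  have h2 : HasFDerivAt (fderiv ℝ x) (fderiv ℝ (fderiv ℝ x) q) q :=
    ((hx.fderiv_right (m := 1) (by norm_num)).differentiableAt (by norm_num)).hasFDerivAt
  have h3 : HasFDerivAt (fun p => A.Γ (x p)) ((fderiv ℝ A.Γ (x q)) ∘L fderiv ℝ x q) q :=
    HasFDerivAt.comp (F := V) (G := V →L[ℝ] V →L[ℝ] V) q (differentiableAt_Γ hy).hasFDerivAt
      (hx.differentiableAt (by norm_num)).hasFDerivAt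
  have h4 := (hX.differentiableAt (by norm_num)).hasFDerivAt
  have hs : IsSymmSndFDerivAt ℝ x q := hx.isSymmSndFDerivAt (by simp)
  have hS : IsSymmSndFDerivAt ℝ X q := hX.isSymmSndFDerivAt (by simp)
  have key : ∀ c : E → E, DifferentiableAt ℝ c q → ∀ v : E,
      A.cov x (fun p => A.cov x X p (c p)) q v
        = fderiv ℝ (fderiv ℝ X) q v (c q) + fderiv ℝ X q (fderiv ℝ c q v)
          + (fderiv ℝ A.Γ (x q) (fderiv ℝ x q v) (fderiv ℝ x q (c q)) (X q)
          + A.Γ (x q) (fderiv ℝ (fderiv ℝ x) q v (c q) + fderiv ℝ x q (fderiv ℝ c q v)) (X q)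
          + A.Γ (x q) (fderiv ℝ x q (c q)) (fderiv ℝ X q v))
          + A.Γ (x q) (fderiv ℝ x q v) (fderiv ℝ X q (c q)
            + A.Γ (x q) (fderiv ℝ x q (c q)) (X q)) := by
    intro c hc v
    have h5 := (h1.clm_apply hc.hasFDerivAt).add
      ((h3.clm_apply (h2.clm_apply hc.hasFDerivAt)).clm_apply h4)
    rw [cov_apply, show (fun p => A.cov x X p (c p)) = _ from
      funext fun p => cov_apply (A := A) x X p (c p)]
    erw [h5.fderiv]
    simp only [add_apply, ContinuousLinearMap.comp_apply, ContinuousLinearMap.flip_apply, cov_apply,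
      map_add]
    abel
  rw [key b hb, key a ha, cov_apply]
  simp only [VectorField.lieBracket, map_sub, map_add, hs.eq (a q) (b q), hS.eq (a q) (b q),
    sub_apply, add_apply, Rm]
  abel

theorem Rm_skew (y u v w : V) : A.Rm y u v w = - A.Rm y v u w := by
  simp only [Rm]; abel

theorem Rm_add_left (y u u' v w : V) : A.Rm y (u + u') v w = A.Rm y u v w + A.Rm y u' v w := by
  simp only [Rm, map_add, add_apply]; abel

theorem Rm_smul_left (c : ℝ) (y u v w : V) : A.Rm y (c • u) v w = c • A.Rm y u v w := by
  simp only [Rm, map_smul, smul_apply, smul_sub, smul_add]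

theorem Rm_add_right (y u v v' w : V) : A.Rm y u (v + v') w = A.Rm y u v w + A.Rm y u v' w := by
  simp only [Rm, map_add, add_apply]; abel

theorem Rm_smul_right (c : ℝ) (y u v w : V) : A.Rm y u (c • v) w = c • A.Rm y u v w := by
  simp only [Rm, map_smul, smul_apply, smul_sub, smul_add]

theorem Rm_apply_add (y u v w w' : V) : A.Rm y u v (w + w') = A.Rm y u v w + A.Rm y u v w' := by
  simp only [Rm, map_add]; abel

theorem Rm_apply_smul (c : ℝ) (y u v w : V) : A.Rm y u v (c • w) = c • A.Rm y u v w := by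
  simp only [Rm, map_smul, smul_sub, smul_add]

theorem fderiv_Γ_symm (hy : y ∈ A.Ω) (u v w : V) :
    fderiv ℝ A.Γ y u v w = fderiv ℝ A.Γ y u w v := by
  have h : ∀ v w, fderiv ℝ A.Γ y u v w = fderiv ℝ (fun z => A.Γ z v w) y u := fun v w => by
    rw [(((differentiableAt_Γ hy).hasFDerivAt.clm_apply (hasFDerivAt_const v y)).clm_apply
      (hasFDerivAt_const w y)).fderiv]
    simp
  rw [h, h]
  have : (fun z => A.Γ z v w) =ᶠ[𝓝 y] (fun z => A.Γ z w v) := by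
    filter_upwards [A.isOpen.mem_nhds hy] with z hz using Γ_symm hz v w
  rw [this.fderiv_eq]

theorem Rm_bianchi (hy : y ∈ A.Ω) (u v w : V) :
    A.Rm y u v w + A.Rm y v w u + A.Rm y w u v = 0 := by
  simp only [Rm, fderiv_Γ_symm hy u v w, fderiv_Γ_symm hy v u w, fderiv_Γ_symm hy w u v,
    Γ_symm hy u v, Γ_symm hy v w, Γ_symm hy u w]
  abel

/-- The mixed second derivatives of the function |c|², for constant `c`, commute. -/
theorem inner_Rm_self (hy : y ∈ A.Ω) (a b c : V) : A.G y (A.Rm y a b c) c = 0 := by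
  have hid : ContDiffAt ℝ 2 (fun z : V => z) y := contDiffAt_id
  have hcurv := cov_curvature (A := A) (x := fun z : V => z) (X := fun _ => c) (q := y)
    (a := fun _ => a) (b := fun _ => b) hy hid contDiffAt_const
    (differentiableAt_const _) (differentiableAt_const _)
  have hbr : VectorField.lieBracket ℝ (fun _ : V => a) (fun _ => b) y = 0 := by
    simp [VectorField.lieBracket]
  simp only [hbr, map_zero, sub_zero, fderiv_fun_id, ContinuousLinearMap.id_apply] at hcurv
  have hf : ContDiffAt ℝ 2 (fun z => A.G z c c) y :=
    (((A.smooth.contDiffAt (A.isOpen.mem_nhds hy)).clm_apply contDiffAt_const).clm_apply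
      contDiffAt_const).of_le (by norm_cast)
  have hs := (hf.isSymmSndFDerivAt (by simp)).eq a b
  have hdd : DifferentiableAt ℝ (fderiv ℝ fun z => A.G z c c) y :=
    (hf.fderiv_right (m := 1) (by norm_num)).differentiableAt (by norm_num)
  have hcov : ∀ d : V, DifferentiableAt ℝ
      (fun p => A.cov (fun z : V => z) (fun _ => c) p d) y := fun d =>
    (differentiableAt_cov hy hid contDiffAt_const).clm_apply (differentiableAt_const d)
  -- ∂_a ∂_b |c|² = 2(⟨D_a D_b c, c⟩ + ⟨D_b c, D_a c⟩), where the last product is symmetric in a, b.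
  have key : ∀ a b : V, fderiv ℝ (fderiv ℝ fun z => A.G z c c) y a b
      = 2 * (A.G y (A.cov (fun z => z) (fun p => A.cov (fun z : V => z) (fun _ => c) p b) y a) c
        + A.G y (A.cov (fun z : V => z) (fun _ => c) y b)
            (A.cov (fun z : V => z) (fun _ => c) y a)) := by
    intro a b
    have e1 : (fun p => fderiv ℝ (fun z => A.G z c c) p b) =ᶠ[𝓝 y]
        fun p => 2 * A.G p (A.cov (fun z : V => z) (fun _ => c) p b) c := by
      filter_upwards [A.isOpen.mem_nhds hy] with p hp
      rw [hasFDerivAt_inner (A := A) (x := fun z : V => z) hp differentiableAt_fun_id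
        (differentiableAt_const _) (differentiableAt_const _), A.symm p hp c]
      ring
    have e2 := (hdd.hasFDerivAt.clm_apply (hasFDerivAt_const b y)).fderiv
    rw [e1.fderiv_eq] at e2
    have hd : DifferentiableAt ℝ
        (fun p => A.G p (A.cov (fun z : V => z) (fun _ => c) p b) c) y :=
      ((differentiableAt_G hy).clm_apply (hcov b)).clm_apply (differentiableAt_const c)
    have e3 := DFunLike.congr_fun e2 a
    rw [fderiv_const_mul hd] at e3
    simp only [smul_apply, smul_eq_mul] at e3
    rw [hasFDerivAt_inner (A := A) (x := fun z : V => z) hy differentiableAt_fun_id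
        (hcov b) (differentiableAt_const _)] at e3
    simpa using e3.symm
  rw [key, key, A.symm y hy (A.cov (fun z : V => z) (fun _ => c) y b)] at hs
  rw [← hcurv, map_sub, sub_apply]
  linarith

theorem inner_Rm_skew (hy : y ∈ A.Ω) (a b c d : V) :
    A.G y (A.Rm y a b c) d = - A.G y (A.Rm y a b d) c := by
  have h := inner_Rm_self hy a b (c + d)
  simp only [Rm_apply_add, map_add, add_apply, inner_Rm_self hy] at h
  linarith

/-- Pure algebra: the Bianchi identities for the four cyclic shifts of (a, b, c, d) are combined
with the skewness in each pair of arguments. -/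
theorem inner_Rm_pair (hy : y ∈ A.Ω) (a b c d : V) :
    A.G y (A.Rm y a b c) d = A.G y (A.Rm y c d a) b := by
  have B : ∀ a b c d : V,
      A.G y (A.Rm y a b c) d + A.G y (A.Rm y b c a) d + A.G y (A.Rm y c a b) d = 0 := by
    intro a b c d
    have := congrArg (fun v => A.G y v d) (Rm_bianchi hy a b c)
    simpa using this
  have K : ∀ a b c d : V, A.G y (A.Rm y a b c) d = - A.G y (A.Rm y b a c) d := by
    intro a b c d
    rw [Rm_skew]; simp
  have S := inner_Rm_skew hy
  linarith [B a b c d, B b c d a, B c d a b, B d a b c, K a b c d, K b c a d, K c a b d, K b c d a,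
    K c d b a, K d b c a, K c d a b, K d a c b, K a c d b, K d a b c, K a b d c, K b d a c,
    S a b c d, S b c a d, S c a b d, S b c d a, S c d b a, S d b c a, S c d a b, S d a c b,
    S a c d b, S d a b c, S a b d c, S b d a c]

end MetricChart

theorem MetricChart.eq_zero_of_orthogonal {V : Type*} [NormedAddCommGroup V] [NormedSpace ℝ V]
    [FiniteDimensional ℝ V]
    {A : MetricChart V} {y : V} (hy : y ∈ A.Ω) (hV : Module.finrank ℝ V = 3) (f : Fin 3 → V)
    (hf : ∀ i, f i ≠ 0) (ho : ∀ i j, i ≠ j → A.G y (f i) (f j) = 0) {v : V}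
    (hv : ∀ i, A.G y v (f i) = 0) : v = 0 := by
  have hli : LinearIndependent ℝ f := by
    rw [Fintype.linearIndependent_iff]
    intro c hc i
    have h := congrArg (fun w => A.G y w (f i)) hc
    simp only [map_sum, map_smul, sum_apply, smul_apply, smul_eq_mul,
      map_zero, zero_apply] at h
    rw [Finset.sum_eq_single i (fun j _ hj => by rw [ho j i hj, mul_zero]) (by simp)] at h
    exact (mul_eq_zero.1 h).resolve_right (A.pos y hy _ (hf i)).ne'
  have hspan := hli.span_eq_top_of_card_eq_finrank' (by simp [hV])
  have hall : ∀ w ∈ Submodule.span ℝ (Set.range f), A.G y v w = 0 := by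
    intro w hw
    induction hw using Submodule.span_induction with
    | mem w hw => obtain ⟨i, rfl⟩ := hw; exact hv i
    | zero => simp
    | add a b _ _ ha hb => simp [ha, hb]
    | smul c a _ ha => simp [ha]
  by_contra hne
  exact (A.pos y hy v hne).ne' (hall v (by rw [hspan]; trivial))

/-! ### Sasakian structures on open subsets of a vector space -/

/-- A Sasakian structure on an open subset of a vector space: a metric `G`, a unit Killing field
`T` and the endomorphism `J` such that `dη = G (J ·) ·` for the `1`-form `η = G T`. -/
structure SasakianChart (V : Type*) [NormedAddCommGroup V] [NormedSpace ℝ V]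
    extends MetricChart V where
  T : V → V
  J : V → V →L[ℝ] V
  T_smooth : ContDiffOn ℝ ∞ T Ω
  J_smooth : ContDiffOn ℝ ∞ J Ω
  T_unit : ∀ y ∈ Ω, G y (T y) (T y) = 1
  J_T : ∀ y ∈ Ω, J y (T y) = 0
  J_isom : ∀ y ∈ Ω, ∀ u, G y (J y u) (J y u) = G y u u - (G y (T y) u) ^ 2
  killing : ∀ y ∈ Ω, ∀ u v,
    fderiv ℝ G y (T y) u v + G y (fderiv ℝ T y u) v + G y u (fderiv ℝ T y v) = 0
  d_eta : ∀ y ∈ Ω, ∀ u v, fderiv ℝ G y u (T y) v + G y (fderiv ℝ T y u) v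
    - (fderiv ℝ G y v (T y) u + G y (fderiv ℝ T y v) u) = 2 * G y (J y u) v

namespace SasakianChart

open MetricChart

variable {V : Type*} [NormedAddCommGroup V] [NormedSpace ℝ V] [FiniteDimensional ℝ V]
  {A : SasakianChart V} {y : V}

/-- The left side of `d_eta` is antisymmetric in `u`, `v`. -/
theorem J_skew (hy : y ∈ A.Ω) (u v : V) : A.G y (A.J y u) v = - A.G y (A.J y v) u := by
  linarith [A.d_eta y hy u v, A.d_eta y hy v u]

theorem J_skew_self (hy : y ∈ A.Ω) (u : V) : A.G y (A.J y u) u = 0 := by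
  linarith [J_skew hy u u]

theorem differentiableAt_T (hy : y ∈ A.Ω) : DifferentiableAt ℝ A.T y :=
  (A.T_smooth.contDiffAt (A.isOpen.mem_nhds hy)).differentiableAt (by simp)

theorem differentiableAt_J (hy : y ∈ A.Ω) : DifferentiableAt ℝ A.J y :=
  (A.J_smooth.contDiffAt (A.isOpen.mem_nhds hy)).differentiableAt (by simp)

/-- In the bilinear form ⟨D_u T, v⟩ the symmetric part vanishes by `killing`, and the skew part is
⟨J u, v⟩ by `d_eta`. -/
theorem cov_T_id (hy : y ∈ A.Ω) (u : V) : fderiv ℝ A.T y u + A.Γ y u (A.T y) = A.J y u := by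
  refine ext_of_inner hy fun v => ?_
  rw [map_add, add_apply, G_Γ hy, koszul_apply]
  have h1 := A.killing y hy u v
  have h2 := A.d_eta y hy u v
  rw [fderiv_G_symm hy v u]
  rw [fderiv_G_symm hy u] at h2 ⊢
  rw [A.symm y hy u] at h1
  rw [fderiv_G_symm hy u v] at h2 ⊢
  linarith

variable {E : Type*} [NormedAddCommGroup E] [NormedSpace ℝ E] {x : E → V} {q : E}

theorem differentiableAt_T_comp (hy : x q ∈ A.Ω) (hx : DifferentiableAt ℝ x q) :
    DifferentiableAt ℝ (fun p => A.T (x p)) q :=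
  (differentiableAt_T hy).comp q hx

/-- `D_v T = J v`. -/
theorem cov_T (hy : x q ∈ A.Ω) (hx : DifferentiableAt ℝ x q) (v : E) :
    A.cov x (fun p => A.T (x p)) q v = A.J (x q) (fderiv ℝ x q v) := by
  have h : HasFDerivAt (fun p => A.T (x p)) _ q :=
    (differentiableAt_T hy).hasFDerivAt.comp q hx.hasFDerivAt
  rw [cov_apply, h.fderiv, ← cov_T_id hy]
  rfl

/-- Extend Z = Jν and ν to constant fields. Since DT = J, the curvature term R(Z, ν)T is D_Z(Jν) -
D_ν(JZ). Its Z-component follows from differentiating the algebraic identities for |Jν|² and ⟨JZ,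
Z⟩, so the covariant derivative of J is never computed. -/
theorem inner_Rm_T (hy : y ∈ A.Ω) (ν : V) (hν : A.G y (A.T y) ν = 0)
    (hJ : A.J y (A.J y ν) = -ν) : A.G y (A.Rm y (A.J y ν) ν (A.T y)) (A.J y ν) = 0 := by
  set Z := A.J y ν with hZ
  have hid : ContDiffAt ℝ 2 (fun z : V => z) y := contDiffAt_id
  have hT : ContDiffAt ℝ 2 A.T y :=
    (A.T_smooth.contDiffAt (A.isOpen.mem_nhds hy)).of_le (by norm_cast)
  have hcurv := cov_curvature (A := A.toMetricChart) (x := fun z : V => z) (X := A.T) (q := y)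
    (a := fun _ => Z) (b := fun _ => ν) hy hid hT
    (differentiableAt_const _) (differentiableAt_const _)
  have hbr : VectorField.lieBracket ℝ (fun _ : V => Z) (fun _ => ν) y = 0 := by
    simp [VectorField.lieBracket]
  have hc : ∀ c : V, (fun p => A.cov (fun z : V => z) A.T p c) =ᶠ[𝓝 y] fun p => A.J p c := by
    intro c
    filter_upwards [A.isOpen.mem_nhds hy] with p hp
    rw [cov_T (x := fun z : V => z) hp differentiableAt_fun_id]
    simp
  simp only [hbr, map_zero, sub_zero, fderiv_fun_id, ContinuousLinearMap.id_apply] at hcurv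
  rw [cov_congr (hc ν), cov_congr (hc Z)] at hcurv
  have hdJ : ∀ c : V, DifferentiableAt ℝ (fun p => A.J p c) y := fun c =>
    (differentiableAt_J hy).clm_apply (differentiableAt_const c)
  have hcon : ∀ c : V, DifferentiableAt ℝ (fun _ : V => c) y := fun c => differentiableAt_const c
  have hder := fun (X Y : V → V) (hX : DifferentiableAt ℝ X y) (hY : DifferentiableAt ℝ Y y) =>
    hasFDerivAt_inner (A := A.toMetricChart) (x := fun z : V => z) hy differentiableAt_fun_id hX hY
  have hconst : ∀ c v : V, A.cov (fun z : V => z) (fun _ => c) y v = A.Γ y v c := fun c v => by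
    simp [cov_apply]
  -- Differentiate |Jν|² = |ν|² - ⟨T, ν⟩² along Z; the last square has zero derivative because ⟨T,
  -- ν⟩ = 0 at `y`.
  have e1 : A.G y (A.cov (fun z => z) (fun p => A.J p ν) y Z) Z = A.G y (A.Γ y Z ν) ν := by
    have h : (fun p => A.G p (A.J p ν) (A.J p ν)) =ᶠ[𝓝 y]
        fun p => A.G p ν ν - A.G p (A.T p) ν * A.G p (A.T p) ν := by
      filter_upwards [A.isOpen.mem_nhds hy] with p hp
      rw [A.J_isom p hp ν, sq]
    have hd1 : DifferentiableAt ℝ (fun p => A.G p ν ν) y :=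
      ((differentiableAt_G hy).clm_apply (hcon ν)).clm_apply (hcon ν)
    have hd2 : DifferentiableAt ℝ (fun p => A.G p (A.T p) ν) y :=
      ((differentiableAt_G hy).clm_apply (differentiableAt_T hy)).clm_apply (hcon ν)
    have h2 := DFunLike.congr_fun (h.fderiv_eq (𝕜 := ℝ)) Z
    have h3 : fderiv ℝ (fun p => A.G p ν ν - A.G p (A.T p) ν * A.G p (A.T p) ν) y Z
        = fderiv ℝ (fun p => A.G p ν ν) y Z := by
      rw [(hd1.hasFDerivAt.fun_sub (hd2.hasFDerivAt.fun_mul hd2.hasFDerivAt)).fderiv]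
      simp [hν]
    rw [h3, hder (fun p => A.J p ν) (fun p => A.J p ν) (hdJ ν) (hdJ ν), hder (fun _ => ν) (fun _ => ν) (hcon ν) (hcon ν)] at h2
    simp only [hconst, ← hZ] at h2
    rw [A.symm y hy Z, A.symm y hy ν] at h2
    linarith
  -- Differentiate ⟨JZ, Z⟩ = 0 along ν and use JZ = -ν at `y`. The values in `e1` and `e2` agree by
  -- symmetry of Γ.
  have e2 : A.G y (A.cov (fun z => z) (fun p => A.J p Z) y ν) Z = A.G y (A.Γ y ν Z) ν := by
    have h : (fun p => A.G p (A.J p Z) Z) =ᶠ[𝓝 y] fun _ => 0 := by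
      filter_upwards [A.isOpen.mem_nhds hy] with p hp using J_skew_self hp Z
    have h2 := DFunLike.congr_fun (h.fderiv_eq (𝕜 := ℝ)) ν
    rw [hder (fun p => A.J p Z) (fun _ => Z) (hdJ Z) (hcon Z), hconst, hJ] at h2
    simp only [fderiv_fun_const, Pi.zero_apply, zero_apply, map_neg, neg_apply] at h2
    rw [A.symm y hy ν] at h2
    linarith
  rw [← hcurv, map_sub, sub_apply, e1, e2, Γ_symm hy Z ν, sub_self]

/-- Orthonormal frames `ν, Z = J ν, T`. -/
structure IsFrame (A : SasakianChart V) (y ν Z : V) : Prop where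
  νν : A.G y ν ν = 1
  ZZ : A.G y Z Z = 1
  νZ : A.G y ν Z = 0
  νT : A.G y ν (A.T y) = 0
  ZT : A.G y Z (A.T y) = 0
  Jν : A.J y ν = Z
  JZ : A.J y Z = -ν

theorem IsFrame.ext {ν Z : V} (hF : IsFrame A y ν Z) (hy : y ∈ A.Ω)
    (hV : Module.finrank ℝ V = 3) {u v : V}
    (h1 : A.G y u ν = A.G y v ν) (h2 : A.G y u Z = A.G y v Z)
    (h3 : A.G y u (A.T y) = A.G y v (A.T y)) : u = v := by
  have hne : ∀ w, A.G y w w = 1 → w ≠ 0 := by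
    rintro w hw rfl
    simp at hw
  have hZν := A.symm y hy Z ν
  have hTν := A.symm y hy (A.T y) ν
  have hTZ := A.symm y hy (A.T y) Z
  refine sub_eq_zero.1 (eq_zero_of_orthogonal (A := A.toMetricChart) hy hV ![ν, Z, A.T y] ?_ ?_ ?_)
  · intro i
    fin_cases i
    · exact hne _ hF.νν
    · exact hne _ hF.ZZ
    · exact hne _ (A.T_unit y hy)
  · intro i j hij
    fin_cases i <;> fin_cases j <;> simp [hF.νZ, hF.νT, hF.ZT, hZν, hTν, hTZ] at hij ⊢
  · intro i
    fin_cases i <;> simp [h1, h2, h3]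

end SasakianChart

/-! ### Surfaces without singular points: structure equations of the adapted frame -/

/-- A parametrized surface `x : U → Ω` in a Sasakian chart without singular points, together with
its frame: `Z` is the unit horizontal tangent field, `ν` the horizontal unit normal, and the
tangent plane is spanned by `Z` and `T - u ν`. The fields `z`, `w` on `U` represent these. -/
structure FramedSurface {V : Type*} [NormedAddCommGroup V] [NormedSpace ℝ V]
    (A : SasakianChart V) (E : Type*) [NormedAddCommGroup E] [NormedSpace ℝ E] where
  U : Set E
  isOpen : IsOpen U
  x : E → V
  ν : E → V
  Z : E → V
  u : E → ℝ
  z : E → E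
  w : E → E
  mapsTo : ∀ q ∈ U, x q ∈ A.Ω
  x_smooth : ContDiffOn ℝ 2 x U
  ν_smooth : ContDiffOn ℝ 2 ν U
  Z_smooth : ContDiffOn ℝ 2 Z U
  u_smooth : ContDiffOn ℝ 2 u U
  z_smooth : ContDiffOn ℝ 1 z U
  w_smooth : ContDiffOn ℝ 1 w U
  frame : ∀ q ∈ U, SasakianChart.IsFrame A (x q) (ν q) (Z q)
  x_z : ∀ q ∈ U, fderiv ℝ x q (z q) = Z q
  x_w : ∀ q ∈ U, fderiv ℝ x q (w q) = A.T (x q) - u q • ν q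
  normal : ∀ q ∈ U, ∀ a, A.G (x q) (fderiv ℝ x q a) (ν q + u q • A.T (x q)) = 0
  inj : ∀ q ∈ U, Function.Injective (fderiv ℝ x q)

namespace FramedSurface

open MetricChart SasakianChart

variable {V : Type*} [NormedAddCommGroup V] [NormedSpace ℝ V] [FiniteDimensional ℝ V]
  {A : SasakianChart V} {E : Type*} [NormedAddCommGroup E] [NormedSpace ℝ E]
  {F : FramedSurface A E} {q : E}

section regularity

variable (hq : q ∈ F.U)
include hq

theorem cx : ContDiffAt ℝ 2 F.x q := F.x_smooth.contDiffAt (F.isOpen.mem_nhds hq)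
theorem dx : DifferentiableAt ℝ F.x q := (cx hq).differentiableAt (by norm_num)
theorem dν : DifferentiableAt ℝ F.ν q :=
  (F.ν_smooth.contDiffAt (F.isOpen.mem_nhds hq)).differentiableAt (by norm_num)
theorem cZ : ContDiffAt ℝ 2 F.Z q := F.Z_smooth.contDiffAt (F.isOpen.mem_nhds hq)
theorem dZ : DifferentiableAt ℝ F.Z q := (cZ hq).differentiableAt (by norm_num)
theorem cu : ContDiffAt ℝ 2 F.u q := F.u_smooth.contDiffAt (F.isOpen.mem_nhds hq)
theorem du : DifferentiableAt ℝ F.u q := (cu hq).differentiableAt (by norm_num)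
theorem dz : DifferentiableAt ℝ F.z q :=
  (F.z_smooth.contDiffAt (F.isOpen.mem_nhds hq)).differentiableAt (by norm_num)
theorem dw : DifferentiableAt ℝ F.w q :=
  (F.w_smooth.contDiffAt (F.isOpen.mem_nhds hq)).differentiableAt (by norm_num)
theorem dT : DifferentiableAt ℝ (fun p => A.T (F.x p)) q :=
  differentiableAt_T_comp (F.mapsTo q hq) (dx hq)
theorem duz : DifferentiableAt ℝ (fun p => fderiv ℝ F.u p (F.z p)) q :=
  (((cu hq).fderiv_right (m := 1) (by norm_num)).differentiableAt (by norm_num)).clm_apply (dz hq)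

/-- Metric compatibility applied to a constant inner product. With the orthonormality relations of
the frame it yields the skew-symmetry of the connection coefficients. -/
theorem inner_deriv {X Y : E → V} (hX : DifferentiableAt ℝ X q) (hY : DifferentiableAt ℝ Y q)
    (c : ℝ) (h : ∀ p ∈ F.U, A.G (F.x p) (X p) (Y p) = c) (v : E) :
    A.G (F.x q) (A.cov F.x X q v) (Y q) = - A.G (F.x q) (A.cov F.x Y q v) (X q) := by
  have h1 := hasFDerivAt_inner (A := A.toMetricChart) (F.mapsTo q hq) (dx hq) hX hY v
  have h2 : (fun p => A.G (F.x p) (X p) (Y p)) =ᶠ[𝓝 q] fun _ => c := by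
    filter_upwards [F.isOpen.mem_nhds hq] with p hp using h p hp
  rw [h2.fderiv_eq] at h1
  simp only [fderiv_fun_const, Pi.zero_apply, zero_apply] at h1
  rw [A.symm _ (F.mapsTo q hq) (A.cov F.x Y q v)]
  linarith

theorem cov_Z_Z (v : E) : A.G (F.x q) (A.cov F.x F.Z q v) (F.Z q) = 0 := by
  linarith [inner_deriv hq (dZ hq) (dZ hq) 1 (fun p hp => (F.frame p hp).ZZ) v]

theorem cov_ν_ν (v : E) : A.G (F.x q) (A.cov F.x F.ν q v) (F.ν q) = 0 := by
  linarith [inner_deriv hq (dν hq) (dν hq) 1 (fun p hp => (F.frame p hp).νν) v]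

theorem cov_ν_Z (v : E) :
    A.G (F.x q) (A.cov F.x F.ν q v) (F.Z q) = - A.G (F.x q) (A.cov F.x F.Z q v) (F.ν q) :=
  inner_deriv hq (dν hq) (dZ hq) 0 (fun p hp => (F.frame p hp).νZ) v

/-- T is the member of the frame whose derivative is known, so the derivative is moved onto it and
`cov_T` applies. -/
theorem cov_Z_T (v : E) :
    A.G (F.x q) (A.cov F.x F.Z q v) (A.T (F.x q))
      = - A.G (F.x q) (A.J (F.x q) (fderiv ℝ F.x q v)) (F.Z q) := by
  rw [inner_deriv hq (dZ hq) (dT hq) 0 (fun p hp => (F.frame p hp).ZT) v,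
    cov_T (F.mapsTo q hq) (dx hq)]

theorem cov_ν_T (v : E) :
    A.G (F.x q) (A.cov F.x F.ν q v) (A.T (F.x q))
      = - A.G (F.x q) (A.J (F.x q) (fderiv ℝ F.x q v)) (F.ν q) := by
  rw [inner_deriv hq (dν hq) (dT hq) 0 (fun p hp => (F.frame p hp).νT) v,
    cov_T (F.mapsTo q hq) (dx hq)]

variable (hV : Module.finrank ℝ V = 3)
include hV

theorem cov_Z_z : A.cov F.x F.Z q (F.z q)
    = A.G (F.x q) (A.cov F.x F.Z q (F.z q)) (F.ν q) • F.ν q := by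
  have hf := F.frame q hq
  refine hf.ext (F.mapsTo q hq) hV ?_ ?_ ?_
  · simp [hf.νν]
  · simp [hf.νZ, cov_Z_Z hq]
  · rw [cov_Z_T hq, F.x_z q hq]
    simp [hf.JZ, hf.νT, hf.νZ]

/-- The coefficient of T is -⟨JZ, ν⟩ = 1; the other components come from skew-symmetry. -/
theorem cov_ν_z : A.cov F.x F.ν q (F.z q)
    = A.T (F.x q) - A.G (F.x q) (A.cov F.x F.Z q (F.z q)) (F.ν q) • F.Z q := by
  have hf := F.frame q hq
  have hy := F.mapsTo q hq
  have hZν := A.symm _ hy (F.Z q) (F.ν q)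
  have hTν := A.symm _ hy (A.T (F.x q)) (F.ν q)
  have hTZ := A.symm _ hy (A.T (F.x q)) (F.Z q)
  refine hf.ext hy hV ?_ ?_ ?_
  · simp [hZν, hf.νZ, hTν, hf.νT, cov_ν_ν hq]
  · simp [hf.ZZ, cov_ν_Z hq, hTZ, hf.ZT]
  · rw [cov_ν_T hq, F.x_z q hq]
    simp [hf.JZ, hf.νν, hf.ZT, A.T_unit _ hy]

theorem cov_Z_w : A.cov F.x F.Z q (F.w q)
    = A.G (F.x q) (A.cov F.x F.Z q (F.w q)) (F.ν q) • F.ν q + F.u q • A.T (F.x q) := by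
  have hf := F.frame q hq
  have hy := F.mapsTo q hq
  have hTν := A.symm _ hy (A.T (F.x q)) (F.ν q)
  have hTZ := A.symm _ hy (A.T (F.x q)) (F.Z q)
  refine hf.ext hy hV ?_ ?_ ?_
  · simp [hf.νν, hTν, hf.νT]
  · simp [hf.νZ, cov_Z_Z hq, hTZ, hf.ZT]
  · rw [cov_Z_T hq, F.x_w q hq]
    simp [hf.Jν, hf.ZZ, hf.νT, A.T_unit _ hy, A.J_T _ hy]

variable {H : ℝ} (hH : A.G (F.x q) (A.cov F.x F.Z q (F.z q)) (F.ν q) = 2 * H)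
include hH

/-- Vanishing torsion: the image of [z, w] is D_Z(T - uν) - D_W Z. The coefficient ⟨D_W Z, ν⟩ is
still unknown here. -/
theorem fderiv_bracket :
    fderiv ℝ F.x q (VectorField.lieBracket ℝ F.z F.w q)
      = -(1 + fderiv ℝ F.u q (F.z q) + A.G (F.x q) (A.cov F.x F.Z q (F.w q)) (F.ν q)) • F.ν q
        + (2 * H * F.u q) • F.Z q - (2 * F.u q) • A.T (F.x q) := by
  have hy := F.mapsTo q hq
  rw [← cov_torsion (A := A.toMetricChart) hy (cx hq) (dz hq) (dw hq)]
  have e1 : (fun p => fderiv ℝ F.x p (F.w p)) =ᶠ[𝓝 q] fun p => A.T (F.x p) - F.u p • F.ν p := by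
    filter_upwards [F.isOpen.mem_nhds hq] with p hp using F.x_w p hp
  have e2 : (fun p => fderiv ℝ F.x p (F.z p)) =ᶠ[𝓝 q] F.Z := by
    filter_upwards [F.isOpen.mem_nhds hq] with p hp using F.x_z p hp
  rw [cov_congr e1, cov_congr e2, cov_sub (dT hq) ((du hq).fun_smul (dν hq)),
    cov_smul (du hq) (dν hq), cov_T hy (dx hq), F.x_z q hq, (F.frame q hq).JZ, cov_ν_z hq hV, hH]
  nth_rw 1 [cov_Z_w hq hV]
  module

/-- The bracket is tangent to the surface, hence orthogonal to ν + uT. In `fderiv_bracket` this is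
one linear equation for the unknown coefficient. -/
theorem inner_cov_Z_w :
    A.G (F.x q) (A.cov F.x F.Z q (F.w q)) (F.ν q)
      = -1 - fderiv ℝ F.u q (F.z q) - 2 * F.u q ^ 2 := by
  have hf := F.frame q hq
  have hy := F.mapsTo q hq
  have hZν := A.symm _ hy (F.Z q) (F.ν q)
  have hTν := A.symm _ hy (A.T (F.x q)) (F.ν q)
  have h := F.normal q hq (VectorField.lieBracket ℝ F.z F.w q)
  rw [fderiv_bracket hq hV hH] at h
  simp [hZν, hTν, hf.νν, hf.νZ, hf.νT, hf.ZT, A.T_unit _ hy] at h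
  linarith

theorem lieBracket_z_w :
    VectorField.lieBracket ℝ F.z F.w q = (2 * H * F.u q) • F.z q - (2 * F.u q) • F.w q := by
  apply F.inj q hq
  rw [fderiv_bracket hq hV hH, inner_cov_Z_w hq hV hH]
  simp only [map_sub, map_smul, F.x_z q hq, F.x_w q hq]
  module

end regularity

/-- The equation satisfied by `u = ⟨N, T⟩ / |N_h|` on a surface of constant mean curvature. -/
theorem second_order_equation (hV : Module.finrank ℝ V = 3) {H : ℝ}
    (hH : ∀ p ∈ F.U, A.G (F.x p) (A.cov F.x F.Z p (F.z p)) (F.ν p) = 2 * H) (hq : q ∈ F.U) :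
    fderiv ℝ (fun p => fderiv ℝ F.u p (F.z p)) q (F.z q) + 6 * F.u q * fderiv ℝ F.u q (F.z q)
      + 4 * F.u q ^ 3 + 4 * H ^ 2 * F.u q
      + (A.G (F.x q) (A.Rm (F.x q) (F.ν q) (F.Z q) (F.Z q)) (F.ν q) + 3) * F.u q = 0 := by
  have hf := F.frame q hq
  have hy := F.mapsTo q hq
  have hZν := A.symm _ hy (F.Z q) (F.ν q)
  have hTν := A.symm _ hy (A.T (F.x q)) (F.ν q)
  have hR := cov_curvature (A := A.toMetricChart) hy (cx hq) (cZ hq) (dz hq) (dw hq)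
  have e1 : (fun p => A.cov F.x F.Z p (F.w p)) =ᶠ[𝓝 q] fun p =>
      (-1 - fderiv ℝ F.u p (F.z p) - 2 * F.u p ^ 2) • F.ν p + F.u p • A.T (F.x p) := by
    filter_upwards [F.isOpen.mem_nhds hq] with p hp
    rw [cov_Z_w hp hV, inner_cov_Z_w hp hV (hH p hp)]
  have e2 : (fun p => A.cov F.x F.Z p (F.z p)) =ᶠ[𝓝 q] fun p => (2 * H) • F.ν p := by
    filter_upwards [F.isOpen.mem_nhds hq] with p hp
    rw [cov_Z_z hp hV, hH p hp]
  have hu := du hq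
  have huz := duz hq
  -- This is the coefficient ω = ⟨D_W Z, ν⟩; its derivative along Z brings in Z(Z(u)).
  have hω : HasFDerivAt (fun p => -1 - fderiv ℝ F.u p (F.z p) - 2 * F.u p ^ 2)
      (- fderiv ℝ (fun p => fderiv ℝ F.u p (F.z p)) q - (4 * F.u q) • fderiv ℝ F.u q) q := by
    have h := ((hasFDerivAt_const (-1 : ℝ) q).sub huz.hasFDerivAt).sub
      ((hu.hasFDerivAt.pow 2).const_mul 2)
    refine h.congr_fderiv ?_
    ext v
    simp
    ring
  rw [cov_congr e1, cov_congr e2, lieBracket_z_w hq hV (hH q hq),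
    cov_add (hω.differentiableAt.fun_smul (dν hq)) (hu.fun_smul (dT hq)),
    cov_smul hω.differentiableAt (dν hq), cov_smul hu (dT hq),
    cov_smul (differentiableAt_const _) (dν hq), cov_T hy (dx hq), hω.fderiv, F.x_z q hq,
    F.x_w q hq, hf.JZ] at hR
  -- In the ν-component the D_W D_Z Z term drops out: 2H is constant and D_W ν is orthogonal to ν.
  have h := congrArg (fun v => A.G (F.x q) v (F.ν q)) hR
  -- Pair symmetry turns ⟨R(Z, T)Z, ν⟩ into ⟨R(Z, ν)Z, T⟩ = -⟨R(Z, ν)T, Z⟩, which `inner_Rm_T`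
  -- kills.
  have hJ : A.G (F.x q) (A.Rm (F.x q) (F.Z q) (A.T (F.x q)) (F.Z q)) (F.ν q) = 0 := by
    have h1 := inner_Rm_T hy (F.ν q) (by rw [hTν, hf.νT]) (by rw [hf.Jν, hf.JZ])
    rw [hf.Jν] at h1
    rw [inner_Rm_pair hy, inner_Rm_skew hy, h1, neg_zero]
  have hRm : A.Rm (F.x q) (F.Z q) (A.T (F.x q) - F.u q • F.ν q) (F.Z q)
      = A.Rm (F.x q) (F.Z q) (A.T (F.x q)) (F.Z q)
        + F.u q • A.Rm (F.x q) (F.ν q) (F.Z q) (F.Z q) := by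
    rw [sub_eq_add_neg, ← neg_smul, Rm_add_right, Rm_smul_right, Rm_skew (F.x q) (F.ν q)]
    module
  simp only [hRm, map_add, map_sub, map_smul, add_apply, sub_apply, smul_apply, smul_eq_mul,
    hJ, hf.νν, hTν, hf.νT, cov_ν_ν hq, hH q hq, inner_cov_Z_w hq hV (hH q hq), map_neg, neg_apply,
    fderiv_fun_const, Pi.zero_apply, zero_apply] at h
  linarith

end FramedSurface

/-! ### From the equation for u to the Jacobi equation for ψ -/

namespace FramedSurface

open MetricChart SasakianChart

variable {V : Type*} [NormedAddCommGroup V] [NormedSpace ℝ V] [FiniteDimensional ℝ V]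
  {A : SasakianChart V} {E : Type*} [NormedAddCommGroup E] [NormedSpace ℝ E]
  {F : FramedSurface A E} {q : E}

/-- Both ⟨D_s ν, ν⟩ and ⟨D_s ν, T⟩ = -⟨J(αν + βT), ν⟩ = -α⟨Z, ν⟩ vanish. This removes the S-term
from the mean curvature. -/
theorem inner_cov_ν_self (hq : q ∈ F.U) {s : E} {α β : ℝ}
    (hs : fderiv ℝ F.x q s = α • F.ν q + β • A.T (F.x q)) :
    A.G (F.x q) (A.cov F.x F.ν q s) (fderiv ℝ F.x q s) = 0 := by
  have hf := F.frame q hq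
  have hy := F.mapsTo q hq
  have h := cov_ν_T hq s
  rw [hs] at h ⊢
  simp [hf.Jν, A.J_T _ hy, A.symm _ hy (F.Z q), hf.νZ] at h
  simp [cov_ν_ν hq, h]

/-- The Jacobi equation for `ψ = ⟨N, T⟩` in a Sasakian chart. -/
theorem jacobi_equation (hV : Module.finrank ℝ V = 3) {H : ℝ}
    (hH : ∀ p ∈ F.U, A.G (F.x p) (A.cov F.x F.Z p (F.z p)) (F.ν p) = 2 * H)
    {h ψ : E → ℝ} {N : E → V} (hh : ContDiffOn ℝ 2 h F.U) (hψ : ContDiffOn ℝ 2 ψ F.U)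
    (hpos : ∀ p ∈ F.U, 0 < h p) (hsum : ∀ p ∈ F.U, h p ^ 2 + ψ p ^ 2 = 1)
    (hu : ∀ p ∈ F.U, ψ p = F.u p * h p)
    (hN : ∀ p ∈ F.U, N p = h p • F.ν p + ψ p • A.T (F.x p)) (hq : q ∈ F.U) :
    let BZ := -A.cov F.x N q (F.z q)
    let S := ψ q • F.ν q - h q • A.T (F.x q)
    fderiv ℝ (fun p => fderiv ℝ ψ p (F.z p)) q (F.z q)
      + 2 * (h q)⁻¹ * ψ q * A.G (F.x q) BZ S * fderiv ℝ ψ q (F.z q)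
      + (A.G (F.x q) (BZ + S) (BZ + S)
        + (A.G (F.x q) (A.Rm (F.x q) (F.ν q) (F.Z q) (F.Z q)) (F.ν q) - 1) * h q ^ 2) * ψ q
      = 0 := by
  intro BZ S
  have hf := F.frame q hq
  have hy := F.mapsTo q hq
  have dh : ∀ p ∈ F.U, DifferentiableAt ℝ h p := fun p hp =>
    (hh.contDiffAt (F.isOpen.mem_nhds hp)).differentiableAt (by norm_num)
  have dψ : ∀ p ∈ F.U, DifferentiableAt ℝ ψ p := fun p hp =>
    (hψ.contDiffAt (F.isOpen.mem_nhds hp)).differentiableAt (by norm_num)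
  -- Differentiating ψ = uh and h² + ψ² = 1 gives two linear equations that determine Z(ψ) and Z(h)
  -- in terms of Z(u).
  have first : ∀ p ∈ F.U, fderiv ℝ ψ p (F.z p) = h p ^ 3 * fderiv ℝ F.u p (F.z p) ∧
      fderiv ℝ h p (F.z p) = -(ψ p * h p ^ 2 * fderiv ℝ F.u p (F.z p)) := by
    intro p hp
    have e1 : ψ =ᶠ[𝓝 p] fun r => F.u r * h r := by
      filter_upwards [F.isOpen.mem_nhds hp] with r hr using hu r hr
    have e2 : (fun r => h r ^ 2 + ψ r ^ 2) =ᶠ[𝓝 p] fun _ => 1 := by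
      filter_upwards [F.isOpen.mem_nhds hp] with r hr using hsum r hr
    have h1 := DFunLike.congr_fun (e1.fderiv_eq (𝕜 := ℝ)) (F.z p)
    rw [((du hp).hasFDerivAt.fun_mul (dh p hp).hasFDerivAt).fderiv] at h1
    have h2 := DFunLike.congr_fun (e2.fderiv_eq (𝕜 := ℝ)) (F.z p)
    have h2' : HasFDerivAt (fun r => h r ^ 2 + ψ r ^ 2) _ p :=
      ((dh p hp).hasFDerivAt.pow 2).add ((dψ p hp).hasFDerivAt.pow 2)
    rw [h2'.fderiv] at h2
    simp at h1 h2
    have h3 := hsum p hp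
    have h4 := hu p hp
    have h5 := hpos p hp
    have h6 : fderiv ℝ h p (F.z p) = -(ψ p * h p ^ 2 * fderiv ℝ F.u p (F.z p)) := by
      linear_combination (-(fderiv ℝ h p) (F.z p)) * h3 + (h p / 2) * h2 - ψ p * h p * h1
        + ψ p * (fderiv ℝ h p) (F.z p) * h4
    refine ⟨?_, h6⟩
    rw [h6] at h1
    rw [h1]
    linear_combination (h p * fderiv ℝ F.u p (F.z p)) * (-h3)
      + ψ p * h p * fderiv ℝ F.u p (F.z p) * h4
  have second : fderiv ℝ (fun p => fderiv ℝ ψ p (F.z p)) q (F.z q)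
      = 3 * h q ^ 2 * fderiv ℝ h q (F.z q) * fderiv ℝ F.u q (F.z q)
        + h q ^ 3 * fderiv ℝ (fun p => fderiv ℝ F.u p (F.z p)) q (F.z q) := by
    have e1 : (fun p => fderiv ℝ ψ p (F.z p)) =ᶠ[𝓝 q]
        fun p => h p ^ 3 * fderiv ℝ F.u p (F.z p) := by
      filter_upwards [F.isOpen.mem_nhds hq] with r hr using (first r hr).1
    have h2 : HasFDerivAt (fun p => h p ^ 3 * fderiv ℝ F.u p (F.z p)) _ q :=
      ((dh q hq).hasFDerivAt.pow 3).mul (duz hq).hasFDerivAt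
    rw [e1.fderiv_eq, h2.fderiv]
    simp
    ring
  have hBZ : BZ = -(fderiv ℝ h q (F.z q) • F.ν q + h q • (A.T (F.x q) - (2 * H) • F.Z q)
      + fderiv ℝ ψ q (F.z q) • A.T (F.x q) - ψ q • F.ν q) := by
    have e1 : N =ᶠ[𝓝 q] fun p => h p • F.ν p + ψ p • A.T (F.x p) := by
      filter_upwards [F.isOpen.mem_nhds hq] with r hr using hN r hr
    simp only [BZ]
    rw [cov_congr e1, cov_add ((dh q hq).fun_smul (dν hq)) ((dψ q hq).fun_smul (dT hq)),
      cov_smul (dh q hq) (dν hq), cov_smul (dψ q hq) (dT hq), cov_T hy (dx hq), F.x_z q hq, hf.JZ,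
      cov_ν_z hq hV, hH q hq]
    module
  have hZν := A.symm _ hy (F.Z q) (F.ν q)
  have hTν := A.symm _ hy (A.T (F.x q)) (F.ν q)
  have hTZ := A.symm _ hy (A.T (F.x q)) (F.Z q)
  have hTT := A.T_unit _ hy
  have comb : ∀ a b c a' b' c' : ℝ,
      A.G (F.x q) (a • F.ν q + b • F.Z q + c • A.T (F.x q))
        (a' • F.ν q + b' • F.Z q + c' • A.T (F.x q)) = a * a' + b * b' + c * c' := by
    intro a b c a' b' c'
    simp [hZν, hTν, hTZ, hTT, hf.νν, hf.νZ, hf.νT, hf.ZT, hf.ZZ]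
  have hBZ' : BZ = (ψ q - fderiv ℝ h q (F.z q)) • F.ν q + (2 * H * h q) • F.Z q
      + (-h q - fderiv ℝ ψ q (F.z q)) • A.T (F.x q) := by rw [hBZ]; module
  have hS' : S = ψ q • F.ν q + (0 : ℝ) • F.Z q + (-h q) • A.T (F.x q) := by
    simp only [S]; module
  have hBS : BZ + S = (2 * ψ q - fderiv ℝ h q (F.z q)) • F.ν q + (2 * H * h q) • F.Z q
      + (-(2 * h q) - fderiv ℝ ψ q (F.z q)) • A.T (F.x q) := by rw [hBZ', hS']; module
  rw [hBS, comb, hBZ', hS', comb, second, (first q hq).1, (first q hq).2, hu q hq]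
  have hr : h q ^ 2 * (1 + F.u q ^ 2) = 1 := by
    have := hsum q hq
    rw [hu q hq] at this
    linarith
  have hpde := second_order_equation hV hH hq
  have h0 := (hpos q hq).ne'
  have hinv : (h q)⁻¹ * h q = 1 := inv_mul_cancel₀ h0
  generalize A.G (F.x q) (A.Rm (F.x q) (F.ν q) (F.Z q) (F.Z q)) (F.ν q) = κ at *
  generalize fderiv ℝ (fun p => fderiv ℝ F.u p (F.z p)) q (F.z q) = b at *
  generalize fderiv ℝ F.u q (F.z q) = a at *
  generalize F.u q = u at *
  generalize h q = t at *
  -- With a = Z(u) and t = h: ⟨B(Z), S⟩ = 1 + t²a and |B(Z) + S|² = (2 + t²a)² + 4H²t², both modulo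
  -- t²(1 + u²) = 1. The sum is then t³ times `hpde`; the multiplier of `hr` collects the uses of
  -- that relation.
  field_simp
  linear_combination t ^ 3 * hpde + (2 * u * t ^ 3 * a * (t ^ 2 * a + 1)
    + (2 + t ^ 2 * a) ^ 2 * u * t - 4 * u * t) * hr

end FramedSurface

/-! ### Differentials of charts -/

namespace ChartTransport

variable {M : Type*} [TopologicalSpace M] [ChartedSpace E3 M] [IsManifold (𝓡 3) ∞ M]
  (e : OpenPartialHomeomorph M E3)

/-- The derivative of the inverse of a chart. -/
def pull (y : E3) : E3 →L[ℝ] E3 := mfderiv (𝓡 3) (𝓡 3) e.symm y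

/-- The derivative of a chart. -/
def push (x : M) : E3 →L[ℝ] E3 := mfderiv (𝓡 3) (𝓡 3) e x

variable {e} (he : e ∈ IsManifold.maximalAtlas (𝓡 3) ∞ M)
include he

theorem mdifferentiable : e.MDifferentiable (𝓡 3) (𝓡 3) :=
  ⟨(contMDiffOn_of_mem_maximalAtlas he).mdifferentiableOn (by simp),
    (contMDiffOn_symm_of_mem_maximalAtlas he).mdifferentiableOn (by simp)⟩

theorem pull_push {x : M} (hx : x ∈ e.source) (u : E3) : pull e (e x) (push e x u) = u :=
  DFunLike.congr_fun ((mdifferentiable he).symm_comp_deriv hx) u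

theorem push_pull {y : E3} (hy : y ∈ e.target) (u : E3) : push e (e.symm y) (pull e y u) = u :=
  DFunLike.congr_fun ((mdifferentiable he).comp_symm_deriv hy) u

theorem pull_push_symm {y : E3} (hy : y ∈ e.target) (u : E3) :
    pull e y (push e (e.symm y) u) = u := by
  have := pull_push he (e.map_target hy) u
  rwa [e.right_inv hy] at this

theorem contMDiffOn_pull (v : E3) : ContMDiffOn (𝓡 3) (𝓡 3).tangent ∞
    (fun y => (⟨e.symm y, pull e y v⟩ : TangentBundle (𝓡 3) M)) e.target := by
  have h1 := (contMDiffOn_symm_of_mem_maximalAtlas he).contMDiffOn_tangentMapWithin (m := ∞)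
    (by simp) e.open_target.uniqueMDiffOn
  have h2 : ContMDiff (𝓡 3) (𝓡 3).tangent ∞
      (fun y : E3 => (⟨y, v⟩ : TangentBundle (𝓡 3) E3)) :=
    contMDiff_vectorSpace_iff_contDiff.2 contDiff_const
  refine (h1.comp (h2.contMDiffOn (s := e.target)) (fun y hy => hy)).congr fun y hy => ?_
  simp only [Function.comp, tangentMapWithin, pull]
  rw [mfderivWithin_of_isOpen e.open_target hy]
  rfl

/-- Stated for fields along a map `b`, so as to serve both for fields on M (`b` an inverse chart)
and for fields along the surface. The case `n = 0` handles the normal, which is only continuous at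
first. -/
theorem contDiffOn_push {X : Type*} [NormedAddCommGroup X] [NormedSpace ℝ X] {s : Set X}
    {n : ℕ∞ω} (hn : n ≤ ∞)
    {b : X → M} {v : ∀ q : X, TangentSpace (𝓡 3) (b q)} (hb : ∀ q ∈ s, b q ∈ e.source)
    (hv : ContMDiffOn 𝓘(ℝ, X) (𝓡 3).tangent n
      (fun q => (⟨b q, v q⟩ : TangentBundle (𝓡 3) M)) s) :
    ContDiffOn ℝ n (fun q => push e (b q) (v q)) s := by
  have h1 := (contMDiffOn_of_mem_maximalAtlas he).contMDiffOn_tangentMapWithin (m := ∞)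
    (by simp) e.open_source.uniqueMDiffOn
  have h2 := (contMDiff_snd_tangentBundle_modelSpace (n := n) E3 (𝓡 3)).comp_contMDiffOn
    ((h1.of_le hn).comp hv hb)
  refine contMDiffOn_iff_contDiffOn.1 (h2.congr fun q hq => ?_)
  simp only [Function.comp, tangentMapWithin, push]
  rw [mfderivWithin_of_isOpen e.open_source (hb q hq)]
  rfl

end ChartTransport

/-! ### The contact sub-Riemannian structure in coordinates -/

namespace ContactSubRiemannian

open ChartTransport

variable {M : Type*} [TopologicalSpace M] [ChartedSpace E3 M] [IsManifold (𝓡 3) ∞ M]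
  (C : ContactSubRiemannian M) (e : OpenPartialHomeomorph M E3)

/-- The contact form in coordinates. -/
def etaChart (y : E3) : E3 →L[ℝ] ℝ := ContinuousLinearMap.comp (C.eta (e.symm y)) (pull e y)

/-- The Reeb field in coordinates. -/
def reebChart (y : E3) : E3 := push e (e.symm y) (C.reeb (e.symm y))

/-- The endomorphism `J` in coordinates. -/
def JChart (y : E3) : E3 →L[ℝ] E3 :=
  (push e (e.symm y)) ∘L (ContinuousLinearMap.comp (C.J (e.symm y)) (pull e y) : E3 →L[ℝ] E3)

/-- The tensor `gh` in coordinates. -/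
def ghChart (y : E3) : E3 →L[ℝ] E3 →L[ℝ] ℝ :=
  ContinuousLinearMap.bilinearComp (C.gh (e.symm y)) (pull e y) (pull e y)

/-- The horizontal projection in coordinates. -/
def horizChart (y : E3) : E3 →L[ℝ] E3 :=
  ContinuousLinearMap.id ℝ E3 - (C.etaChart e y).smulRight (C.reebChart e y)

/-- The metric `g` in coordinates. -/
def gChart (y : E3) : E3 →L[ℝ] E3 →L[ℝ] ℝ :=
  (C.ghChart e y).bilinearComp (C.horizChart e y) (C.horizChart e y)
    + (C.etaChart e y).smulRight (C.etaChart e y)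

theorem etaChart_apply (y u : E3) : C.etaChart e y u = C.eta (e.symm y) (pull e y u) := rfl

theorem ghChart_apply (y u v : E3) :
    C.ghChart e y u v = C.gh (e.symm y) (pull e y u) (pull e y v) := rfl

theorem JChart_apply (y u : E3) :
    C.JChart e y u = push e (e.symm y) (C.J (e.symm y) (pull e y u)) := rfl

theorem horizChart_apply (y u : E3) :
    C.horizChart e y u = u - C.etaChart e y u • C.reebChart e y := rfl

theorem gChart_apply (y u v : E3) : C.gChart e y u v
    = C.ghChart e y (C.horizChart e y u) (C.horizChart e y v)
      + C.etaChart e y u * C.etaChart e y v := rfl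

variable {e} (he : e ∈ IsManifold.maximalAtlas (𝓡 3) ∞ M)
include he

theorem gCoord_eq {y : E3} (hy : y ∈ e.target) (u v : E3) :
    C.gCoord e y u v = C.gChart e y u v := by
  have h : ∀ w : E3, pull e y (C.horizChart e y w) = C.horiz (e.symm y) (pull e y w) := by
    intro w
    rw [horizChart_apply, map_sub, map_smul]
    exact congrArg (fun t => pull e y w - C.etaChart e y w • t)
      (pull_push_symm he hy (C.reeb (e.symm y)))
  rw [gChart_apply, ghChart_apply, h, h]
  rfl

theorem g_eq {x : M} (hx : x ∈ e.source) (u v : TangentSpace (𝓡 3) x) :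
    C.g x u v = C.gChart e (e x) (push e x u) (push e x v) := by
  rw [← C.gCoord_eq he (e.map_source hx)]
  have hu := pull_push he hx u
  have hv := pull_push he hx v
  -- The types of the vectors depend on the base point, so `e.left_inv` is applied through a
  -- generalized base point with vectors in the common model `E3`.
  have key : ∀ x', x' = x → ∀ u' v' : E3, C.g x' u' v' = C.g x u' v' := by
    rintro _ rfl _ _; rfl
  rw [show C.gCoord e (e x) (push e x u) (push e x v) = C.g (e.symm (e x))
    (pull e (e x) (push e x u)) (pull e (e x) (push e x v)) from rfl,
    key _ (e.left_inv hx), hu, hv]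

theorem etaChart_smooth : ContDiffOn ℝ ∞ (C.etaChart e) e.target := by
  refine contDiffOn_clm_apply.2 fun u => contMDiffOn_iff_contDiffOn.1 ?_
  have h1 := C.eta_smooth.comp_contMDiffOn (contMDiffOn_symm_of_mem_maximalAtlas he)
  intro y hy
  have h2 : ContMDiffWithinAt (𝓡 3) ((𝓡 3).prod 𝓘(ℝ, ℝ)) ∞
      (fun y => Bundle.TotalSpace.mk' ℝ (E := Bundle.Trivial M ℝ) (e.symm y)
        (C.eta (e.symm y) (pull e y u))) e.target y :=
    ContMDiffWithinAt.clm_bundle_apply (E₁ := fun x : M => TangentSpace (𝓡 3) x)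
      (E₂ := Bundle.Trivial M ℝ) (h1 y hy) (contMDiffOn_pull he u y hy)
  exact (Bundle.contMDiffWithinAt_totalSpace.1 h2).2

theorem ghChart_smooth : ContDiffOn ℝ ∞ (C.ghChart e) e.target := by
  refine contDiffOn_clm_apply.2 fun u => contDiffOn_clm_apply.2 fun v =>
    contMDiffOn_iff_contDiffOn.1 ?_
  have h1 := C.gh_smooth.comp_contMDiffOn (contMDiffOn_symm_of_mem_maximalAtlas he)
  intro y hy
  have h2 : ContMDiffWithinAt (𝓡 3) ((𝓡 3).prod 𝓘(ℝ, ℝ)) ∞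
      (fun y => Bundle.TotalSpace.mk' ℝ (E := Bundle.Trivial M ℝ) (e.symm y)
        (C.gh (e.symm y) (pull e y u) (pull e y v))) e.target y :=
    ContMDiffWithinAt.clm_bundle_apply₂ (E₁ := fun x : M => TangentSpace (𝓡 3) x)
      (E₂ := fun x : M => TangentSpace (𝓡 3) x)
      (E₃ := Bundle.Trivial M ℝ) (h1 y hy) (contMDiffOn_pull he u y hy)
      (contMDiffOn_pull he v y hy)
  exact (Bundle.contMDiffWithinAt_totalSpace.1 h2).2

theorem reebChart_smooth : ContDiffOn ℝ ∞ (C.reebChart e) e.target :=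
  contDiffOn_push he le_rfl (fun _ hy => e.map_target hy)
    (C.reeb_smooth.comp_contMDiffOn (contMDiffOn_symm_of_mem_maximalAtlas he))

theorem JChart_smooth : ContDiffOn ℝ ∞ (C.JChart e) e.target := by
  refine contDiffOn_clm_apply.2 fun u => ?_
  have h1 := C.J_smooth.comp_contMDiffOn (contMDiffOn_symm_of_mem_maximalAtlas he)
  refine contDiffOn_push he (b := e.symm) (v := fun y => C.J (e.symm y) (pull e y u)) le_rfl
    (fun _ hy => e.map_target hy) fun y hy => ?_
  exact ContMDiffWithinAt.clm_bundle_apply (E₁ := fun x : M => TangentSpace (𝓡 3) x)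
      (E₂ := fun x : M => TangentSpace (𝓡 3) x) (h1 y hy) (contMDiffOn_pull he u y hy)

theorem horizChart_smooth : ContDiffOn ℝ ∞ (C.horizChart e) e.target := by
  refine contDiffOn_clm_apply.2 fun u => ?_
  simp only [horizChart_apply]
  exact contDiffOn_const.sub (((C.etaChart_smooth he).clm_apply contDiffOn_const).smul
    (C.reebChart_smooth he))

theorem gChart_smooth : ContDiffOn ℝ ∞ (C.gChart e) e.target := by
  refine contDiffOn_clm_apply.2 fun u => contDiffOn_clm_apply.2 fun v => ?_
  simp only [gChart_apply]
  have h := C.horizChart_smooth he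
  have h' := C.etaChart_smooth he
  exact (((C.ghChart_smooth he).clm_apply (h.clm_apply contDiffOn_const)).clm_apply
    (h.clm_apply contDiffOn_const)).add
    ((h'.clm_apply contDiffOn_const).mul (h'.clm_apply contDiffOn_const))

end ContactSubRiemannian

/-! ### Pullback of vector fields and the exterior derivative in a chart -/

namespace ChartTransport

variable {M : Type*} [TopologicalSpace M] [ChartedSpace E3 M] [IsManifold (𝓡 3) ∞ M]
  {e : OpenPartialHomeomorph M E3} (he : e ∈ IsManifold.maximalAtlas (𝓡 3) ∞ M)
include he

theorem inverse_push {x : M} (hx : x ∈ e.source) : (push e x).inverse = pull e (e x) := by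
  refine ContinuousLinearMap.inverse_eq ?_ ?_
  · ext1 u
    have := push_pull he (e.map_source hx) u
    rw [e.left_inv hx] at this
    exact this
  · ext1 u
    exact pull_push he hx u

theorem isInvertible_push {x : M} (hx : x ∈ e.source) : (push e x).IsInvertible := by
  refine ContinuousLinearMap.IsInvertible.of_inverse (g := pull e (e x)) ?_ ?_
  · ext1 u
    have := push_pull he (e.map_source hx) u
    rw [e.left_inv hx] at this
    exact this
  · ext1 u
    exact pull_push he hx u

theorem mpullback_chart {x : M} (hx : x ∈ e.source) (V : E3 → E3) :
    VectorField.mpullback (𝓡 3) (𝓡 3) e V x = pull e (e x) (V (e x)) := by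
  rw [← inverse_push he hx]
  rfl

theorem mfderiv_comp_chart {F : Type*} [NormedAddCommGroup F] [NormedSpace ℝ F] {x : M}
    (hx : x ∈ e.source) {f : M → F} {g : E3 → F}
    (hfg : f =ᶠ[𝓝 x] g ∘ e) (hg : DifferentiableAt ℝ g (e x)) (u : TangentSpace (𝓡 3) x) :
    mfderiv (𝓡 3) 𝓘(ℝ, F) f x u = fderiv ℝ g (e x) (push e x u) := by
  have he' : MDifferentiableAt (𝓡 3) (𝓡 3) e x :=
    ((mdifferentiable he).1 x hx).mdifferentiableAt (e.open_source.mem_nhds hx)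
  rw [hfg.mfderiv_eq, mfderiv_comp x hg.mdifferentiableAt he']
  rw [mfderiv_eq_fderiv]
  rfl

/-- Makes constant coordinate fields admissible as test fields in `normalized` and `extDeriv_reeb`.
-/
theorem mdifferentiableAt_mpullback {x : M} (hx : x ∈ e.source) {V : E3 → E3}
    (hV : DifferentiableAt ℝ V (e x)) :
    VFieldDiffAt (VectorField.mpullback (𝓡 3) (𝓡 3) e V) x := by
  have : IsManifold (𝓡 3) 2 M := IsManifold.of_le (n := ∞) (by norm_cast)
  have h := (contMDiffOn_of_mem_maximalAtlas he).contMDiffAt (e.open_source.mem_nhds hx)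
  refine MDifferentiableAt.mpullback_vectorField (n := ∞) ?_ h (isInvertible_push he hx)
    (by norm_cast)
  rw [mdifferentiableAt_totalSpace]
  refine ⟨mdifferentiableAt_id, ?_⟩
  simpa using hV.mdifferentiableAt

theorem mlieBracket_mpullback {x : M} (hx : x ∈ e.source) {V W : E3 → E3}
    (hV : DifferentiableAt ℝ V (e x)) (hW : DifferentiableAt ℝ W (e x))
    {V' W' : ∀ x : M, TangentSpace (𝓡 3) x}
    (hV' : V' =ᶠ[𝓝 x] VectorField.mpullback (𝓡 3) (𝓡 3) e V)
    (hW' : W' =ᶠ[𝓝 x] VectorField.mpullback (𝓡 3) (𝓡 3) e W) :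
    VectorField.mlieBracket (𝓡 3) V' W' x
      = pull e (e x) (VectorField.lieBracket ℝ V W (e x)) := by
  have : IsManifold (𝓡 3) (minSmoothness ℝ 2) M :=
    IsManifold.of_le (n := ∞) (by simp; norm_cast)
  have h := (contMDiffOn_of_mem_maximalAtlas he).contMDiffAt (e.open_source.mem_nhds hx)
  have hd : ∀ {V : E3 → E3}, DifferentiableAt ℝ V (e x) →
      MDifferentiableAt (𝓡 3) (𝓡 3).tangent (fun y => (⟨y, V y⟩ : TangentBundle (𝓡 3) E3))
        (e x) := by
    intro V hV
    rw [mdifferentiableAt_totalSpace]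
    refine ⟨mdifferentiableAt_id, ?_⟩
    simpa using hV.mdifferentiableAt
  have key := VectorField.mpullback_mlieBracket (n := ∞) (hd hV) (hd hW) h
    (by simp; norm_cast)
  rw [hV'.mlieBracket_vectorField_eq hW', ← key]
  refine (mpullback_chart he hx _).trans (congrArg (pull e (e x)) ?_)
  exact (congrFun (VectorField.mlieBracketWithin_eq_lieBracketWithin (𝕜 := ℝ) (V := V) (W := W)
    (s := Set.univ)) (e x)).trans (congrFun VectorField.lieBracketWithin_univ (e x))

end ChartTransport

namespace ContactSubRiemannian

open ChartTransport

variable {M : Type*} [TopologicalSpace M] [ChartedSpace E3 M] [IsManifold (𝓡 3) ∞ M]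
  (C : ContactSubRiemannian M) {e : OpenPartialHomeomorph M E3}
  (he : e ∈ IsManifold.maximalAtlas (𝓡 3) ∞ M)
include he

theorem differentiableAt_etaChart {y : E3} (hy : y ∈ e.target) :
    DifferentiableAt ℝ (C.etaChart e) y :=
  ((C.etaChart_smooth he).contDiffAt (e.open_target.mem_nhds hy)).differentiableAt (by simp)

theorem differentiableAt_reebChart {y : E3} (hy : y ∈ e.target) :
    DifferentiableAt ℝ (C.reebChart e) y :=
  ((C.reebChart_smooth he).contDiffAt (e.open_target.mem_nhds hy)).differentiableAt (by simp)

/-- Only germs matter. The fields are compared near the point and not globally because the Reeb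
field is known to be a pullback only on the source of the chart. -/
theorem extDerivOneForm_chart {y : E3} (hy : y ∈ e.target) {V W : E3 → E3}
    (hV : DifferentiableAt ℝ V y) (hW : DifferentiableAt ℝ W y)
    {V' W' : ∀ x : M, TangentSpace (𝓡 3) x}
    (hV' : V' =ᶠ[𝓝 (e.symm y)] VectorField.mpullback (𝓡 3) (𝓡 3) e V)
    (hW' : W' =ᶠ[𝓝 (e.symm y)] VectorField.mpullback (𝓡 3) (𝓡 3) e W) :
    extDerivOneForm C.eta V' W' (e.symm y) = (1 / 2 : ℝ) *
      (fderiv ℝ (fun z => C.etaChart e z (W z)) y (V y)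
        - fderiv ℝ (fun z => C.etaChart e z (V z)) y (W y)
        - C.etaChart e y (VectorField.lieBracket ℝ V W y)) := by
  have hx := e.map_target hy
  have hr := e.right_inv hy
  have hval : ∀ {V : E3 → E3} {V' : ∀ x : M, TangentSpace (𝓡 3) x},
      V' =ᶠ[𝓝 (e.symm y)] VectorField.mpullback (𝓡 3) (𝓡 3) e V →
      push e (e.symm y) (V' (e.symm y)) = V y := by
    intro V V' h
    have h1 : V' (e.symm y) = pull e (e (e.symm y)) (V (e (e.symm y))) := by
      rw [h.eq_of_nhds, mpullback_chart he hx]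
    rw [hr] at h1
    rw [show push e (e.symm y) (V' (e.symm y)) = push e (e.symm y) (pull e y (V y)) from
      congrArg (push e (e.symm y)) h1, push_pull he hy]
  have hder : ∀ {V : E3 → E3} {V' : ∀ x : M, TangentSpace (𝓡 3) x},
      DifferentiableAt ℝ V y →
      V' =ᶠ[𝓝 (e.symm y)] VectorField.mpullback (𝓡 3) (𝓡 3) e V →
      ∀ u : TangentSpace (𝓡 3) (e.symm y),
      mfderiv (𝓡 3) 𝓘(ℝ, ℝ) (fun x => C.eta x (V' x)) (e.symm y) u
        = fderiv ℝ (fun z => C.etaChart e z (V z)) y (push e (e.symm y) u) := by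
    intro V V' hV h u
    have hd : DifferentiableAt ℝ (fun z => C.etaChart e z (V z)) (e (e.symm y)) := by
      rw [hr]
      exact (C.differentiableAt_etaChart he hy).clm_apply hV
    rw [mfderiv_comp_chart he hx (g := fun z => C.etaChart e z (V z)) ?_ hd, hr]
    filter_upwards [h, e.open_source.mem_nhds hx] with x h1 h2
    rw [h1, mpullback_chart he h2]
    have key : ∀ x', x' = x → ∀ w : E3, C.eta x' w = C.eta x w := by
      rintro _ rfl _; rfl
    exact (key _ (e.left_inv h2) _).symm
  have hb := mlieBracket_mpullback he hx (hr.symm ▸ hV) (hr.symm ▸ hW) hV' hW'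
  rw [hr] at hb
  simp only [extDerivOneForm]
  rw [hder hW hW', hder hV hV', hb]
  erw [hval hV', hval hW']
  rfl

end ContactSubRiemannian

/-! ### Contact metric identities in coordinates -/

namespace ContactSubRiemannian

open ChartTransport

variable {M : Type*} [TopologicalSpace M] [ChartedSpace E3 M] [IsManifold (𝓡 3) ∞ M]
  (C : ContactSubRiemannian M) {e : OpenPartialHomeomorph M E3}
  (he : e ∈ IsManifold.maximalAtlas (𝓡 3) ∞ M) {y : E3} (hy : y ∈ e.target)
include he hy

theorem pull_reebChart : pull e y (C.reebChart e y) = C.reeb (e.symm y) :=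
  pull_push_symm he hy _

theorem etaChart_reebChart : C.etaChart e y (C.reebChart e y) = 1 := by
  rw [etaChart_apply, C.pull_reebChart he hy]
  exact C.eta_reeb _

theorem etaChart_horizChart (u : E3) : C.etaChart e y (C.horizChart e y u) = 0 := by
  rw [horizChart_apply, map_sub, map_smul, C.etaChart_reebChart he hy]
  simp

theorem horizChart_reebChart : C.horizChart e y (C.reebChart e y) = 0 := by
  rw [horizChart_apply, C.etaChart_reebChart he hy]
  simp

theorem horizChart_of_etaChart_eq_zero {u : E3} (hu : C.etaChart e y u = 0) :
    C.horizChart e y u = u := by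
  rw [horizChart_apply, hu]
  simp

theorem gChart_reebChart_left (u : E3) :
    C.gChart e y (C.reebChart e y) u = C.etaChart e y u := by
  rw [gChart_apply, C.horizChart_reebChart he hy, C.etaChart_reebChart he hy]
  simp

theorem gChart_symm (u v : E3) : C.gChart e y u v = C.gChart e y v u := by
  rw [gChart_apply, gChart_apply, mul_comm (C.etaChart e y u)]
  congr 1
  exact C.gh_symm _ _ _ (C.etaChart_horizChart he hy u) (C.etaChart_horizChart he hy v)

theorem gChart_pos {u : E3} (hu : u ≠ 0) : 0 < C.gChart e y u u := by
  rw [gChart_apply]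
  by_cases h : C.horizChart e y u = 0
  · rw [h]
    have h1 : u = C.etaChart e y u • C.reebChart e y := by
      rw [← sub_eq_zero, ← horizChart_apply, h]
    have h2 : C.etaChart e y u ≠ 0 := by
      intro h3
      rw [h3, zero_smul] at h1
      exact hu h1
    simp [h2, mul_self_pos]
  · have h1 : 0 < C.ghChart e y (C.horizChart e y u) (C.horizChart e y u) := by
      refine C.gh_pos _ _ (C.etaChart_horizChart he hy u) fun h0 => h ?_
      rw [← push_pull he hy (C.horizChart e y u)]
      exact (congrArg (push e (e.symm y)) h0).trans (map_zero _)
    have := mul_self_nonneg (C.etaChart e y u)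
    linarith

theorem JChart_reebChart : C.JChart e y (C.reebChart e y) = 0 := by
  rw [JChart_apply, C.pull_reebChart he hy]
  exact (congrArg (push e (e.symm y)) (C.J_reeb _)).trans (map_zero _)

theorem JChart_horizChart (u : E3) : C.JChart e y (C.horizChart e y u) = C.JChart e y u := by
  rw [horizChart_apply, map_sub, map_smul, C.JChart_reebChart he hy]
  simp

theorem pull_JChart (u : E3) : pull e y (C.JChart e y u) = C.J (e.symm y) (pull e y u) :=
  pull_push_symm he hy _

theorem etaChart_JChart (u : E3) : C.etaChart e y (C.JChart e y u) = 0 := by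
  rw [← C.JChart_horizChart he hy, etaChart_apply, C.pull_JChart he hy]
  exact C.J_horizontal _ _ (C.etaChart_horizChart he hy u)

theorem JChart_JChart {u : E3} (hu : C.etaChart e y u = 0) :
    C.JChart e y (C.JChart e y u) = -u := by
  rw [JChart_apply, C.pull_JChart he hy]
  have h := C.J_sq (e.symm y) (pull e y u) hu
  refine (congrArg (push e (e.symm y)) h).trans ?_
  refine (map_neg (push e (e.symm y)) (pull e y u)).trans ?_
  rw [push_pull he hy]

theorem gChart_of_horizontal {u v : E3} (hu : C.etaChart e y u = 0) (hv : C.etaChart e y v = 0) :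
    C.gChart e y u v = C.ghChart e y u v := by
  rw [gChart_apply, C.horizChart_of_etaChart_eq_zero he hy hu,
    C.horizChart_of_etaChart_eq_zero he hy hv, hu]
  simp

theorem gChart_JChart_JChart (u : E3) : C.gChart e y (C.JChart e y u) (C.JChart e y u)
    = C.gChart e y u u - (C.gChart e y (C.reebChart e y) u) ^ 2 := by
  rw [C.gChart_reebChart_left he hy, C.gChart_of_horizontal he hy (C.etaChart_JChart he hy u)
    (C.etaChart_JChart he hy u), gChart_apply, ← C.JChart_horizChart he hy u, ghChart_apply,
    C.pull_JChart he hy]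
  have h0 := C.etaChart_horizChart he hy u
  have h : C.gh (e.symm y) (C.J (e.symm y) (pull e y (C.horizChart e y u)))
      (C.J (e.symm y) (pull e y (C.horizChart e y u)))
      = C.ghChart e y (C.horizChart e y u) (C.horizChart e y u) := C.J_isometry _ _ _ h0 h0
  rw [h]
  ring

theorem fderiv_etaChart_apply (u v : E3) :
    fderiv ℝ (fun z => C.etaChart e z v) y u = fderiv ℝ (C.etaChart e) y u v := by
  rw [((C.differentiableAt_etaChart he hy).hasFDerivAt.clm_apply (hasFDerivAt_const v y)).fderiv]
  simp

/-- Constant fields are horizontal at `y` but perhaps not nearby; `normalized` asks for no more.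
Their bracket vanishes, and the factor 2 undoes the 1/2 in the convention for dη. -/
theorem extDeriv_etaChart_of_horizontal {u v : E3} (hu : C.etaChart e y u = 0)
    (hv : C.etaChart e y v = 0) :
    fderiv ℝ (C.etaChart e) y u v - fderiv ℝ (C.etaChart e) y v u
      = 2 * C.gChart e y (C.JChart e y u) v := by
  have hx := e.map_target hy
  have hr := e.right_inv hy
  have hc : ∀ w : E3, DifferentiableAt ℝ (fun _ : E3 => w) y := fun w => differentiableAt_const w
  have hval : ∀ w : E3, VectorField.mpullback (𝓡 3) (𝓡 3) e (fun _ => w) (e.symm y)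
      = pull e y w := by
    intro w
    refine (mpullback_chart he hx _).trans ?_
    rw [hr]
  have hdiff : ∀ w : E3,
      VFieldDiffAt (VectorField.mpullback (𝓡 3) (𝓡 3) e (fun _ => w)) (e.symm y) := fun w =>
    mdifferentiableAt_mpullback he hx (differentiableAt_const _)
  have h1 := C.normalized (e.symm y) _ _ (hdiff u) (hdiff v) (by rw [hval]; exact hu)
    (by rw [hval]; exact hv)
  rw [C.extDerivOneForm_chart he hy (hc u) (hc v) Filter.EventuallyEq.rfl
    Filter.EventuallyEq.rfl, hval, hval, C.fderiv_etaChart_apply he hy,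
    C.fderiv_etaChart_apply he hy] at h1
  have h2 : C.gChart e y (C.JChart e y u) v
      = C.gh (e.symm y) (C.J (e.symm y) (pull e y u)) (pull e y v) := by
    rw [C.gChart_of_horizontal he hy (C.etaChart_JChart he hy u) hv, ghChart_apply,
      C.pull_JChart he hy]
  rw [h2]
  simp only [VectorField.lieBracket, fderiv_fun_const, Pi.zero_apply, zero_apply, sub_self,
    map_zero, sub_zero] at h1
  have h3 := (eq_div_iff (by norm_num : (1 : ℝ) / 2 ≠ 0)).2 ((mul_comm _ _).trans h1)
  rw [h3]
  ring

theorem fderiv_eta_reeb (u : E3) : fderiv ℝ (C.etaChart e) y u (C.reebChart e y)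
    + C.etaChart e y (fderiv ℝ (C.reebChart e) y u) = 0 := by
  have h : (fun z => C.etaChart e z (C.reebChart e z)) =ᶠ[𝓝 y] fun _ => 1 := by
    filter_upwards [e.open_target.mem_nhds hy] with z hz using C.etaChart_reebChart he hz
  have h1 := DFunLike.congr_fun (h.fderiv_eq (𝕜 := ℝ)) u
  rw [((C.differentiableAt_etaChart he hy).hasFDerivAt.clm_apply
    (C.differentiableAt_reebChart he hy).hasFDerivAt).fderiv] at h1
  simp at h1
  linarith

/-- This is L_T η = 0 on a constant field: dη(T, ·) = 0 and η(T) is constant, while [T, u] = -(∂_u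
T). -/
theorem lieDeriv_etaChart (u : E3) : fderiv ℝ (C.etaChart e) y (C.reebChart e y) u
    + C.etaChart e y (fderiv ℝ (C.reebChart e) y u) = 0 := by
  have hx := e.map_target hy
  have hc : DifferentiableAt ℝ (fun _ : E3 => u) y := differentiableAt_const u
  have h1 := C.extDeriv_reeb (e.symm y) _
    (mdifferentiableAt_mpullback he hx (V := fun _ => u) (differentiableAt_const _))
  have hreeb : C.reeb =ᶠ[𝓝 (e.symm y)] VectorField.mpullback (𝓡 3) (𝓡 3) e (C.reebChart e) := by
    filter_upwards [e.open_source.mem_nhds hx] with x hx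
    rw [mpullback_chart he hx, C.pull_reebChart he (e.map_source hx), e.left_inv hx]
  rw [C.extDerivOneForm_chart he hy (C.differentiableAt_reebChart he hy) hc hreeb
    Filter.EventuallyEq.rfl, C.fderiv_etaChart_apply he hy] at h1
  have h : (fun z => C.etaChart e z (C.reebChart e z)) =ᶠ[𝓝 y] fun _ => 1 := by
    filter_upwards [e.open_target.mem_nhds hy] with z hz using C.etaChart_reebChart he hz
  rw [h.fderiv_eq] at h1
  simp [VectorField.lieBracket] at h1
  linarith

/-- Both sides ignore the Reeb components of `u` and `v`, since dη(T, ·) = 0, JT = 0 and J is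
horizontal-valued; this reduces to horizontal vectors. -/
theorem extDeriv_etaChart (u v : E3) :
    fderiv ℝ (C.etaChart e) y u v - fderiv ℝ (C.etaChart e) y v u
      = 2 * C.gChart e y (C.JChart e y u) v := by
  have h0 := C.extDeriv_etaChart_of_horizontal he hy (C.etaChart_horizChart he hy u)
    (C.etaChart_horizChart he hy v)
  have hT : ∀ w, fderiv ℝ (C.etaChart e) y (C.reebChart e y) w
      = fderiv ℝ (C.etaChart e) y w (C.reebChart e y) := fun w => by
    linarith [C.fderiv_eta_reeb he hy w, C.lieDeriv_etaChart he hy w]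
  have h1 : C.gChart e y (C.JChart e y u) (C.horizChart e y v) = C.gChart e y (C.JChart e y u) v := by
    rw [horizChart_apply, map_sub, map_smul, C.gChart_symm he hy _ (C.reebChart e y),
      C.gChart_reebChart_left he hy, C.etaChart_JChart he hy]
    simp
  rw [C.JChart_horizChart he hy, h1] at h0
  rw [← h0]
  simp only [horizChart_apply, map_sub, map_smul, sub_apply, smul_apply, smul_eq_mul, hT]
  ring

end ContactSubRiemannian

/-! ### The Reeb flow and the Killing equation -/

/-- The derivative at time `0` of the differential of a flow is the differential of the vector
field. -/
theorem hasDerivAt_fderiv_flow {V : Type*} [NormedAddCommGroup V] [NormedSpace ℝ V]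
    {f : ℝ × V → V} {T : V → V} {y : V} (hf : ContDiffAt ℝ 2 f (0, y))
    (hT : ∀ᶠ z in 𝓝 y, fderiv ℝ f (0, z) (1, 0) = T z) (u : V) :
    HasDerivAt (fun s : ℝ => fderiv ℝ f (s, y) (0, u)) (fderiv ℝ T y u) 0 := by
  have h2 : HasFDerivAt (fderiv ℝ f) (fderiv ℝ (fderiv ℝ f) (0, y)) (0, y) :=
    ((hf.fderiv_right (m := 1) (by norm_num)).differentiableAt (by norm_num)).hasFDerivAt
  -- Symmetry of the second derivative of `f` interchanges time and space differentiation.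
  have hsymm := (hf.isSymmSndFDerivAt (by simp)).eq ((1, 0) : ℝ × V) (0, u)
  have hs : HasDerivAt (fun s : ℝ => (s, y)) ((1, 0) : ℝ × V) 0 :=
    (hasDerivAt_id 0).prodMk (hasDerivAt_const 0 y)
  have hz : HasFDerivAt (fun z : V => ((0 : ℝ), z)) (ContinuousLinearMap.inr ℝ ℝ V) y :=
    hasFDerivAt_prodMk_right 0 y
  have e1 : HasDerivAt (fun s : ℝ => fderiv ℝ f (s, y))
      (fderiv ℝ (fderiv ℝ f) (0, y) (1, 0)) 0 := h2.comp_hasDerivAt (0 : ℝ) hs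
  have e2 := e1.clm_apply (hasDerivAt_const (0 : ℝ) ((0, u) : ℝ × V))
  have e3 : HasFDerivAt (fun z : V => fderiv ℝ f (0, z))
      ((fderiv ℝ (fderiv ℝ f) (0, y)) ∘L ContinuousLinearMap.inr ℝ ℝ V) y := h2.comp y hz
  have e4 := e3.clm_apply (hasFDerivAt_const ((1, 0) : ℝ × V) y)
  have e5 : fderiv ℝ T y u = fderiv ℝ (fderiv ℝ f) (0, y) (0, u) (1, 0) := by
    have : (fun z : V => fderiv ℝ f (0, z) (1, 0)) =ᶠ[𝓝 y] T := hT
    rw [← this.fderiv_eq, e4.fderiv]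
    simp
  rw [e5, ← hsymm]
  simpa using e2

namespace ContactSubRiemannian

open ChartTransport

variable {M : Type*} [TopologicalSpace M] [ChartedSpace E3 M] [IsManifold (𝓡 3) ∞ M]
  (C : ContactSubRiemannian M) {e : OpenPartialHomeomorph M E3}
  (he : e ∈ IsManifold.maximalAtlas (𝓡 3) ∞ M)
include he

theorem etaChart_push {x : M} (hx : x ∈ e.source) (u : E3) :
    C.etaChart e (e x) (push e x u) = C.eta x u := by
  have key : ∀ x', x' = x → ∀ u' : E3, C.eta x' u' = C.eta x u' := by
    rintro _ rfl _; rfl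
  rw [etaChart_apply, pull_push he hx]
  exact key _ (e.left_inv hx) u

theorem ghChart_push {x : M} (hx : x ∈ e.source) (u v : E3) :
    C.ghChart e (e x) (push e x u) (push e x v) = C.gh x u v := by
  have key : ∀ x', x' = x → ∀ u' v' : E3, C.gh x' u' v' = C.gh x u' v' := by
    rintro _ rfl _ _; rfl
  rw [ghChart_apply, pull_push he hx, pull_push he hx]
  exact key _ (e.left_inv hx) u v

/-- The flow preserves horizontality and `gh`, so s ↦ g(dΦ_s u, dΦ_s v) is constant near 0; the left
side is its derivative at s = 0, read in the chart. -/
theorem lieDeriv_gChart_of_horizontal (hC : C.IsSasakian) {y : E3} (hy : y ∈ e.target) {u v : E3}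
    (hu : C.etaChart e y u = 0) (hv : C.etaChart e y v = 0) :
    fderiv ℝ (C.gChart e) y (C.reebChart e y) u v + C.gChart e y (fderiv ℝ (C.reebChart e) y u) v
      + C.gChart e y u (fderiv ℝ (C.reebChart e) y v) = 0 := by
  obtain ⟨W, ε, Φ, hW, hxW, hε, hΦ, hΦ0, hint, hiso⟩ := hC (e.symm y)
  have h0 : (0 : ℝ) ∈ Set.Ioo (-ε) ε := ⟨by linarith, hε⟩
  set f : ℝ × E3 → E3 := fun q => e (Φ q.1 (e.symm q.2)) with hf
  have hopen : IsOpen (Set.Ioo (-ε) ε ×ˢ W) := isOpen_Ioo.prod hW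
  have hsm : ∀ s ∈ Set.Ioo (-ε) ε, ∀ x ∈ W,
      ContMDiffAt (𝓘(ℝ, ℝ).prod (𝓡 3)) (𝓡 3) ∞ (fun q : ℝ × M => Φ q.1 q.2) (s, x) :=
    fun s hs x hx => hΦ.contMDiffAt (hopen.mem_nhds ⟨hs, hx⟩)
  have hinner : ∀ s : ℝ, ∀ z ∈ e.target, ContMDiffAt 𝓘(ℝ, ℝ × E3) (𝓘(ℝ, ℝ).prod (𝓡 3)) ∞
      (fun q : ℝ × E3 => (q.1, e.symm q.2)) (s, z) := by
    intro s z hz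
    refine ContMDiffAt.prodMk contDiff_fst.contMDiff.contMDiffAt ?_
    have h1 : ContMDiffAt (𝓡 3) (𝓡 3) ∞ e.symm z :=
      (contMDiffOn_symm_of_mem_maximalAtlas he).contMDiffAt (e.open_target.mem_nhds hz)
    exact ContMDiffAt.comp (s, z) h1 (contDiff_snd (𝕜 := ℝ) (E := ℝ) (F := E3)).contMDiff.contMDiffAt
  have hfs : ∀ s ∈ Set.Ioo (-ε) ε, ∀ z ∈ e.target, e.symm z ∈ W → Φ s (e.symm z) ∈ e.source →
      ContDiffAt ℝ ∞ f (s, z) := by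
    intro s hs z hz hzW hzs
    have h1 : ContMDiffAt (𝓡 3) (𝓡 3) ∞ e (Φ s (e.symm z)) :=
      (contMDiffOn_of_mem_maximalAtlas he).contMDiffAt (e.open_source.mem_nhds hzs)
    have h2 : ContMDiffAt 𝓘(ℝ, ℝ × E3) (𝓡 3) ∞ (fun q : ℝ × E3 => Φ q.1 (e.symm q.2)) (s, z) :=
      ContMDiffAt.comp (s, z) (hsm s hs _ hzW) (hinner s z hz)
    have h3 : ContMDiffAt 𝓘(ℝ, ℝ × E3) (𝓡 3) ∞ f (s, z) := ContMDiffAt.comp (s, z) h1 h2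
    exact contMDiffAt_iff_contDiffAt.1 h3
  have hfy : ∀ s ∈ Set.Ioo (-ε) ε, ∀ z ∈ e.target, e.symm z ∈ W → Φ s (e.symm z) ∈ e.source →
      ∀ w : E3, fderiv ℝ f (s, z) (0, w)
        = push e (Φ s (e.symm z)) (mfderiv (𝓡 3) (𝓡 3) (Φ s) (e.symm z) (pull e z w)) := by
    intro s hs z hz hzW hzs w
    have h1 : MDifferentiableAt (𝓡 3) (𝓡 3) (Φ s) (e.symm z) :=
      (ContMDiffAt.comp (e.symm z) (hsm s hs _ hzW)
        (contMDiffAt_const.prodMk contMDiffAt_id)).mdifferentiableAt (by simp)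
    have h2 : MDifferentiableAt (𝓡 3) (𝓡 3) e (Φ s (e.symm z)) :=
      ((mdifferentiable he).1 _ hzs).mdifferentiableAt (e.open_source.mem_nhds hzs)
    have h3 : MDifferentiableAt (𝓡 3) (𝓡 3) e.symm z :=
      ((mdifferentiable he).2 _ hz).mdifferentiableAt (e.open_target.mem_nhds hz)
    have h4 := (HasMFDerivAt.comp (f := Φ s ∘ e.symm) (g := e) z h2.hasMFDerivAt
      (HasMFDerivAt.comp (f := e.symm) (g := Φ s) z h1.hasMFDerivAt h3.hasMFDerivAt)).hasFDerivAt
    have h5 : HasFDerivAt (fun p : E3 => f (s, p)) _ z :=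
      HasFDerivAt.comp (g := f) z ((hfs s hs z hz hzW hzs).differentiableAt (by simp)).hasFDerivAt
        (hasFDerivAt_prodMk_right s z)
    have h6 := DFunLike.congr_fun (h5.unique h4) w
    refine Eq.trans ?_ h6
    simp
  have hfT : ∀ z ∈ e.target, e.symm z ∈ W → fderiv ℝ f (0, z) (1, 0) = C.reebChart e z := by
    intro z hz hzW
    have hz0 := hΦ0 _ hzW
    have hzs : Φ 0 (e.symm z) ∈ e.source := by rw [hz0]; exact e.map_target hz
    have h2 : MDifferentiableAt (𝓡 3) (𝓡 3) e (Φ 0 (e.symm z)) :=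
      ((mdifferentiable he).1 _ hzs).mdifferentiableAt (e.open_source.mem_nhds hzs)
    have h1 := (hint _ hzW 0 h0).hasMFDerivAt (isOpen_Ioo.mem_nhds h0)
    have h4 := (h2.hasMFDerivAt.comp (0 : ℝ) h1).hasFDerivAt
    have h5 : HasFDerivAt (fun s : ℝ => f (s, z)) _ 0 :=
      HasFDerivAt.comp (g := f) (0 : ℝ)
        ((hfs 0 h0 z hz hzW hzs).differentiableAt (by simp)).hasFDerivAt
        (hasFDerivAt_prodMk_left (0 : ℝ) z)
    have h6 := DFunLike.congr_fun (h5.unique h4) 1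
    have h7 : ∀ x, x = e.symm z → push e x (C.reeb x) = C.reebChart e z := by
      rintro _ rfl; rfl
    rw [← h7 _ hz0]
    refine Eq.trans ?_ (h6.trans ?_)
    · simp
    · exact congrArg (push e (Φ 0 (e.symm z))) (one_smul ℝ (C.reeb (Φ 0 (e.symm z))))
  have hx0 := hΦ0 _ hxW
  have hxs : Φ 0 (e.symm y) ∈ e.source := by rw [hx0]; exact e.map_target hy
  have hf0 : ContDiffAt ℝ 2 f (0, y) := (hfs 0 h0 y hy hxW hxs).of_le (by norm_cast)
  have hf0y : f (0, y) = y := by simp only [hf, hx0, e.right_inv hy]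
  have hnear : ∀ᶠ z in 𝓝 y, z ∈ e.target ∧ e.symm z ∈ W :=
    (e.open_target.eventually_mem hy).and
      ((e.continuousAt_symm hy).eventually (hW.eventually_mem hxW))
  have hflow := hasDerivAt_fderiv_flow hf0 (T := C.reebChart e)
    (by filter_upwards [hnear] with z hz using hfT z hz.1 hz.2)
  have hid : ∀ w : E3, fderiv ℝ f (0, y) (0, w) = w := by
    intro w
    have h5 : HasFDerivAt (fun p : E3 => f (0, p)) _ y :=
      (hf0.differentiableAt (by simp)).hasFDerivAt.comp y (hasFDerivAt_prodMk_right 0 y)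
    have h6 : (fun p : E3 => f (0, p)) =ᶠ[𝓝 y] fun p => p := by
      filter_upwards [hnear] with z hz
      simp only [hf, hΦ0 _ hz.2, e.right_inv hz.1]
    have h7 := h5.fderiv
    rw [h6.fderiv_eq] at h7
    have h8 := DFunLike.congr_fun h7 w
    simpa using h8.symm
  have hG : DifferentiableAt ℝ (C.gChart e) (f (0, y)) := by
    rw [hf0y]
    exact ((C.gChart_smooth he).contDiffAt (e.open_target.mem_nhds hy)).differentiableAt (by simp)
  have hs : HasDerivAt (fun s : ℝ => f (s, y)) (C.reebChart e y) 0 := by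
    have h := (hf0.differentiableAt (by simp)).hasFDerivAt.comp_hasDerivAt (0 : ℝ)
      ((hasDerivAt_id (0 : ℝ)).prodMk (hasDerivAt_const (0 : ℝ) y))
    rw [hfT y hy hxW] at h
    exact h
  have hGf : HasDerivAt (fun s : ℝ => C.gChart e (f (s, y)))
      (fderiv ℝ (C.gChart e) (f (0, y)) (C.reebChart e y)) 0 :=
    HasFDerivAt.comp_hasDerivAt (l := C.gChart e) (0 : ℝ) hG.hasFDerivAt hs
  have hD := (hGf.clm_apply (hflow u)).clm_apply (hflow v)
  -- The time must be small enough for Φ_s to remain inside the chart. There the transported vectors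
  -- are horizontal, so that g reduces to `gh`.
  have hconst : (fun s : ℝ => C.gChart e (f (s, y)) (fderiv ℝ f (s, y) (0, u))
      (fderiv ℝ f (s, y) (0, v))) =ᶠ[𝓝 0] fun _ => C.gChart e y u v := by
    have hcont : ContinuousAt (fun s : ℝ => Φ s (e.symm y)) 0 := by
      have h1 : ContMDiffAt 𝓘(ℝ, ℝ) (𝓡 3) ∞ (fun s : ℝ => Φ s (e.symm y)) 0 :=
        ContMDiffAt.comp (0 : ℝ) (hsm 0 h0 _ hxW) (contMDiffAt_id.prodMk contMDiffAt_const)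
      exact h1.continuousAt
    filter_upwards [isOpen_Ioo.mem_nhds h0,
      hcont.eventually (e.open_source.eventually_mem hxs)] with s hs hss
    have hu' := hiso s hs _ hxW (pull e y u) (pull e y v) hu hv
    have hv' := hiso s hs _ hxW (pull e y v) (pull e y u) hv hu
    rw [hfy s hs y hy hxW hss, hfy s hs y hy hxW hss,
      C.gChart_of_horizontal he (e.map_source hss), C.gChart_of_horizontal he hy hu hv]
    · exact (C.ghChart_push he hss _ _).trans hu'.2.1
    · exact (C.etaChart_push he hss _).trans hu'.1
    · exact (C.etaChart_push he hss _).trans hv'.1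
  have hD0 := hconst.hasDerivAt_iff.1 hD
  have := hD0.unique (hasDerivAt_const (0 : ℝ) _)
  simp only [hid, hf0y, add_apply] at this
  linarith

/-- Since g(T, ·) = η and L_T η = 0, the tensor L_T g vanishes as soon as one argument is T.
Splitting `u` and `v` leaves the horizontal case. -/
theorem lieDeriv_gChart (hC : C.IsSasakian) {y : E3} (hy : y ∈ e.target) (u v : E3) :
    fderiv ℝ (C.gChart e) y (C.reebChart e y) u v + C.gChart e y (fderiv ℝ (C.reebChart e) y u) v
      + C.gChart e y u (fderiv ℝ (C.reebChart e) y v) = 0 := by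
  have hG : DifferentiableAt ℝ (C.gChart e) y :=
    ((C.gChart_smooth he).contDiffAt (e.open_target.mem_nhds hy)).differentiableAt (by simp)
  have hT := C.differentiableAt_reebChart he hy
  have hTl : ∀ w, fderiv ℝ (C.gChart e) y (C.reebChart e y) (C.reebChart e y) w
      + C.gChart e y (fderiv ℝ (C.reebChart e) y (C.reebChart e y)) w
      + C.gChart e y (C.reebChart e y) (fderiv ℝ (C.reebChart e) y w) = 0 := by
    intro w
    have h : (fun z => C.gChart e z (C.reebChart e z) w) =ᶠ[𝓝 y] fun z => C.etaChart e z w := by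
      filter_upwards [e.open_target.mem_nhds hy] with z hz using C.gChart_reebChart_left he hz w
    have h1 := DFunLike.congr_fun (h.fderiv_eq (𝕜 := ℝ)) (C.reebChart e y)
    rw [C.fderiv_etaChart_apply he hy, ((hG.hasFDerivAt.clm_apply hT.hasFDerivAt).clm_apply
      (hasFDerivAt_const w y)).fderiv] at h1
    simp at h1
    rw [C.gChart_reebChart_left he hy (fderiv ℝ (C.reebChart e) y w)]
    linarith [C.lieDeriv_etaChart he hy w]
  have hdsymm : ∀ a b c, fderiv ℝ (C.gChart e) y a b c = fderiv ℝ (C.gChart e) y a c b := by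
    intro a b c
    have h : ∀ b c, fderiv ℝ (C.gChart e) y a b c = fderiv ℝ (fun z => C.gChart e z b c) y a := by
      intro b c
      rw [((hG.hasFDerivAt.clm_apply (hasFDerivAt_const b y)).clm_apply
        (hasFDerivAt_const c y)).fderiv]
      simp
    rw [h, h]
    have : (fun z => C.gChart e z b c) =ᶠ[𝓝 y] fun z => C.gChart e z c b := by
      filter_upwards [e.open_target.mem_nhds hy] with z hz using C.gChart_symm he hz b c
    rw [this.fderiv_eq]
  have hTr : ∀ w, fderiv ℝ (C.gChart e) y (C.reebChart e y) w (C.reebChart e y)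
      + C.gChart e y (fderiv ℝ (C.reebChart e) y w) (C.reebChart e y)
      + C.gChart e y w (fderiv ℝ (C.reebChart e) y (C.reebChart e y)) = 0 := by
    intro w
    rw [hdsymm, C.gChart_symm he hy _ (C.reebChart e y), C.gChart_symm he hy w]
    linarith [hTl w]
  have h0 := C.lieDeriv_gChart_of_horizontal he hC hy (C.etaChart_horizChart he hy u)
    (C.etaChart_horizChart he hy v)
  simp only [horizChart_apply, map_sub, map_smul, sub_apply, smul_apply, smul_eq_mul] at h0
  linear_combination h0 + C.etaChart e y u * hTl v + C.etaChart e y v * hTr u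
    - C.etaChart e y u * C.etaChart e y v * hTl (C.reebChart e y)

/-- The Sasakian structure in coordinates. -/
def sasakianChart (hC : C.IsSasakian) : SasakianChart E3 where
  Ω := e.target
  isOpen := e.open_target
  G := C.gChart e
  smooth := C.gChart_smooth he
  symm := fun _ hy => C.gChart_symm he hy
  pos := fun _ hy _ hu => C.gChart_pos he hy hu
  T := C.reebChart e
  J := C.JChart e
  T_smooth := C.reebChart_smooth he
  J_smooth := C.JChart_smooth he
  T_unit := fun _ hy => by rw [C.gChart_reebChart_left he hy, C.etaChart_reebChart he hy]
  J_T := fun _ hy => C.JChart_reebChart he hy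
  J_isom := fun _ hy => C.gChart_JChart_JChart he hy
  killing := fun _ hy => C.lieDeriv_gChart he hC hy
  d_eta := fun y hy u v => by
    have hG : DifferentiableAt ℝ (C.gChart e) y :=
      ((C.gChart_smooth he).contDiffAt (e.open_target.mem_nhds hy)).differentiableAt (by simp)
    have hT := C.differentiableAt_reebChart he hy
    have key : ∀ w a : E3, fderiv ℝ (C.gChart e) y a (C.reebChart e y) w
        + C.gChart e y (fderiv ℝ (C.reebChart e) y a) w = fderiv ℝ (C.etaChart e) y a w := by
      intro w a
      have h : (fun z => C.gChart e z (C.reebChart e z) w) =ᶠ[𝓝 y] fun z => C.etaChart e z w := by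
        filter_upwards [e.open_target.mem_nhds hy] with z hz using C.gChart_reebChart_left he hz w
      have h1 := DFunLike.congr_fun (h.fderiv_eq (𝕜 := ℝ)) a
      rw [C.fderiv_etaChart_apply he hy, ((hG.hasFDerivAt.clm_apply hT.hasFDerivAt).clm_apply
        (hasFDerivAt_const w y)).fderiv] at h1
      simp at h1
      linarith
    rw [key, key, C.extDeriv_etaChart he hy]

end ContactSubRiemannian

/-! ### The coordinate formulas for connection and curvature agree with the invariant ones -/

namespace ContactSubRiemannian

open ChartTransport MetricChart SasakianChart

variable {M : Type*} [TopologicalSpace M] [ChartedSpace E3 M] [IsManifold (𝓡 3) ∞ M]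
  (C : ContactSubRiemannian M) {e : OpenPartialHomeomorph M E3}
  (he : e ∈ IsManifold.maximalAtlas (𝓡 3) ∞ M) (hC : C.IsSasakian)
include he hC

theorem christoffelFirst_eq {y : E3} (hy : y ∈ e.target) (u v w : E3) :
    C.christoffelFirst e y u v w = (C.sasakianChart he hC).koszul y u v w := by
  have h : ∀ a b c : E3, fderiv ℝ (fun z => C.gCoord e z b c) y a
      = fderiv ℝ (C.sasakianChart he hC).G y a b c := by
    intro a b c
    rw [← fderiv_G_apply (A := (C.sasakianChart he hC).toMetricChart) hy]
    have : (fun z => C.gCoord e z b c) =ᶠ[𝓝 y] fun z => (C.sasakianChart he hC).G z b c := by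
      filter_upwards [e.open_target.mem_nhds hy] with z hz using C.gCoord_eq he hz b c
    rw [this.fderiv_eq]
  rw [koszul_apply, christoffelFirst, h, h, h]

/-- Both sides represent the same Koszul form with respect to `G`: one through the inverse Gram
matrix of the standard basis, the other through the inverse of `G` as a linear map. -/
theorem christoffel_eq {y : E3} (hy : y ∈ e.target) (u v : E3) :
    C.christoffel e y u v = (C.sasakianChart he hC).Γ y u v := by
  set A := C.sasakianChart he hC with hA
  set Q : Matrix (Fin 3) (Fin 3) ℝ :=
    Matrix.of fun i j : Fin 3 => C.gCoord e y (basisVec i) (basisVec j) with hQ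
  have hQa : ∀ i j, Q i j = A.G y (basisVec i) (basisVec j) := fun i j => C.gCoord_eq he hy _ _
  have hexp : ∀ w : E3, w = ∑ i, w i • basisVec i := by
    intro w
    ext j
    simp [basisVec, Pi.single_apply]
  -- A vector in the kernel of the Gram matrix would have zero length.
  have hunit : IsUnit Q := by
    rw [← Matrix.mulVec_injective_iff_isUnit, ← Matrix.coe_mulVecLin, ← LinearMap.ker_eq_bot,
      LinearMap.ker_eq_bot']
    intro c hc
    have hc' : ∀ i, ∑ j, A.G y (basisVec i) (basisVec j) * c j = 0 := fun i => by
      have := congrFun hc i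
      simpa [Matrix.mulVec, dotProduct, hQa] using this
    have h0 : (∑ j, c j • basisVec j : E3) = 0 := by
      by_contra hne
      refine (A.pos y hy _ hne).ne' ?_
      rw [map_sum]
      refine Finset.sum_eq_zero fun i _ => ?_
      rw [map_smul, A.symm y hy, map_sum]
      have := hc' i
      simp only [map_smul, smul_eq_mul, mul_comm _ (c _)] at this ⊢
      rw [this, mul_zero]
    ext j
    have := congrFun (congrArg WithLp.ofLp h0) j
    simpa [basisVec, Pi.single_apply] using this
  have hinv : Q * Q⁻¹ = 1 := Matrix.mul_nonsing_inv _ ((Matrix.isUnit_iff_isUnit_det _).1 hunit)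
  have hm : ∀ m, A.G y (C.christoffel e y u v) (basisVec m) = A.koszul y u v (basisVec m) := by
    intro m
    simp only [christoffel, map_sum, sum_apply, map_smul, smul_apply, smul_eq_mul,
      C.christoffelFirst_eq he hC hy]
    have h1 : ∀ k, A.G y (basisVec k) (basisVec m) = Q m k := fun k => by
      rw [hQa, A.symm y hy]
    have h2 : ∀ l, ∑ k, Q m k * Q⁻¹ k l = if m = l then 1 else 0 := fun l => by
      rw [← Matrix.mul_apply, hinv, Matrix.one_apply]
    calc ∑ k, (∑ l, Q⁻¹ k l * A.koszul y u v (basisVec l)) * A.G y (basisVec k) (basisVec m)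
        = ∑ l, (∑ k, Q m k * Q⁻¹ k l) * A.koszul y u v (basisVec l) := by
          simp only [h1, Finset.sum_mul]
          rw [Finset.sum_comm]
          refine Finset.sum_congr rfl fun l _ => Finset.sum_congr rfl fun k _ => ?_
          ring
      _ = A.koszul y u v (basisVec m) := by simp [h2]
  refine ext_of_inner (A := A.toMetricChart) hy fun w => ?_
  rw [G_Γ hy, hexp w]
  simp only [map_sum, map_smul, hm]

theorem curvature_eq {y : E3} (hy : y ∈ e.target) (u v w : E3) :
    C.curvature e y u v w = (C.sasakianChart he hC).Rm y u v w := by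
  set A := C.sasakianChart he hC with hA
  have h : ∀ a b c : E3, fderiv ℝ (fun z => C.christoffel e z b c) y a
      = fderiv ℝ A.Γ y a b c := by
    intro a b c
    have : (fun z => C.christoffel e z b c) =ᶠ[𝓝 y] fun z => A.Γ z b c := by
      filter_upwards [e.open_target.mem_nhds hy] with z hz using C.christoffel_eq he hC hz b c
    rw [this.fderiv_eq, (((differentiableAt_Γ (A := A.toMetricChart) hy).hasFDerivAt.clm_apply
      (hasFDerivAt_const b y)).clm_apply (hasFDerivAt_const c y)).fderiv]
    simp
  simp only [curvature, Rm, h, C.christoffel_eq he hC hy]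
  rfl

omit hC in
theorem push_J {x : M} (hx : x ∈ e.source) (u : TangentSpace (𝓡 3) x) :
    push e x (C.J x u) = C.JChart e (e x) (push e x u) := by
  have key : ∀ x', x' = x → ∀ u' : E3, push e x' (C.J x' u') = push e x (C.J x u') := by
    rintro _ rfl _; rfl
  exact (key _ (e.left_inv hx) u).symm.trans
    (congrArg (fun t : E3 => push e _ (C.J _ t)) (pull_push he hx u).symm)

/-- The arbitrarily chosen horizontal vector is aν + bZ. Numerator and denominator of the sectional
curvature both scale by (a² + b²)², so the frame may be used instead. -/
theorem websterCurvature_eq {x : M} (hx : x ∈ e.source) {ν Z : E3}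
    (hf : IsFrame (C.sasakianChart he hC) (e x) ν Z) :
    C.websterCurvature e x = (1 / 4 : ℝ) *
      ((C.sasakianChart he hC).G (e x) ((C.sasakianChart he hC).Rm (e x) ν Z Z) ν + 3) := by
  have hy := e.map_source hx
  simp only [websterCurvature]
  set A := C.sasakianChart he hC with hA
  have hV : Module.finrank ℝ E3 = 3 := by simp
  have hZν := A.symm _ hy Z ν
  -- `Classical.epsilon` has the required property only if some vector has it; ν pulled back to M is
  -- one.
  have hex : ∃ u : TangentSpace (𝓡 3) x, C.eta x u = 0 ∧ u ≠ 0 := by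
    have hpp : push e x (pull e (e x) ν) = ν := by
      have := push_pull he hy ν
      rwa [e.left_inv hx] at this
    refine ⟨pull e (e x) ν, ?_, fun h0 => ?_⟩
    · refine (C.etaChart_push he hx _).symm.trans ?_
      rw [hpp, ← C.gChart_reebChart_left he hy, C.gChart_symm he hy]
      exact hf.νT
    · have h1 : ν = 0 := by
        rw [← hpp]
        exact (congrArg (push e x) h0).trans (map_zero _)
      have := hf.νν
      rw [h1] at this
      simp at this
  obtain ⟨hu0, hune⟩ := Classical.epsilon_spec hex
  set u := Classical.epsilon fun u : TangentSpace (𝓡 3) x => C.eta x u = 0 ∧ u ≠ 0 with hudef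
  set a := A.G (e x) (push e x u) ν with ha
  set b := A.G (e x) (push e x u) Z with hb
  have hu : push e x u = a • ν + b • Z := by
    refine hf.ext hy hV ?_ ?_ ?_
    · simp [hf.νν, hZν, hf.νZ, ha]
    · simp [hf.ZZ, hf.νZ, hb]
    · have h1 : A.G (e x) (push e x u) (A.T (e x)) = 0 := by
        rw [A.symm _ hy]
        exact (C.gChart_reebChart_left he hy _).trans ((C.etaChart_push he hx u).trans hu0)
      simp [h1, hf.νT, hf.ZT]
  have hJu : push e x (C.J x u) = a • Z - b • ν := by
    rw [C.push_J he hx, hu]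
    have h1 := hf.Jν
    have h2 := hf.JZ
    change C.JChart e (e x) ν = Z at h1
    change C.JChart e (e x) Z = -ν at h2
    simp [h1, h2, sub_eq_add_neg]
  have hab : a ^ 2 + b ^ 2 ≠ 0 := by
    intro h0
    have ha0 : a = 0 := by nlinarith [sq_nonneg a, sq_nonneg b]
    have hb0 : b = 0 := by nlinarith [sq_nonneg a, sq_nonneg b]
    rw [ha0, hb0] at hu
    apply hune
    have h1 := pull_push he hx u
    rw [hu] at h1
    have h2 : pull e (e x) ((0 : ℝ) • ν + (0 : ℝ) • Z) = 0 := by simp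
    exact h1.symm.trans h2
  have hguu : C.g x u u = a ^ 2 + b ^ 2 := by
    rw [C.g_eq he hx, hu]
    change A.G (e x) _ _ = _
    simp [hf.νν, hf.ZZ, hf.νZ, hZν]
    ring
  have hgJJ : C.g x (C.J x u) (C.J x u) = a ^ 2 + b ^ 2 := by
    rw [C.g_eq he hx, hJu]
    change A.G (e x) _ _ = _
    simp [hf.νν, hf.ZZ, hf.νZ, hZν]
    ring
  have hguJ : C.g x u (C.J x u) = 0 := by
    rw [C.g_eq he hx, hJu, hu]
    change A.G (e x) _ _ = _
    simp [hf.νν, hf.ZZ, hf.νZ, hZν]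
    ring
  have hself : ∀ v w : E3, A.Rm (e x) v v w = 0 := fun v w => by simp [Rm]
  have hnum : C.gCoord e (e x) (C.curvature e (e x) (push e x u) (push e x (C.J x u))
      (push e x (C.J x u))) (push e x u)
      = (a ^ 2 + b ^ 2) ^ 2 * A.G (e x) (A.Rm (e x) ν Z Z) ν := by
    rw [C.gCoord_eq he hy, C.curvature_eq he hC hy, hJu, hu]
    change A.G (e x) _ _ = _
    have h1 : ∀ w, A.Rm (e x) (a • ν + b • Z) (a • Z - b • ν) w
        = (a ^ 2 + b ^ 2) • A.Rm (e x) ν Z w := by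
      intro w
      rw [sub_eq_add_neg, ← neg_smul]
      simp only [Rm_add_left, Rm_add_right, Rm_smul_left, Rm_smul_right, hself,
        Rm_skew (e x) Z ν]
      module
    have h2 := inner_Rm_skew (A := A.toMetricChart) hy ν Z Z ν
    have h3 := inner_Rm_self (A := A.toMetricChart) hy ν Z
    rw [h1, sub_eq_add_neg, ← neg_smul]
    simp only [Rm_apply_add, Rm_apply_smul, map_add, map_smul, add_apply, smul_apply, smul_eq_mul,
      h3]
    linear_combination (a ^ 2 + b ^ 2) * (b ^ 2) * (-h2)
  have hsec : C.sectionalCurvature e x u (C.J x u) = A.G (e x) (A.Rm (e x) ν Z Z) ν := by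
    have h0 : C.sectionalCurvature e x u (C.J x u)
        = C.gCoord e (e x) (C.curvature e (e x) (push e x u) (push e x (C.J x u))
          (push e x (C.J x u))) (push e x u)
          / (C.g x u u * C.g x (C.J x u) (C.J x u) - C.g x u (C.J x u) ^ 2) := rfl
    rw [h0, hnum, hguu, hgJJ, hguJ]
    field_simp
    ring
  rw [hsec]

end ContactSubRiemannian

/-! ### Linear algebra for tangent planes and smooth linear systems -/

/-- Solutions of smooth injective linear systems are smooth. -/
theorem contDiffAt_of_injective_clm {X V Y : Type*} [NormedAddCommGroup X] [NormedSpace ℝ X]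
    [NormedAddCommGroup V] [NormedSpace ℝ V] [FiniteDimensional ℝ V]
    [NormedAddCommGroup Y] [NormedSpace ℝ Y] [FiniteDimensional ℝ Y] {n : ℕ∞ω}
    {B : X → V →L[ℝ] Y} {r : X → Y} {z : X → V} {q : X} (hB : ContDiffAt ℝ n B q)
    (hinj : Function.Injective (B q)) (hr : ContDiffAt ℝ n r q)
    (hz : ∀ᶠ p in 𝓝 q, B p (z p) = r p) : ContDiffAt ℝ n z q := by
  have : CompleteSpace V := FiniteDimensional.complete ℝ V
  -- A left inverse at the single point `q` suffices: `L ∘ B p` is the identity at `p = q`, hence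
  -- invertible nearby, and z = (L ∘ B)⁻¹ (L r).
  obtain ⟨L, hL⟩ := LinearMap.exists_leftInverse_of_injective (B q : V →ₗ[ℝ] Y)
    (LinearMap.ker_eq_bot.2 hinj)
  set L' : Y →L[ℝ] V := LinearMap.toContinuousLinearMap L
  have hD : ContDiffAt ℝ n (fun p => L' ∘L B p) q := contDiffAt_const.clm_comp hB
  have hDq : L' ∘L B q = (ContinuousLinearEquiv.refl ℝ V : V →L[ℝ] V) := by
    ext v
    exact DFunLike.congr_fun hL v
  have hinv : ContDiffAt ℝ n (fun p => (L' ∘L B p).inverse) q := by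
    have h1 := contDiffAt_map_inverse (𝕜 := ℝ) (n := n) (ContinuousLinearEquiv.refl ℝ V)
    rw [← hDq] at h1
    exact h1.comp q hD
  have hev : ∀ᶠ p in 𝓝 q, L' ∘L B p ∈ Set.range ((↑) : (V ≃L[ℝ] V) → V →L[ℝ] V) := by
    have h1 := ContinuousLinearEquiv.nhds (𝕜 := ℝ) (ContinuousLinearEquiv.refl ℝ V)
    rw [← hDq] at h1
    exact hD.continuousAt h1
  refine (hinv.clm_apply (contDiffAt_const.clm_apply hr : ContDiffAt ℝ n (fun p => L' (r p)) q)
    ).congr_of_eventuallyEq ?_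
  filter_upwards [hev, hz] with p hp hzp
  obtain ⟨f, hf⟩ := hp
  rw [← hzp, ← hf, ContinuousLinearMap.inverse_equiv]
  have : f (z p) = L' (B p (z p)) := DFunLike.congr_fun hf (z p)
  rw [← this]
  simp

/-- A plane on which a nonzero linear form on `E3` vanishes is the kernel of this form. -/
theorem exists_eq_of_linearForm_eq_zero {B : E2 →L[ℝ] E3} (hB : Function.Injective B)
    {η : E3 →L[ℝ] ℝ} {w : E3} (hw : η w ≠ 0) (hBη : ∀ a, η (B a) = 0) {v : E3} (hv : η v = 0) :
    ∃ a, B a = v := by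
  have h1 : Module.finrank ℝ (LinearMap.range (B : E2 →ₗ[ℝ] E3)) = 2 := by
    rw [LinearMap.finrank_range_of_inj hB]
    simp
  have hne : (η : E3 →ₗ[ℝ] ℝ) ≠ 0 := fun h0 => hw (DFunLike.congr_fun h0 w)
  have h2 : Module.finrank ℝ (LinearMap.ker (η : E3 →ₗ[ℝ] ℝ)) = 2 := by
    have h3 := Module.Dual.finrank_ker_add_one_of_ne_zero (f := (η : E3 →ₗ[ℝ] ℝ)) hne
    have h4 : Module.finrank ℝ E3 = 3 := by simp
    omega
  have hle : LinearMap.range (B : E2 →ₗ[ℝ] E3) ≤ LinearMap.ker (η : E3 →ₗ[ℝ] ℝ) := by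
    rintro _ ⟨a, rfl⟩
    exact hBη a
  have heq := Submodule.eq_of_le_of_finrank_eq hle (by rw [h1, h2])
  have : v ∈ LinearMap.range (B : E2 →ₗ[ℝ] E3) := by
    rw [heq]
    exact hv
  exact this

theorem MetricChart.mem_range_of_orthogonal {A : MetricChart E3} {y : E3} (hy : y ∈ A.Ω)
    {B : E2 →L[ℝ] E3} (hB : Function.Injective B) {N : E3} (hN : N ≠ 0)
    (hBN : ∀ a, A.G y N (B a) = 0) {v : E3} (hv : A.G y N v = 0) : ∃ a, B a = v :=
  exists_eq_of_linearForm_eq_zero hB (A.pos y hy N hN).ne' hBN hv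

/-! ### Charts of the surface -/

namespace SurfaceChart

variable {Sig : Type*} [TopologicalSpace Sig] [ChartedSpace E2 Sig] [IsManifold (𝓡 2) 2 Sig]
  {c : OpenPartialHomeomorph Sig E2}

/-- The derivative of a chart of the surface. -/
def dc (c : OpenPartialHomeomorph Sig E2) (p : Sig) : E2 →L[ℝ] E2 := mfderiv (𝓡 2) (𝓡 2) c p

variable (hc : c ∈ IsManifold.maximalAtlas (𝓡 2) 2 Sig)
include hc

theorem mdifferentiable : c.MDifferentiable (𝓡 2) (𝓡 2) :=
  ⟨(contMDiffOn_of_mem_maximalAtlas hc).mdifferentiableOn (by simp),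
    (contMDiffOn_symm_of_mem_maximalAtlas hc).mdifferentiableOn (by simp)⟩

theorem dc_injective {p : Sig} (hp : p ∈ c.source) : Function.Injective (dc c p) := by
  intro a b hab
  have h := fun u : E2 => DFunLike.congr_fun ((mdifferentiable hc).symm_comp_deriv hp) u
  have ha : (mfderiv (𝓡 2) (𝓡 2) c.symm (c p) : E2 →L[ℝ] E2) (dc c p a) = a := h a
  have hb : (mfderiv (𝓡 2) (𝓡 2) c.symm (c p) : E2 →L[ℝ] E2) (dc c p b) = b := h b
  rw [← ha, ← hb, hab]

theorem dc_surjective {p : Sig} (hp : p ∈ c.source) : Function.Surjective (dc c p) :=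
  (LinearMap.injective_iff_surjective (f := (dc c p : E2 →ₗ[ℝ] E2))).1 (dc_injective hc hp)

theorem mfderiv_eq {F : Type*} [NormedAddCommGroup F] [NormedSpace ℝ F] {p : Sig}
    (hp : p ∈ c.source) {f : Sig → F} {g : E2 → F} (hfg : f =ᶠ[𝓝 p] g ∘ c)
    (hg : DifferentiableAt ℝ g (c p)) (u : TangentSpace (𝓡 2) p) :
    mfderiv (𝓡 2) 𝓘(ℝ, F) f p u = fderiv ℝ g (c p) (dc c p u) := by
  have hc' : MDifferentiableAt (𝓡 2) (𝓡 2) c p :=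
    ((mdifferentiable hc).1 p hp).mdifferentiableAt (c.open_source.mem_nhds hp)
  rw [hfg.mfderiv_eq, mfderiv_comp p hg.mdifferentiableAt hc']
  rw [mfderiv_eq_fderiv]
  rfl

end SurfaceChart

/-! ### The immersion and its normal in charts -/

namespace OrientedSurface

open ChartTransport SurfaceChart MetricChart SasakianChart

variable {M : Type*} [TopologicalSpace M] [ChartedSpace E3 M] [IsManifold (𝓡 3) ∞ M]
  {C : ContactSubRiemannian M} {Sig : Type*} [TopologicalSpace Sig] [ChartedSpace E2 Sig]
  [IsManifold (𝓡 2) 2 Sig] (F : OrientedSurface C Sig)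
  (e : OpenPartialHomeomorph M E3) (c : OpenPartialHomeomorph Sig E2)

/-- The domain of the parametrization of the surface in charts. -/
def chartDomain : Set E2 := c.target ∩ (F.φ ∘ c.symm) ⁻¹' e.source

/-- The parametrization of the surface in charts. -/
def chartMap (q : E2) : E3 := e (F.φ (c.symm q))

/-- A vector field along the surface in charts. -/
def chartField (X : ∀ p : Sig, TangentSpace (𝓡 3) (F.φ p)) (q : E2) : E3 :=
  push e (F.φ (c.symm q)) (X (c.symm q))

variable {F e c} (he : e ∈ IsManifold.maximalAtlas (𝓡 3) ∞ M)
  (hc : c ∈ IsManifold.maximalAtlas (𝓡 2) 2 Sig)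
  (hφ : ContMDiffOn (𝓡 2) (𝓡 3) 3 (F.φ ∘ c.symm) c.target)

include hφ

theorem isOpen_chartDomain : IsOpen (F.chartDomain e c) :=
  hφ.continuousOn.isOpen_inter_preimage c.open_target e.open_source

include he

theorem contDiffOn_chartMap : ContDiffOn ℝ 3 (F.chartMap e c) (F.chartDomain e c) := by
  have h1 : ContMDiffOn (𝓡 3) (𝓡 3) 3 e e.source :=
    (contMDiffOn_of_mem_maximalAtlas he).of_le (by norm_cast)
  exact contMDiffOn_iff_contDiffOn.1
    (h1.comp (hφ.mono Set.inter_subset_left) fun q hq => hq.2)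

theorem contDiffAt_chartMap {q : E2} (hq : q ∈ F.chartDomain e c) :
    ContDiffAt ℝ 3 (F.chartMap e c) q :=
  (contDiffOn_chartMap he hφ).contDiffAt ((isOpen_chartDomain hφ).mem_nhds hq)

theorem differentiableAt_chartMap {q : E2} (hq : q ∈ F.chartDomain e c) :
    DifferentiableAt ℝ (F.chartMap e c) q :=
  (contDiffAt_chartMap he hφ hq).differentiableAt (by norm_num)

include hc

theorem fderiv_chartMap {q : E2} (hq : q ∈ F.chartDomain e c)
    (v : TangentSpace (𝓡 2) (c.symm q)) :
    fderiv ℝ (F.chartMap e c) q (dc c (c.symm q) v)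
      = push e (F.φ (c.symm q)) (mfderiv (𝓡 2) (𝓡 3) F.φ (c.symm q) v) := by
  have hp := c.map_target hq.1
  have hr := c.right_inv hq.1
  have h1 : MDifferentiableAt (𝓡 3) (𝓡 3) e (F.φ (c.symm q)) :=
    ((ChartTransport.mdifferentiable he).1 _ hq.2).mdifferentiableAt (e.open_source.mem_nhds hq.2)
  have h2 : MDifferentiableAt (𝓡 2) (𝓡 3) F.φ (c.symm q) :=
    F.contMDiff.mdifferentiableAt (by norm_num)
  have h3 := mfderiv_eq hc hp (f := e ∘ F.φ) (g := F.chartMap e c) ?_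
    (by rw [hr]; exact differentiableAt_chartMap he hφ hq) v
  · rw [hr] at h3
    rw [← h3]
    exact DFunLike.congr_fun (mfderiv_comp (c.symm q) h1 h2) v
  · filter_upwards [c.open_source.mem_nhds hp] with p hp
    simp [chartMap, c.left_inv hp]

theorem fderiv_chartMap_injective {q : E2} (hq : q ∈ F.chartDomain e c) :
    Function.Injective (fderiv ℝ (F.chartMap e c) q) := by
  have hp := c.map_target hq.1
  rw [injective_iff_map_eq_zero]
  intro a ha
  obtain ⟨v, rfl⟩ := dc_surjective hc hp a
  have h1 := fderiv_chartMap he hc hφ hq v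
  rw [ha] at h1
  have h2 : mfderiv (𝓡 2) (𝓡 3) F.φ (c.symm q) v = 0 := by
    have h3 := pull_push he hq.2 (mfderiv (𝓡 2) (𝓡 3) F.φ (c.symm q) v)
    exact h3.symm.trans ((congrArg (pull e _) h1.symm).trans (map_zero _))
  have h3 : v = 0 := F.immersion (c.symm q) (h2.trans (map_zero _).symm)
  exact (congrArg (dc c (c.symm q)) h3).trans (map_zero _)

theorem chartField_N_normal {q : E2} (hq : q ∈ F.chartDomain e c) (a : E2) :
    C.gChart e (F.chartMap e c q) (F.chartField e c F.N q) (fderiv ℝ (F.chartMap e c) q a) = 0 := by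
  obtain ⟨v, rfl⟩ := dc_surjective hc (c.map_target hq.1) a
  rw [fderiv_chartMap he hc hφ hq v]
  exact (C.g_eq he hq.2 _ _).symm.trans (F.N_normal (c.symm q) v)

omit hc hφ in
theorem chartField_N_unit {q : E2} (hq : q ∈ F.chartDomain e c) :
    C.gChart e (F.chartMap e c q) (F.chartField e c F.N q) (F.chartField e c F.N q) = 1 :=
  (C.g_eq he hq.2 _ _).symm.trans (F.N_unit (c.symm q))

omit hφ hc in
theorem continuousOn_chartField_N :
    ContinuousOn (F.chartField e c F.N) (F.chartDomain e c) := by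
  have h1 : ContMDiffOn (𝓡 2) (𝓡 3).tangent 0
      (fun q => (⟨F.φ (c.symm q), F.N (c.symm q)⟩ : TangentBundle (𝓡 3) M))
      (F.chartDomain e c) := by
    rw [contMDiffOn_zero_iff]
    exact F.N_continuous.comp_continuousOn (c.continuousOn_symm.mono Set.inter_subset_left)
  exact contDiffOn_zero.1 (contDiffOn_push he (n := 0) (by norm_cast) (fun q hq => hq.2) h1)

end OrientedSurface

/-! ### Regularity of the normal and description of the singular set -/

namespace OrientedSurface

open ChartTransport SurfaceChart MetricChart SasakianChart

/-- A continuous unit normal of a parametrized `C³` surface is of class `C²`. -/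
theorem contDiffAt_unit_normal {A : MetricChart E3} {U : Set E2} (hU : IsOpen U) {x N : E2 → E3}
    (hx : ContDiffOn ℝ 3 x U) (hxU : ∀ q ∈ U, x q ∈ A.Ω)
    (hinj : ∀ q ∈ U, Function.Injective (fderiv ℝ x q))
    (hN : ContinuousOn N U) (hunit : ∀ q ∈ U, A.G (x q) (N q) (N q) = 1)
    (hnormal : ∀ q ∈ U, ∀ a, A.G (x q) (N q) (fderiv ℝ x q a) = 0) {q : E2} (hq : q ∈ U) :
    ContDiffAt ℝ 2 N q := by
  have hx3 : ContDiffAt ℝ 3 x q := hx.contDiffAt (hU.mem_nhds hq)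
  have hdx : ContDiffAt ℝ 2 (fderiv ℝ x) q := hx3.fderiv_right (by norm_num)
  have hG : ContDiffAt ℝ 2 (fun p => A.G (x p)) q :=
    ((A.smooth.contDiffAt (A.isOpen.mem_nhds (hxU q hq))).of_le (by norm_cast)).comp q
      (hx3.of_le (by norm_num))
  set w := N q with hw
  have hne : w ≠ 0 := fun h0 => by
    have := hunit q hq
    rw [← hw, h0] at this
    simp at this
  set P₁ : E2 → E3 →L[ℝ] (E2 →L[ℝ] ℝ) := fun p =>
    ((ContinuousLinearMap.compL ℝ E2 E3 ℝ).flip (fderiv ℝ x p)) ∘L A.G (x p) with hP₁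
  set P₂ : E2 → E3 →L[ℝ] ℝ := fun p =>
    (ContinuousLinearMap.apply ℝ ℝ w) ∘L A.G (x p) with hP₂
  -- The system "v is normal to the surface and ⟨v, w⟩ = 1", with `w` the fixed vector N(q), has C²
  -- coefficients and is injective at `q`. Its solution is N rescaled.
  set B : E2 → E3 →L[ℝ] ((E2 →L[ℝ] ℝ) × ℝ) := fun p =>
    (ContinuousLinearMap.inl ℝ (E2 →L[ℝ] ℝ) ℝ) ∘L P₁ p
      + (ContinuousLinearMap.inr ℝ (E2 →L[ℝ] ℝ) ℝ) ∘L P₂ p with hB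
  have hB1 : ∀ p v, (B p v).1 = (A.G (x p) v) ∘L fderiv ℝ x p := fun p v => by simp [hB, hP₁, hP₂]
  have hB2 : ∀ p v, (B p v).2 = A.G (x p) v w := fun p v => by simp [hB, hP₁, hP₂]
  have hBs : ContDiffAt ℝ 2 B q :=
    (contDiffAt_const.clm_comp ((contDiffAt_const.clm_apply hdx).clm_comp hG)).add
      (contDiffAt_const.clm_comp (contDiffAt_const.clm_comp hG))
  have hBinj : Function.Injective (B q) := by
    rw [injective_iff_map_eq_zero]
    intro v hv
    have h1 := (hB1 q v).symm.trans (congrArg Prod.fst hv)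
    have h2 := (hB2 q v).symm.trans (congrArg Prod.snd hv)
    obtain ⟨a, rfl⟩ := mem_range_of_orthogonal (hxU q hq) (hinj q hq) hne (hnormal q hq)
      ((A.symm _ (hxU q hq) _ _).trans h2)
    by_contra h0
    exact (A.pos _ (hxU q hq) _ h0).ne' (DFunLike.congr_fun h1 a)
  -- Continuity of N enters here: it keeps `t` positive near `q`, which fixes the sign when N is
  -- recovered by normalizing `n`.
  set t : E2 → ℝ := fun p => A.G (x p) (N p) w with ht
  have hcont : ContinuousAt t q :=
    (hG.continuousAt.clm_apply (hN.continuousAt (hU.mem_nhds hq))).clm_apply continuousAt_const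
  have htq : t q = 1 := hunit q hq
  have htpos : ∀ᶠ p in 𝓝 q, 0 < t p :=
    hcont.eventually (lt_mem_nhds (by rw [htq]; norm_num))
  set n : E2 → E3 := fun p => (t p)⁻¹ • N p with hn
  have hns : ContDiffAt ℝ 2 n q := by
    refine contDiffAt_of_injective_clm hBs hBinj
      (contDiffAt_const (c := ((0, 1) : (E2 →L[ℝ] ℝ) × ℝ))) ?_
    filter_upwards [htpos, hU.mem_nhds hq] with p hp hpU
    refine Prod.ext ?_ ?_
    · rw [hB1]
      ext a
      simp [hn, hnormal p hpU]
    · rw [hB2]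
      simp only [hn, map_smul, smul_apply, smul_eq_mul]
      exact inv_mul_cancel₀ hp.ne'
  have hnn : ContDiffAt ℝ 2 (fun p => A.G (x p) (n p) (n p)) q := (hG.clm_apply hns).clm_apply hns
  have hnq : A.G (x q) (n q) (n q) = 1 := by
    simp only [hn, htq]
    simp [hunit q hq]
  have hsq : ContDiffAt ℝ 2 (fun p => (√(A.G (x p) (n p) (n p)))⁻¹ • n p) q := by
    refine ((hnn.sqrt (by rw [hnq]; norm_num)).inv ?_).smul hns
    rw [hnq]
    norm_num
  refine hsq.congr_of_eventuallyEq ?_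
  filter_upwards [htpos, hU.mem_nhds hq] with p hp hpU
  have h1 : A.G (x p) (n p) (n p) = (t p)⁻¹ ^ 2 := by
    simp only [hn, map_smul, smul_apply, smul_eq_mul, hunit p hpU]
    ring
  rw [h1, Real.sqrt_sq (inv_pos.2 hp).le, inv_inv]
  simp only [hn, smul_smul]
  rw [mul_inv_cancel₀ hp.ne', one_smul]

variable {M : Type*} [TopologicalSpace M] [ChartedSpace E3 M] [IsManifold (𝓡 3) ∞ M]
  {C : ContactSubRiemannian M} {Sig : Type*} [TopologicalSpace Sig] [ChartedSpace E2 Sig]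
  [IsManifold (𝓡 2) 2 Sig] (F : OrientedSurface C Sig)
  (e : OpenPartialHomeomorph M E3) (c : OpenPartialHomeomorph Sig E2)

/-- `⟨N, T⟩` in charts. -/
def chartPsi (q : E2) : ℝ := F.normalReeb (c.symm q)

/-- `|N_h|` in charts. -/
def chartNorm (q : E2) : ℝ := F.normNh (c.symm q)

/-- The set of regular points in charts. -/
def regularDomain : Set E2 := {q ∈ F.chartDomain e c | F.chartPsi c q ^ 2 < 1}

variable {F e c} (he : e ∈ IsManifold.maximalAtlas (𝓡 3) ∞ M)
  (hc : c ∈ IsManifold.maximalAtlas (𝓡 2) 2 Sig)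
  (hφ : ContMDiffOn (𝓡 2) (𝓡 3) 3 (F.φ ∘ c.symm) c.target)

section pointwise

variable (p : Sig)

omit [IsManifold (𝓡 2) 2 Sig]

theorem eta_reeb_smul (a : ℝ) : C.eta (F.φ p) (a • C.reeb (F.φ p)) = a := by
  rw [map_smul, C.eta_reeb, smul_eq_mul, mul_one]

theorem horiz_reeb : C.horiz (F.φ p) (C.reeb (F.φ p)) = 0 := by
  rw [ContactSubRiemannian.horiz, C.eta_reeb, one_smul, sub_self]

theorem normalReeb_eq : F.normalReeb p = C.eta (F.φ p) (F.N p) := by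
  rw [normalReeb, ContactSubRiemannian.g, horiz_reeb, C.eta_reeb, map_zero]
  simp

theorem Nh_eq : F.Nh p = C.horiz (F.φ p) (F.N p) := by
  rw [Nh, normalReeb_eq]
  rfl

theorem eta_horiz (x : M) (u : TangentSpace (𝓡 3) x) : C.eta x (C.horiz x u) = 0 := by
  rw [ContactSubRiemannian.horiz, map_sub, map_smul, C.eta_reeb, smul_eq_mul, mul_one, sub_self]

theorem g_of_horizontal {x : M} {u : TangentSpace (𝓡 3) x} (hu : C.eta x u = 0)
    (v : TangentSpace (𝓡 3) x) : C.g x u v = C.gh x u (C.horiz x v) := by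
  rw [ContactSubRiemannian.g, ContactSubRiemannian.horiz, hu]
  simp

theorem g_Nh_N : C.g (F.φ p) (F.Nh p) (F.N p) = C.g (F.φ p) (F.Nh p) (F.Nh p) := by
  have h := eta_horiz (C := C) (F.φ p) (F.N p)
  have h2 : C.horiz (F.φ p) (C.horiz (F.φ p) (F.N p)) = C.horiz (F.φ p) (F.N p) := by
    conv_lhs => rw [ContactSubRiemannian.horiz, h, zero_smul, sub_zero]
  rw [Nh_eq, g_of_horizontal h, g_of_horizontal h, h2]

theorem g_Nh_Nh : C.g (F.φ p) (F.Nh p) (F.Nh p) = 1 - F.normalReeb p ^ 2 := by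
  have h := eta_horiz (C := C) (F.φ p) (F.N p)
  rw [← g_Nh_N, Nh_eq, g_of_horizontal h, normalReeb_eq]
  have h1 := F.N_unit p
  rw [ContactSubRiemannian.g] at h1
  linarith

theorem normNh_sq : F.normNh p = √(1 - F.normalReeb p ^ 2) := by
  rw [normNh, g_Nh_Nh]

/-- If the tangent plane is horizontal it contains N_h, so |N_h|² = ⟨N_h, N⟩ = 0. Conversely N_h = 0
makes N a multiple of T, so the tangent plane lies in ker η and equals it by dimension. The
inequality form shows that regularity is an open condition. -/
theorem sq_lt_one_iff : F.normalReeb p ^ 2 < 1 ↔ p ∉ F.singularSet := by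
  have h := eta_horiz (C := C) (F.φ p) (F.N p)
  constructor
  · intro hlt hp
    have h1 : F.Nh p ∈ Set.range (mfderiv (𝓡 2) (𝓡 3) F.φ p) := by
      have h2 : Set.range (mfderiv (𝓡 2) (𝓡 3) F.φ p) = {u | C.eta (F.φ p) u = 0} := hp
      rw [h2, Nh_eq]
      exact h
    obtain ⟨a, ha⟩ := h1
    have h2 := F.N_normal p a
    rw [ha] at h2
    have h3 : C.g (F.φ p) (F.N p) (F.Nh p) = C.g (F.φ p) (F.Nh p) (F.N p) := by
      have h4 : C.eta (F.φ p) (F.Nh p) = 0 := by rw [Nh_eq]; exact h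
      rw [g_of_horizontal h4, ContactSubRiemannian.g, h4, mul_zero, add_zero]
      have h5 : C.horiz (F.φ p) (F.Nh p) = F.Nh p := by
        rw [ContactSubRiemannian.horiz, h4, zero_smul, sub_zero]
      rw [h5]
      exact C.gh_symm _ _ _ (eta_horiz _ _) h4
    rw [h3, g_Nh_N, g_Nh_Nh] at h2
    linarith
  · intro hp
    by_contra hge
    have h1 : ¬ 0 < C.g (F.φ p) (F.Nh p) (F.Nh p) := by
      rw [g_Nh_Nh]
      linarith
    have h4 : C.eta (F.φ p) (F.Nh p) = 0 := by rw [Nh_eq]; exact h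
    have h5 : F.Nh p = 0 := by
      by_contra hne
      apply h1
      rw [g_of_horizontal h4, ContactSubRiemannian.horiz, h4, zero_smul, sub_zero]
      exact C.gh_pos _ _ h4 hne
    have h6 : F.N p = F.normalReeb p • C.reeb (F.φ p) := sub_eq_zero.1 h5
    have h7 : F.normalReeb p ^ 2 = 1 := by
      have := g_Nh_Nh (F := F) p
      rw [h5, ContactSubRiemannian.g, ContactSubRiemannian.horiz] at this
      simp at this
      linarith
    apply hp
    have hle : ∀ a, C.eta (F.φ p) (mfderiv (𝓡 2) (𝓡 3) F.φ p a) = 0 := by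
      intro a
      have h8 := F.N_normal p a
      rw [h6, ContactSubRiemannian.g, eta_reeb_smul, ContactSubRiemannian.horiz, eta_reeb_smul,
        sub_self, map_zero] at h8
      simp only [zero_apply, zero_add] at h8
      rcases mul_eq_zero.1 h8 with h9 | h9
      · rw [h9] at h7
        norm_num at h7
      · exact h9
    refine Set.Subset.antisymm ?_ fun u hu => ?_
    · rintro _ ⟨a, rfl⟩
      exact hle a
    · have h8 : C.eta (F.φ p) (C.reeb (F.φ p)) ≠ 0 := by
        rw [C.eta_reeb]
        exact one_ne_zero
      exact exists_eq_of_linearForm_eq_zero (F.immersion p) h8 hle hu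

end pointwise

end OrientedSurface

/-! ### The adapted frame and its tangent fields in charts -/

namespace OrientedSurface

open ChartTransport SurfaceChart MetricChart SasakianChart

variable {M : Type*} [TopologicalSpace M] [ChartedSpace E3 M] [IsManifold (𝓡 3) ∞ M]
  {C : ContactSubRiemannian M} {Sig : Type*} [TopologicalSpace Sig] [ChartedSpace E2 Sig]
  [IsManifold (𝓡 2) 2 Sig] (F : OrientedSurface C Sig)
  (e : OpenPartialHomeomorph M E3) (c : OpenPartialHomeomorph Sig E2)

/-- The vector field in charts on the surface that represents a tangent vector field along the
immersion. -/
def liftField (X : ∀ p : Sig, TangentSpace (𝓡 3) (F.φ p)) (q : E2) : E2 :=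
  dc c (c.symm q) (F.lift (c.symm q) (X (c.symm q)))

variable {F e c} (he : e ∈ IsManifold.maximalAtlas (𝓡 3) ∞ M)
  (hc : c ∈ IsManifold.maximalAtlas (𝓡 2) 2 Sig)
  (hφ : ContMDiffOn (𝓡 2) (𝓡 3) 3 (F.φ ∘ c.symm) c.target)

section pointwise

variable {q : E2} (hq : q ∈ F.chartDomain e c)

theorem chartMap_mem (hq : q ∈ F.chartDomain e c) : F.chartMap e c q ∈ e.target :=
  e.map_source hq.2

include he

include hq in
theorem g_eq_gChart {X Y : ∀ p : Sig, TangentSpace (𝓡 3) (F.φ p)} :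
    C.g (F.φ (c.symm q)) (X (c.symm q)) (Y (c.symm q))
      = C.gChart e (F.chartMap e c q) (F.chartField e c X q) (F.chartField e c Y q) :=
  C.g_eq he hq.2 _ _

omit he in
include hq in
theorem push_reeb : push e (F.φ (c.symm q)) (C.reeb (F.φ (c.symm q)))
    = C.reebChart e (F.chartMap e c q) := by
  have key : ∀ x', x' = F.φ (c.symm q) →
      push e (F.φ (c.symm q)) (C.reeb (F.φ (c.symm q))) = push e x' (C.reeb x') := by
    rintro _ rfl; rfl
  exact key _ (e.left_inv hq.2)

include hq in
theorem etaChart_chartField_N :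
    C.etaChart e (F.chartMap e c q) (F.chartField e c F.N q) = F.chartPsi c q :=
  (C.etaChart_push he hq.2 _).trans (normalReeb_eq _).symm

omit he in
include hq in
theorem chartField_Nh : F.chartField e c F.Nh q
    = F.chartField e c F.N q - F.chartPsi c q • C.reebChart e (F.chartMap e c q) := by
  rw [← push_reeb hq]
  exact ((push e (F.φ (c.symm q))).map_sub _ _).trans
    (congrArg (F.chartField e c F.N q - ·) ((push e (F.φ (c.symm q))).map_smul _ _))

omit he in
include hq in
theorem chartField_nu : F.chartField e c F.nu q = (F.chartNorm c q)⁻¹ •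
    (F.chartField e c F.N q - F.chartPsi c q • C.reebChart e (F.chartMap e c q)) := by
  rw [← chartField_Nh hq]
  exact (push e (F.φ (c.symm q))).map_smul _ _

omit he in
include hq in
theorem chartField_S : F.chartField e c F.S q
    = F.chartPsi c q • F.chartField e c F.nu q
      - F.chartNorm c q • C.reebChart e (F.chartMap e c q) := by
  rw [← push_reeb hq]
  exact ((push e (F.φ (c.symm q))).map_sub _ _).trans
    (congrArg₂ (· - ·) ((push e (F.φ (c.symm q))).map_smul _ _)
      ((push e (F.φ (c.symm q))).map_smul _ _))

include hq in
theorem chartField_Z : F.chartField e c F.Z q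
    = C.JChart e (F.chartMap e c q) (F.chartField e c F.nu q) :=
  C.push_J he hq.2 _

include hc hφ hq in
-- `lift` is defined by `Function.invFun`, which is meaningful only on the range of the
-- differential; orthogonality to N puts `v` there by a dimension count.
theorem fderiv_lift {v : TangentSpace (𝓡 3) (F.φ (c.symm q))}
    (hv : C.g (F.φ (c.symm q)) (F.N (c.symm q)) v = 0) (hC : C.IsSasakian) :
    fderiv ℝ (F.chartMap e c) q (dc c (c.symm q) (F.lift (c.symm q) v))
      = push e (F.φ (c.symm q)) v := by
  have hN : F.chartField e c F.N q ≠ 0 := fun h0 => by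
    have := chartField_N_unit he hq
    rw [h0] at this
    simp at this
  obtain ⟨b, hb⟩ := mem_range_of_orthogonal (A := (C.sasakianChart he hC).toMetricChart)
    (chartMap_mem hq) (fderiv_chartMap_injective he hc hφ hq) hN
    (chartField_N_normal he hc hφ hq) ((C.g_eq he hq.2 _ v).symm.trans hv)
  obtain ⟨a, rfl⟩ := dc_surjective hc (c.map_target hq.1) b
  have h1 : push e (F.φ (c.symm q)) (mfderiv (𝓡 2) (𝓡 3) F.φ (c.symm q) a)
      = push e (F.φ (c.symm q)) v := (fderiv_chartMap he hc hφ hq a).symm.trans hb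
  have h2 : mfderiv (𝓡 2) (𝓡 3) F.φ (c.symm q) a = v :=
    ((pull_push he hq.2 _).symm.trans (congrArg (pull e _) h1)).trans (pull_push he hq.2 v)
  have h3 : mfderiv (𝓡 2) (𝓡 3) F.φ (c.symm q) (F.lift (c.symm q) v) = v :=
    Function.invFun_eq ⟨a, h2⟩
  exact (fderiv_chartMap he hc hφ hq _).trans (congrArg (push e _) h3)

end pointwise

section regular

variable {q : E2} (hq : q ∈ F.regularDomain e c)

theorem chartNorm_eq (q : E2) : F.chartNorm c q = √(1 - F.chartPsi c q ^ 2) := normNh_sq _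

theorem chartNorm_pos (hq : q ∈ F.regularDomain e c) : 0 < F.chartNorm c q := by
  rw [chartNorm_eq]
  exact Real.sqrt_pos.2 (by linarith [hq.2])

theorem chartNorm_sq (hq : q ∈ F.regularDomain e c) :
    F.chartNorm c q ^ 2 + F.chartPsi c q ^ 2 = 1 := by
  rw [chartNorm_eq, Real.sq_sqrt (by linarith [hq.2])]
  ring

include hq

theorem chartField_N_eq : F.chartField e c F.N q = F.chartNorm c q • F.chartField e c F.nu q
    + F.chartPsi c q • C.reebChart e (F.chartMap e c q) := by
  rw [chartField_nu hq.1, smul_smul, mul_inv_cancel₀ (chartNorm_pos hq).ne', one_smul,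
    sub_add_cancel]

include he

theorem isFrame_chartField (hC : C.IsSasakian) : IsFrame (C.sasakianChart he hC)
    (F.chartMap e c q) (F.chartField e c F.nu q) (F.chartField e c F.Z q) := by
  have hy := chartMap_mem hq.1
  have hs := chartNorm_sq hq
  have hpos := chartNorm_pos hq
  set A := C.sasakianChart he hC with hA
  set x := F.chartMap e c q
  have hTT : A.G x (A.T x) (A.T x) = 1 := A.T_unit x hy
  have hNN : A.G x (F.chartField e c F.N q) (F.chartField e c F.N q) = 1 :=
    chartField_N_unit he hq.1
  have hTN : A.G x (A.T x) (F.chartField e c F.N q) = F.chartPsi c q :=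
    (C.gChart_reebChart_left he hy _).trans (etaChart_chartField_N he hq.1)
  have hNT := (A.symm x hy (F.chartField e c F.N q) (A.T x)).trans hTN
  have hν : F.chartField e c F.nu q = (F.chartNorm c q)⁻¹ •
    (F.chartField e c F.N q - F.chartPsi c q • A.T x) := chartField_nu hq.1
  have hZ : F.chartField e c F.Z q = A.J x (F.chartField e c F.nu q) := chartField_Z he hq.1
  have hTν : A.G x (A.T x) (F.chartField e c F.nu q) = 0 := by
    rw [hν]
    simp [hTN, hTT]
  have hνν : A.G x (F.chartField e c F.nu q) (F.chartField e c F.nu q) = 1 := by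
    have : A.G x (F.chartField e c F.nu q) (F.chartField e c F.nu q)
        = (F.chartNorm c q)⁻¹ ^ 2 * (1 - F.chartPsi c q ^ 2) := by
      rw [hν]
      simp [hTN, hTT, hNN, hNT]
      ring
    rw [this]
    field_simp
    linarith
  have hη : C.etaChart e x (F.chartField e c F.nu q) = 0 :=
    (C.gChart_reebChart_left he hy _).symm.trans hTν
  refine ⟨hνν, ?_, ?_, ?_, ?_, hZ.symm, ?_⟩
  · rw [hZ, A.J_isom x hy, hνν, hTν]
    norm_num
  · rw [hZ, A.symm x hy]
    exact J_skew_self hy _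
  · rw [A.symm x hy]
    exact hTν
  · rw [hZ, A.symm x hy]
    exact (C.gChart_reebChart_left he hy _).trans (C.etaChart_JChart he hy _)
  · rw [hZ]
    exact C.JChart_JChart he hy hη

include hc hφ

theorem fderiv_liftField_Z (hC : C.IsSasakian) :
    fderiv ℝ (F.chartMap e c) q (F.liftField c F.Z q) = F.chartField e c F.Z q := by
  have hf := isFrame_chartField he hq hC
  refine fderiv_lift he hc hφ hq.1 ?_ hC
  refine (g_eq_gChart he hq.1 (X := F.N) (Y := F.Z)).trans ?_
  rw [chartField_N_eq hq]
  have h1 : C.gChart e (F.chartMap e c q) (F.chartField e c F.nu q) (F.chartField e c F.Z q) = 0 :=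
    hf.νZ
  have h2 : C.gChart e (F.chartMap e c q) (C.reebChart e (F.chartMap e c q))
      (F.chartField e c F.Z q) = 0 :=
    (C.gChart_symm he (chartMap_mem hq.1) _ _).trans hf.ZT
  simp [h1, h2]

theorem fderiv_liftField_S (hC : C.IsSasakian) :
    fderiv ℝ (F.chartMap e c) q (F.liftField c F.S q) = F.chartField e c F.S q := by
  have hf := isFrame_chartField he hq hC
  refine fderiv_lift he hc hφ hq.1 ?_ hC
  refine (g_eq_gChart he hq.1 (X := F.N) (Y := F.S)).trans ?_
  rw [chartField_N_eq hq, chartField_S hq.1]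
  have h1 : C.gChart e (F.chartMap e c q) (F.chartField e c F.nu q) (F.chartField e c F.nu q) = 1 :=
    hf.νν
  have h2 : C.gChart e (F.chartMap e c q) (F.chartField e c F.nu q)
      (C.reebChart e (F.chartMap e c q)) = 0 := hf.νT
  have h3 : C.gChart e (F.chartMap e c q) (C.reebChart e (F.chartMap e c q))
      (F.chartField e c F.nu q) = 0 :=
    (C.gChart_symm he (chartMap_mem hq.1) _ _).trans h2
  have h4 : C.gChart e (F.chartMap e c q) (C.reebChart e (F.chartMap e c q))
      (C.reebChart e (F.chartMap e c q)) = 1 :=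
    (C.sasakianChart he hC).T_unit _ (chartMap_mem hq.1)
  simp [h1, h2, h3, h4]
  ring

end regular

section smoothness

include he hφ

theorem contDiffAt_comp_chartMap {Y : Type*} [NormedAddCommGroup Y] [NormedSpace ℝ Y]
    {f : E3 → Y} (hf : ContDiffOn ℝ ∞ f e.target) {q : E2} (hq : q ∈ F.chartDomain e c) :
    ContDiffAt ℝ 2 (fun p => f (F.chartMap e c p)) q :=
  ((hf.contDiffAt (e.open_target.mem_nhds (chartMap_mem hq))).of_le (by norm_cast)).comp q
    ((contDiffAt_chartMap he hφ hq).of_le (by norm_num))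

include hc

theorem contDiffAt_chartField_N (hC : C.IsSasakian) {q : E2} (hq : q ∈ F.chartDomain e c) :
    ContDiffAt ℝ 2 (F.chartField e c F.N) q :=
  contDiffAt_unit_normal (A := (C.sasakianChart he hC).toMetricChart) (isOpen_chartDomain hφ)
    (contDiffOn_chartMap he hφ) (fun _ hp => chartMap_mem hp)
    (fun _ hp => fderiv_chartMap_injective he hc hφ hp) (continuousOn_chartField_N he)
    (fun _ hp => chartField_N_unit he hp) (fun _ hp => chartField_N_normal he hc hφ hp) hq

theorem contDiffAt_chartPsi (hC : C.IsSasakian) {q : E2} (hq : q ∈ F.chartDomain e c) :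
    ContDiffAt ℝ 2 (F.chartPsi c) q := by
  have h := (contDiffAt_comp_chartMap he hφ (C.etaChart_smooth he) hq).clm_apply
    (contDiffAt_chartField_N he hc hφ hC hq)
  refine h.congr_of_eventuallyEq ?_
  filter_upwards [(isOpen_chartDomain hφ).mem_nhds hq] with p hp
  exact (etaChart_chartField_N he hp).symm

theorem isOpen_regularDomain (hC : C.IsSasakian) : IsOpen (F.regularDomain e c) := by
  have h : ContinuousOn (F.chartPsi c) (F.chartDomain e c) := fun p hp =>
    (contDiffAt_chartPsi he hc hφ hC hp).continuousAt.continuousWithinAt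
  exact (h.pow 2).isOpen_inter_preimage (isOpen_chartDomain hφ) (isOpen_gt' 1)

variable {q : E2} (hq : q ∈ F.regularDomain e c)
include hq

theorem contDiffAt_chartNorm (hC : C.IsSasakian) : ContDiffAt ℝ 2 (F.chartNorm c) q := by
  have h : ContDiffAt ℝ 2 (fun p => √(1 - F.chartPsi c p ^ 2)) q :=
    (contDiffAt_const.sub ((contDiffAt_chartPsi he hc hφ hC hq.1).pow 2)).sqrt
      (by linarith [hq.2])
  exact h.congr_of_eventuallyEq (Filter.Eventually.of_forall fun p => chartNorm_eq p)

theorem contDiffAt_chartField_nu (hC : C.IsSasakian) :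
    ContDiffAt ℝ 2 (F.chartField e c F.nu) q := by
  have h := ((contDiffAt_chartNorm he hc hφ hq hC).inv (chartNorm_pos hq).ne').smul
    ((contDiffAt_chartField_N he hc hφ hC hq.1).sub ((contDiffAt_chartPsi he hc hφ hC hq.1).smul
      (contDiffAt_comp_chartMap he hφ (C.reebChart_smooth he) hq.1)))
  refine h.congr_of_eventuallyEq ?_
  filter_upwards [(isOpen_chartDomain hφ).mem_nhds hq.1] with p hp
  exact chartField_nu hp

theorem contDiffAt_chartField_Z (hC : C.IsSasakian) :
    ContDiffAt ℝ 2 (F.chartField e c F.Z) q := by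
  have h := (contDiffAt_comp_chartMap he hφ (C.JChart_smooth he) hq.1).clm_apply
    (contDiffAt_chartField_nu he hc hφ hq hC)
  refine h.congr_of_eventuallyEq ?_
  filter_upwards [(isOpen_chartDomain hφ).mem_nhds hq.1] with p hp
  exact chartField_Z he hp

/-- The differential of the parametrization is C² and injective, so `z` solves a C² linear system.
-/
theorem contDiffAt_of_fderiv_chartMap_eq (hC : C.IsSasakian) {z : E2 → E2} {Z : E2 → E3}
    (hZ : ContDiffAt ℝ 2 Z q)
    (h : ∀ p ∈ F.regularDomain e c, fderiv ℝ (F.chartMap e c) p (z p) = Z p) :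
    ContDiffAt ℝ 2 z q := by
  refine contDiffAt_of_injective_clm (B := fderiv ℝ (F.chartMap e c))
    ((contDiffAt_chartMap he hφ hq.1).fderiv_right (by norm_num))
    (fderiv_chartMap_injective he hc hφ hq.1) hZ ?_
  filter_upwards [(isOpen_regularDomain he hc hφ hC).mem_nhds hq] with p hp using h p hp

end smoothness

end OrientedSurface

/-! ### Mean curvature and Jacobi operator in charts -/

namespace OrientedSurface

open ChartTransport SurfaceChart MetricChart SasakianChart

variable {M : Type*} [TopologicalSpace M] [ChartedSpace E3 M] [IsManifold (𝓡 3) ∞ M]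
  {C : ContactSubRiemannian M} {Sig : Type*} [TopologicalSpace Sig] [ChartedSpace E2 Sig]
  [IsManifold (𝓡 2) 2 Sig] {F : OrientedSurface C Sig}
  {e : OpenPartialHomeomorph M E3} {c : OpenPartialHomeomorph Sig E2}
  (he : e ∈ IsManifold.maximalAtlas (𝓡 3) ∞ M)
  (hc : c ∈ IsManifold.maximalAtlas (𝓡 2) 2 Sig)
  (hφ : ContMDiffOn (𝓡 2) (𝓡 3) 3 (F.φ ∘ c.symm) c.target) (hC : C.IsSasakian)

/-- The regular part of the surface in charts. -/
def framedSurface : FramedSurface (C.sasakianChart he hC) E2 where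
  U := F.regularDomain e c
  isOpen := isOpen_regularDomain he hc hφ hC
  x := F.chartMap e c
  ν := F.chartField e c F.nu
  Z := F.chartField e c F.Z
  u := fun q => F.chartPsi c q * (F.chartNorm c q)⁻¹
  z := F.liftField c F.Z
  -- From S = ψν - |N_h| T, division by -|N_h| gives T - uν.
  w := fun q => -(F.chartNorm c q)⁻¹ • F.liftField c F.S q
  mapsTo := fun _ hq => chartMap_mem hq.1
  x_smooth := fun q hq =>
    ((contDiffAt_chartMap he hφ hq.1).of_le (by norm_num)).contDiffWithinAt
  ν_smooth := fun q hq => (contDiffAt_chartField_nu he hc hφ hq hC).contDiffWithinAt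
  Z_smooth := fun q hq => (contDiffAt_chartField_Z he hc hφ hq hC).contDiffWithinAt
  u_smooth := fun q hq => ((contDiffAt_chartPsi he hc hφ hC hq.1).mul
    ((contDiffAt_chartNorm he hc hφ hq hC).inv (chartNorm_pos hq).ne')).contDiffWithinAt
  z_smooth := fun q hq => ((contDiffAt_of_fderiv_chartMap_eq he hc hφ hq hC
    (contDiffAt_chartField_Z he hc hφ hq hC)
    fun p hp => fderiv_liftField_Z he hc hφ hp hC).of_le (by norm_num)).contDiffWithinAt
  w_smooth := fun q hq => by
    have hS : ContDiffAt ℝ 2 (F.chartField e c F.S) q := by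
      have h := ((contDiffAt_chartPsi he hc hφ hC hq.1).smul
        (contDiffAt_chartField_nu he hc hφ hq hC)).sub ((contDiffAt_chartNorm he hc hφ hq hC).smul
          (contDiffAt_comp_chartMap he hφ (C.reebChart_smooth he) hq.1))
      refine h.congr_of_eventuallyEq ?_
      filter_upwards [(isOpen_chartDomain hφ).mem_nhds hq.1] with p hp
      exact chartField_S hp
    exact ((((contDiffAt_chartNorm he hc hφ hq hC).inv (chartNorm_pos hq).ne').neg.smul
      (contDiffAt_of_fderiv_chartMap_eq he hc hφ hq hC hS
        fun p hp => fderiv_liftField_S he hc hφ hp hC)).of_le (by norm_num)).contDiffWithinAt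
  frame := fun _ hq => isFrame_chartField he hq hC
  x_z := fun _ hq => fderiv_liftField_Z he hc hφ hq hC
  x_w := fun q hq => by
    rw [map_smul, fderiv_liftField_S he hc hφ hq hC, chartField_S hq.1, smul_sub, smul_smul,
      smul_smul, neg_mul, neg_mul, inv_mul_cancel₀ (chartNorm_pos hq).ne', mul_comm (_)⁻¹]
    simp only [neg_smul, one_smul]
    rw [sub_neg_eq_add, neg_add_eq_sub]
    rfl
  normal := fun q hq a => by
    have h1 : F.chartField e c F.nu q + (F.chartPsi c q * (F.chartNorm c q)⁻¹) •
        C.reebChart e (F.chartMap e c q) = (F.chartNorm c q)⁻¹ • F.chartField e c F.N q := by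
      rw [chartField_N_eq hq, smul_add, smul_smul, smul_smul,
        inv_mul_cancel₀ (chartNorm_pos hq).ne', one_smul, mul_comm (_)⁻¹]
    have h2 : C.gChart e (F.chartMap e c q) (fderiv ℝ (F.chartMap e c) q a)
        (F.chartField e c F.N q) = 0 :=
      (C.gChart_symm he (chartMap_mem hq.1) _ _).trans (chartField_N_normal he hc hφ hq.1 a)
    refine (congrArg (C.gChart e (F.chartMap e c q) (fderiv ℝ (F.chartMap e c) q a)) h1).trans ?_
    rw [map_smul, h2, smul_zero]
  inj := fun _ hq => fderiv_chartMap_injective he hc hφ hq.1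

section covDeriv

include hc hφ

/-- The hypothesis `hv` says that `v` is tangent to the surface, so that its lift is not a default
value. -/
theorem push_covDeriv {X : ∀ p : Sig, TangentSpace (𝓡 3) (F.φ p)} {q : E2}
    (hq : q ∈ F.chartDomain e c) (hX : DifferentiableAt ℝ (F.chartField e c X) q)
    {v : TangentSpace (𝓡 3) (F.φ (c.symm q))}
    (hv : fderiv ℝ (F.chartMap e c) q (dc c (c.symm q) (F.lift (c.symm q) v))
      = push e (F.φ (c.symm q)) v) :
    push e (F.φ (c.symm q)) (F.covDeriv e X (c.symm q) v)
      = (C.sasakianChart he hC).cov (F.chartMap e c) (F.chartField e c X) q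
        (dc c (c.symm q) (F.lift (c.symm q) v)) := by
  have hp := c.map_target hq.1
  have hr := c.right_inv hq.1
  have hy := chartMap_mem hq
  have key : ∀ w : E3, push e (F.φ (c.symm q)) (pull e (F.chartMap e c q) w) = w := by
    intro w
    have h := push_pull he hy w
    have h' : e.symm (F.chartMap e c q) = F.φ (c.symm q) := e.left_inv hq.2
    rwa [h'] at h
  refine (key _).trans ?_
  rw [cov_apply, hv, ← C.christoffel_eq he hC hy]
  refine congrArg (· + C.christoffel e (F.chartMap e c q) (push e (F.φ (c.symm q)) v)
    (F.chartField e c X q)) ?_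
  have h := mfderiv_eq hc hp (f := fun p => push e (F.φ p) (X p)) (g := F.chartField e c X) ?_
    (by rwa [hr]) (F.lift (c.symm q) v)
  · rw [hr] at h
    exact h
  · filter_upwards [c.open_source.mem_nhds hp] with p hp
    have key : ∀ p', p' = p → push e (F.φ p) (X p) = push e (F.φ p') (X p') := by
      rintro _ rfl; rfl
    exact key _ (c.left_inv hp)

end covDeriv

section meanCurvature

include hc hφ

/-- The S-term is zero by `inner_cov_ν_self`, and ⟨D_Z ν, Z⟩ = -⟨D_Z Z, ν⟩ by skew-symmetry. -/
theorem meanCurvature_eq {q : E2} (hq : q ∈ F.regularDomain e c) :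
    2 * F.meanCurvature e (c.symm q)
      = (C.sasakianChart he hC).G (F.chartMap e c q)
        ((C.sasakianChart he hC).cov (F.chartMap e c) (F.chartField e c F.Z) q
          (F.liftField c F.Z q)) (F.chartField e c F.nu q) := by
  set A := C.sasakianChart he hC with hA
  have hν : DifferentiableAt ℝ (F.chartField e c F.nu) q :=
    (contDiffAt_chartField_nu he hc hφ hq hC).differentiableAt (by norm_num)
  have h1 := push_covDeriv he hc hφ hC hq.1 hν (fderiv_liftField_Z he hc hφ hq hC)
  have h2 := push_covDeriv he hc hφ hC hq.1 hν (fderiv_liftField_S he hc hφ hq hC)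
  have h3 := (C.g_eq he (x := F.φ (c.symm q)) hq.1.2 (F.covDeriv e F.nu (c.symm q) (F.Z (c.symm q)))
    (F.Z (c.symm q))).trans (congrArg (fun t => C.gChart e _ t _) h1)
  have h4 := (C.g_eq he (x := F.φ (c.symm q)) hq.1.2 (F.covDeriv e F.nu (c.symm q) (F.S (c.symm q)))
    (F.S (c.symm q))).trans (congrArg (fun t => C.gChart e _ t _) h2)
  have h5 := FramedSurface.cov_ν_Z (F := framedSurface he hc hφ hC) hq (F.liftField c F.Z q)
  have hs : fderiv ℝ (F.chartMap e c) q (F.liftField c F.S q)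
      = F.chartPsi c q • F.chartField e c F.nu q
        + (-F.chartNorm c q) • A.T (F.chartMap e c q) := by
    rw [fderiv_liftField_S he hc hφ hq hC, chartField_S hq.1, neg_smul, sub_eq_add_neg]
    rfl
  have h6 := FramedSurface.inner_cov_ν_self (F := framedSurface he hc hφ hC) hq hs
  have h7 : A.G (F.chartMap e c q) (A.cov (F.chartMap e c) (F.chartField e c F.nu) q
      (F.liftField c F.S q)) (F.chartField e c F.S q) = 0 := by
    rw [← fderiv_liftField_S he hc hφ hq hC]
    exact h6
  rw [meanCurvature, h3, h4]
  have h9 : C.gChart e (F.chartMap e c q) (A.cov (F.chartMap e c) (F.chartField e c F.nu) q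
      (F.liftField c F.Z q)) (F.chartField e c F.Z q) = -A.G (F.chartMap e c q)
      (A.cov (F.chartMap e c) (F.chartField e c F.Z) q (F.liftField c F.Z q))
      (F.chartField e c F.nu q) := h5
  refine (congrArg₂ (fun a b : ℝ => 2 * (-(1 / 2 : ℝ) * (a + b))) h9 h7).trans ?_
  ring

end meanCurvature

section derivZ

include hc hφ

theorem derivZ_eq {f : Sig → ℝ} {g : E2 → ℝ} {q : E2} (hq : q ∈ F.chartDomain e c)
    (hfg : ∀ᶠ p in 𝓝 q, f (c.symm p) = g p) (hg : DifferentiableAt ℝ g q) :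
    F.derivZ f (c.symm q) = fderiv ℝ g q (F.liftField c F.Z q) := by
  have hp := c.map_target hq.1
  have hr := c.right_inv hq.1
  have h := mfderiv_eq hc hp (f := f) (g := g) ?_ (by rwa [hr])
    (F.lift (c.symm q) (F.Z (c.symm q)))
  · rw [hr] at h
    exact h
  · have h1 : Filter.Tendsto c (𝓝 (c.symm q)) (𝓝 q) := by
      have := c.continuousAt hp
      rwa [ContinuousAt, hr] at this
    filter_upwards [h1.eventually hfg, c.open_source.mem_nhds hp] with p h2 h3
    rwa [c.left_inv h3] at h2

end derivZ

section main

include hc hφ hC he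

theorem jacobiOperator_normalReeb {H : ℝ} (hH : F.HasConstantMeanCurvature H) {q : E2}
    (hq : q ∈ F.regularDomain e c) : F.jacobiOperator e F.normalReeb (c.symm q) = 0 := by
  set A := C.sasakianChart he hC with hA
  have hU := isOpen_regularDomain he hc hφ hC
  have hψ : ∀ p ∈ F.regularDomain e c, ContDiffAt ℝ 2 (F.chartPsi c) p :=
    fun p hp => contDiffAt_chartPsi he hc hφ hC hp.1
  have J := FramedSurface.jacobi_equation (F := framedSurface he hc hφ hC) (by simp) (H := H)
    (fun p hp => by
      rw [← hH _ ((sq_lt_one_iff _).1 hp.2) e he hp.1.2]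
      exact (meanCurvature_eq he hc hφ hC hp).symm)
    (fun p hp => (contDiffAt_chartNorm he hc hφ hp hC).contDiffWithinAt)
    (fun p hp => (hψ p hp).contDiffWithinAt) (fun p hp => chartNorm_pos hp)
    (fun p hp => chartNorm_sq hp) (fun p hp => (inv_mul_cancel_right₀ (chartNorm_pos hp).ne' _).symm)
    (fun p hp => chartField_N_eq hp) hq
  have hN : DifferentiableAt ℝ (F.chartField e c F.N) q :=
    (contDiffAt_chartField_N he hc hφ hC hq.1).differentiableAt (by norm_num)
  have d1 : ∀ p ∈ F.regularDomain e c, F.derivZ F.normalReeb (c.symm p)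
      = fderiv ℝ (F.chartPsi c) p (F.liftField c F.Z p) := fun p hp =>
    derivZ_eq hc hφ hp.1 (Filter.Eventually.of_forall fun _ => rfl)
      ((hψ p hp).differentiableAt (by norm_num))
  have hz : DifferentiableAt ℝ (F.liftField c F.Z) q :=
    FramedSurface.dz (F := framedSurface he hc hφ hC) hq
  have d2 : F.derivZ (F.derivZ F.normalReeb) (c.symm q)
      = fderiv ℝ (fun p => fderiv ℝ (F.chartPsi c) p (F.liftField c F.Z p)) q
        (F.liftField c F.Z q) := by
    refine derivZ_eq hc hφ hq.1 ?_ ((((hψ q hq).fderiv_right (m := 1)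
      (by norm_num)).differentiableAt (by norm_num)).clm_apply hz)
    filter_upwards [hU.mem_nhds hq] with p hp using d1 p hp
  have hW := C.websterCurvature_eq he hC (x := F.φ (c.symm q)) hq.1.2 (isFrame_chartField he hq hC)
  have hB : push e (F.φ (c.symm q)) (F.shape e (c.symm q) (F.Z (c.symm q)))
      = -A.cov (F.chartMap e c) (F.chartField e c F.N) q (F.liftField c F.Z q) :=
    ((push e (F.φ (c.symm q))).map_neg _).trans (congrArg (- ·)
      (push_covDeriv he hc hφ hC hq.1 hN (fderiv_liftField_Z he hc hφ hq hC)))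
  have hS : push e (F.φ (c.symm q)) (F.S (c.symm q))
      = F.chartPsi c q • F.chartField e c F.nu q
        - F.chartNorm c q • A.T (F.chartMap e c q) := chartField_S hq.1
  have hBS := ((push e (F.φ (c.symm q))).map_add (F.shape e (c.symm q) (F.Z (c.symm q)))
    (F.S (c.symm q))).trans (congrArg₂ (· + ·) hB hS)
  have g1 := (C.g_eq he (x := F.φ (c.symm q)) hq.1.2 (F.shape e (c.symm q) (F.Z (c.symm q))) (F.S (c.symm q))).trans
    (congrArg₂ (fun a b => C.gChart e _ a b) hB hS)
  have g2 := (C.g_eq he (x := F.φ (c.symm q)) hq.1.2 (F.shape e (c.symm q) (F.Z (c.symm q)) + F.S (c.symm q))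
    (F.shape e (c.symm q) (F.Z (c.symm q)) + F.S (c.symm q))).trans
    (congrArg₂ (fun a b => C.gChart e _ a b) hBS hBS)
  simp only [jacobiOperator]
  rw [d1 q hq, d2, g1, g2, hW]
  refine mul_eq_zero_of_right _ (Eq.trans ?_ J)
  -- With K = (κ + 3)/4 the zeroth-order coefficient 4(K - 1) becomes κ - 1, as in
  -- `jacobi_equation`.
  have h4 : ∀ κ : ℝ, 4 * (1 / 4 * (κ + 3) - 1) = κ - 1 := fun κ => by ring
  rw [h4]
  rfl

theorem contMDiffAt_normalReeb {p : Sig} (hp : p ∈ c.source) (hpe : F.φ p ∈ e.source) :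
    ContMDiffAt (𝓡 2) 𝓘(ℝ, ℝ) 2 F.normalReeb p := by
  have hq : c p ∈ F.chartDomain e c :=
    ⟨c.map_source hp, by simpa [c.left_inv hp] using hpe⟩
  have h1 : ContMDiffAt (𝓡 2) (𝓡 2) 2 c p :=
    (contMDiffOn_of_mem_maximalAtlas hc).contMDiffAt (c.open_source.mem_nhds hp)
  have h2 := (contDiffAt_chartPsi he hc hφ hC hq).contMDiffAt.comp p h1
  refine h2.congr_of_eventuallyEq ?_
  filter_upwards [c.open_source.mem_nhds hp] with p' hp'
  simp [chartPsi, c.left_inv hp']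

end main

end OrientedSurface

end

/-! ### Conclusion -/

theorem mainTheorem3 {M : Type*} [TopologicalSpace M] [T2Space M] [SecondCountableTopology M]
    [ConnectedSpace M] [ChartedSpace E3 M] [IsManifold (𝓡 3) ∞ M]
    (C : ContactSubRiemannian M) (hC : C.IsSasakian)
    {Sig : Type*} [TopologicalSpace Sig] [ChartedSpace E2 Sig] [IsManifold (𝓡 2) 2 Sig]
    (F : OrientedSurface C Sig) (hF : F.IsC3OffSingularSet)
    (H : ℝ) (hH : F.HasConstantMeanCurvature H) :
    F.IsJacobiFunction F.normalReeb := by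
  constructor
  · intro p hp
    obtain ⟨c, hc, hpc, hφ⟩ := hF p hp
    -- The regularity of ψ does not involve a chart of M, so the preferred one at φ(p) is used; the
    -- equation below is proved for every chart `e`.
    exact (OrientedSurface.contMDiffAt_normalReeb (IsManifold.chart_mem_maximalAtlas (F.φ p))
      hc hφ hC hpc (mem_chart_source E3 (F.φ p))).contMDiffWithinAt
  · intro p hp e he hpe
    obtain ⟨c, hc, hpc, hφ⟩ := hF p hp
    have h := c.left_inv hpc
    have hq : c p ∈ F.regularDomain e c :=
      ⟨⟨c.map_source hpc, by simpa [h] using hpe⟩, by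
        simpa [OrientedSurface.chartPsi, h] using (OrientedSurface.sq_lt_one_iff p).2 hp⟩
    have := OrientedSurface.jacobiOperator_normalReeb he hc hφ hC hH hq
    rwa [h] at this
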